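/- Let $\varepsilon,\tau>0$. For $t>0$, $x_1,x_2\in\mathbb R$ and integers $m_1,m_2\ge 0$ let \begin{align*} K(x_1,m_1;x_2,m_2)=&-\frac{\chi_{m_1<m_2}}{2\pi i}\oint_{\Gamma_0}(1-\varepsilon w)^{[m_1/2]-[m_2/2]}(1-\varepsilon/w)^{[(m_1+1)/2]-[(m_2+1)/2]}w^{[x_1]-[x_2]}\frac{dw}{w}\\ &+\frac1{(2\pi i)^2}\oint_{\Gamma_0}dw\oint_{\Gamma_{\varepsilon,\varepsilon^{-1}}}dz\,\frac{e^{t(w+1/w)}(1-\varepsilon w)^{[m_1/2]}(1-\varepsilon/w)^{[(m_1+1)/2]}w^{[x_1]}}{e^{t(z+1/z)}(1-\varepsilon z)^{[m_2/2]}(1-\varepsilon/z)^{[(m_2+1)/2]}z^{[x_2]}}\,\frac1{z(w-z)} \end{align*} be the correlation kernel at time $t$ of the interlacing particle system with parameter $\varepsilon$. Here $[\cdot]$ is the integer part (floor), $\chi_{m_1<m_2}$ is $1$ if $m_1<m_2$ and $0$ otherwise, $\Gamma_0$ encircles $0$ but not $\varepsilon,\varepsilon^{-1}$, and $\Gamma_{\varepsilon,\varepsilon^{-1}}$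 encircles $\varepsilon$ and $\varepsilon^{-1}$ but neither $0$ nor $\Gamma_0$. Both contours are anti-clockwise and disjoint. Let $\mathbb H=\{z\in\mathbb C:\operatorname{Im}z>0\}$ and, for $\xi\in\mathbb R$, $\mu\ge0$, let $F:\mathbb H\to\mathbb C$, $$F(z)=\tau(z+z^{-1})+\frac{\mu}{2}\log\bigl(1+\varepsilon^2-\varepsilon(z+z^{-1})\bigr)-\xi\log z .$$ Let $\mathcal D_1$ be the set of $(\xi,\mu)\in\mathbb R\times[0,\infty)$ for which $F'(z)=0$ has a solution $z\in\mathbb H$, and let $\mathcal D_2$ be the part of the complement of $\mathcal D_1$ lying above $\mathcal D_1$, i.e. the set of $(\xi,\mu)\notin\mathcal D_1$ such that $(\xi,\mu')\in\mathcal D_1$ for some $\mu'<\mu$. (1) If $\varepsilon\neq1$, the boundary $\partial\mathcal D_1$ has exactly two cusp points, located at $\bigl(0,\,2\tau(\varepsilon+\varepsilon^{-1}\pm2)\bigr)$. That is, at these two points $\partial\mathcal D_1$ is locally a smooth arc $\gamma$ having an ordinary (semicubical) cusp ($\gamma'=0$, with $\gamma''$ and $\gamma'''$ linearly independent there), and near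 every other of its points $\partial\mathcal D_1$ is a smooth regular curve. (2) For $(\xi,\mu)\in\mathcal D_1$ the equation $F'(z)=0$ has a unique solution $z(\xi,\mu)$ in $\mathbb H$. For all $\xi\in\mathbb R$ and $\mu\ge0$, with $t=\tau L$, $m=[\mu L]$, $x=[\xi L]$, $$\lim_{L\to\infty}K(x,m;x,m)=\begin{cases}1,&(\xi,\mu)\in\mathcal D_2,\\ \frac1\pi\arg z(\xi,\mu),&(\xi,\mu)\in\mathcal D_1,\\ 0,&\text{otherwise.}\end{cases}$$ -/

import Mathlib

open Filter Topology
open scoped ContDiff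

noncomputable section

/-- The correlation kernel `K(x₁, m₁; x₂, m₂)` at time `t` of the interlacing particle system
with parameter `ε > 0`.

The contour `Γ₀` is the circle of radius `min ε ε⁻¹ / 4` around `0`; it leaves `ε` and `ε⁻¹`
outside.  The contour `Γ_{ε,ε⁻¹}` is the circle with centre `(ε + ε⁻¹) / 2` and radius
`max ε ε⁻¹ / 2`; it meets the positive real axis at `min ε ε⁻¹ / 2` and at
`max ε ε⁻¹ + min ε ε⁻¹ / 2`, so it encircles `ε` and `ε⁻¹` but neither `0` nor `Γ₀`.
Both are oriented anti-clockwise; by Cauchy's theorem any other choice of such contours gives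
the same kernel. -/
def corrKernel (ε t x₁ : ℝ) (m₁ : ℕ) (x₂ : ℝ) (m₂ : ℕ) : ℂ :=
  -(if m₁ < m₂ then (1 : ℂ) else 0) / (2 * Real.pi * Complex.I) *
      (∮ w in C(0, min ε ε⁻¹ / 4),
        (1 - ε * w) ^ (((m₁ / 2 : ℕ) : ℤ) - ((m₂ / 2 : ℕ) : ℤ)) *
        (1 - ε / w) ^ ((((m₁ + 1) / 2 : ℕ) : ℤ) - (((m₂ + 1) / 2 : ℕ) : ℤ)) *
        w ^ (⌊x₁⌋ - ⌊x₂⌋) / w) +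
  1 / (2 * Real.pi * Complex.I) ^ 2 *
      (∮ w in C(0, min ε ε⁻¹ / 4), ∮ z in C(((ε + ε⁻¹) / 2 : ℝ), max ε ε⁻¹ / 2),
        (Complex.exp (t * (w + 1 / w)) *
            (1 - ε * w) ^ (m₁ / 2) * (1 - ε / w) ^ ((m₁ + 1) / 2) * w ^ ⌊x₁⌋) /
          (Complex.exp (t * (z + 1 / z)) *
            (1 - ε * z) ^ (m₂ / 2) * (1 - ε / z) ^ ((m₂ + 1) / 2) * z ^ ⌊x₂⌋) *
        (1 / (z * (w - z))))

/-- The function `F(z) = τ (z + z⁻¹) + (μ/2) log (1 + ε² - ε (z + z⁻¹)) - ξ log z`, used in the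
open upper half-plane, where both principal logarithms are holomorphic. -/
def actionF (ε τ ξ μ : ℝ) (z : ℂ) : ℂ :=
  τ * (z + z⁻¹) + μ / 2 * Complex.log (1 + ε ^ 2 - ε * (z + z⁻¹)) - ξ * Complex.log z

/-- `z` is a critical point of `F` in the open upper half-plane. -/
def IsUpperCritical (ε τ ξ μ : ℝ) (z : ℂ) : Prop :=
  0 < z.im ∧ deriv (actionF ε τ ξ μ) z = 0

/-- The domain `𝒟₁`: pairs `(ξ, μ)` for which `F` has a critical point in the upper half-plane. -/
def domainD1 (ε τ : ℝ) : Set (ℝ × ℝ) :=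
  {p | 0 ≤ p.2 ∧ ∃ z : ℂ, IsUpperCritical ε τ p.1 p.2 z}

/-- The domain `𝒟₂`: the part of the complement of `𝒟₁` that lies above `𝒟₁`
(its lower boundary curve included). -/
def domainD2 (ε τ : ℝ) : Set (ℝ × ℝ) :=
  {p | p ∉ domainD1 ε τ ∧ ∃ μ' < p.2, (p.1, μ') ∈ domainD1 ε τ}

/-- `γ` restricted to `[-1, 1]` is an injective smooth arc with `γ 0 = p` which parametrizes
the planar set `S` near `p`. -/
def IsLocalArc (S : Set (ℝ × ℝ)) (p : ℝ × ℝ) (γ : ℝ → ℝ × ℝ) : Prop :=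
  ContDiff ℝ ∞ γ ∧ Set.InjOn γ (Set.Icc (-1) 1) ∧ γ 0 = p ∧
    ∃ U ∈ 𝓝 p, S ∩ U = γ '' Set.Icc (-1) 1 ∩ U

/-- Near `p` the set `S` is a smooth regular curve. -/
def IsRegularCurvePoint (S : Set (ℝ × ℝ)) (p : ℝ × ℝ) : Prop :=
  ∃ γ : ℝ → ℝ × ℝ, IsLocalArc S p γ ∧ deriv γ 0 ≠ 0

/-- The set `S` has an (ordinary, i.e. semicubical) cusp at `p`: near `p` it is a smooth arc `γ`
with vanishing velocity at `p`, the second and third derivatives being linearly independent. -/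
def IsCuspPoint (S : Set (ℝ × ℝ)) (p : ℝ × ℝ) : Prop :=
  ∃ γ : ℝ → ℝ × ℝ, IsLocalArc S p γ ∧ deriv γ 0 = 0 ∧
    LinearIndependent ℝ ![iteratedDeriv 2 γ 0, iteratedDeriv 3 γ 0]

end

/-!
Write `a = ε + ε⁻¹`, `u = z + z⁻¹` and `z = exp (σ + iθ)` with `C = cosh σ` and `c = cos θ`; these are
elliptic coordinates for `u`.

*Critical points.*  In these coordinates `F'(z) = 0` is a linear system for `ξ` and `μ`
(`isUpperCritical_exp_iff`), with solution `ξ = critSpeed σ c`, `μ = critLevel σ c`.  The critical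
points are also the zeros of a real quartic whose constant term is the negative of its leading
coefficient, so that at most one pair of them is not real (`IsUpperCritical.unique`).  For fixed `c`
the map `σ ↦ ξ` is an increasing bijection of `ℝ`; for fixed `ξ` the level `μ` becomes a continuous
function of `c ∈ [-1, 1]`, injective on the open interval by uniqueness.  Hence `𝒟₁` is the region
between the graphs that belong to `c = 1` (lower) and `c = -1` (upper), where the pair of critical
points merges on the real axis (`exists_domainD1_eq`).

*The boundary.*  Both graphs are parametrized by `σ`, and for `ε ≠ 1` the velocity of the parametrization vanishes
only at `σ = 0`, to second order in the component `ξ` and to first order in the component `μ`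
(`hasDerivAt_crit`).  This is a semicubical cusp at `σ = 0`, a smooth regular curve elsewhere
(`frontier_domainD1`).

*The density.*  The kernel on the diagonal is a double contour integral of `g w / (g z z (w - z))`.  The
`z`-contour is deformed to the level curve `‖a - u‖ = ρ` through the saddle point
(`corrKernel_diag_eq_level`).  On it the modulus of `(1 - ε z) (1 - ε / z)` is constant, so the large
parameter enters only through `exp (τ L u)` and the power of `z`, and a comparison of tangents shows
that `‖g z‖` has its strict minimum at the saddle point (`level_action_pos`, up to factors bounded
uniformly in the scale).  The `w`-contour is the circle around `0` through the saddle point, on which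
`‖g w‖` is at most a constant multiple of its value there, since its logarithm is a concave function of
`cos (arg w)` (`exists_norm_weight_le`).  The remaining singularity at the crossing of the contours is
integrable (`exists_norm_cauchyInt_le`), and by dominated convergence the double integral tends to `0`.
What is left is the residue at `w = z`, which is picked up for those `z` on the level curve that lie
outside the circle; it is an integral of `dz / z` between the saddle point and its complex conjugate
and gives `θ / π` (`integral_indicator_levelDeriv`, `IsSaddle.tendsto_corrKernel`).

The same argument works with a real saddle point.  On the circle through it the maximum of `‖g‖` is
then attained at an end point of `cos (arg w) ∈ [-1, 1]`, which needs only an inequality for `μ`: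
above `𝒟₁` there is such a point with `θ = π`, below with `θ = 0`, and the density is `1` or `0`.
-/

/-! ### Contour integrals over circles and arcs -/

/-- The integral of `f` along the straight segment from `p` to `q`. -/
noncomputable def segInt (f : ℂ → ℂ) (p q : ℂ) : ℂ :=
  ∫ t in (0 : ℝ)..1, f (p + t * (q - p)) * (q - p)

theorem segInt_self (f : ℂ → ℂ) (p : ℂ) : segInt f p p = 0 := by
  simp [segInt]

theorem segInt_eq_sub {V : Set ℂ} (hV : Convex ℝ V) {f G : ℂ → ℂ}
    (hG : ∀ z ∈ V, HasDerivAt G (f z) z) (hf : ContinuousOn f V) {p q : ℂ}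
    (hp : p ∈ V) (hq : q ∈ V) : segInt f p q = G q - G p := by
  have hmem : ∀ t ∈ Set.Icc (0 : ℝ) 1, p + t * (q - p) ∈ V := by
    intro t ht
    have := hV.add_smul_sub_mem hp hq ht
    simpa using this
  have hline : ∀ t : ℝ, HasDerivAt (fun t : ℝ => p + t * (q - p)) (q - p) t := by
    intro t
    simpa using ((Complex.ofRealCLM.hasDerivAt (x := t)).mul_const (q - p)).const_add p
  have h := intervalIntegral.integral_eq_sub_of_hasDerivAt (a := (0 : ℝ)) (b := 1)
    (f := fun t : ℝ => G (p + t * (q - p))) (f' := fun t : ℝ => f (p + t * (q - p)) * (q - p))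
    (by
      intro t ht
      rw [Set.uIcc_of_le zero_le_one] at ht
      exact (hG _ (hmem t ht)).comp t (hline t))
    (by
      apply ContinuousOn.intervalIntegrable
      rw [Set.uIcc_of_le zero_le_one]
      exact (hf.comp (by fun_prop) hmem).mul continuousOn_const)
  rw [segInt, h]
  simp

/-- When the end points of a segment move inside the domain of holomorphy of `f`, the integral of
`f` over the segment changes by the integrals of `f` along the paths of the end points.  Locally
`f` has a primitive near the segment, because a neighbourhood of a segment can be chosen convex. -/
theorem segInt_sub_segInt {U : Set ℂ} (hU : IsOpen U) {f : ℂ → ℂ} (hf : DifferentiableOn ℂ f U)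
    {a b a' b' : ℝ → ℂ} {α β : ℝ} (hαβ : α ≤ β)
    (ha : ContinuousOn a (Set.Icc α β)) (hb : ContinuousOn b (Set.Icc α β))
    (hsub : ∀ s ∈ Set.Icc α β, segment ℝ (a s) (b s) ⊆ U)
    (ha' : ∀ s ∈ Set.Ioo α β, HasDerivAt a (a' s) s)
    (hb' : ∀ s ∈ Set.Ioo α β, HasDerivAt b (b' s) s)
    (hint : IntervalIntegrable (fun s => f (b s) * b' s - f (a s) * a' s) MeasureTheory.volume α β) :
    segInt f (a β) (b β) - segInt f (a α) (b α) =
      ∫ s in α..β, (f (b s) * b' s - f (a s) * a' s) := by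
  have loc : ∀ s₀ ∈ Set.Icc α β, ∃ G : ℂ → ℂ, ∃ V : Set ℂ, IsOpen V ∧ a s₀ ∈ V ∧ b s₀ ∈ V ∧
      (∀ z ∈ V, HasDerivAt G (f z) z) ∧
      ∀ p ∈ V, ∀ q ∈ V, segInt f p q = G q - G p := by
    intro s₀ hs₀
    have hcomp : IsCompact (segment ℝ (a s₀) (b s₀)) := by
      rw [segment_eq_image_lineMap]
      exact isCompact_Icc.image (by fun_prop)
    obtain ⟨δ, hδ, hδU⟩ := hcomp.exists_thickening_subset_open hU (hsub s₀ hs₀)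
    have hconv : Convex ℝ (Metric.thickening δ (segment ℝ (a s₀) (b s₀))) :=
      (convex_segment _ _).thickening δ
    obtain ⟨G, hG⟩ := hconv.exists_forall_hasDerivWithinAt (hf.mono hδU)
    have hG' : ∀ z ∈ Metric.thickening δ (segment ℝ (a s₀) (b s₀)), HasDerivAt G (f z) z :=
      fun z hz => (hG z hz).hasDerivAt (Metric.isOpen_thickening.mem_nhds hz)
    -- A thickening of a segment is convex, so the holomorphic function has a primitive there.
    refine ⟨G, _, Metric.isOpen_thickening,
      Metric.self_subset_thickening hδ _ (left_mem_segment ℝ _ _),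
      Metric.self_subset_thickening hδ _ (right_mem_segment ℝ _ _), hG', ?_⟩
    intro p hp q hq
    exact segInt_eq_sub hconv hG' (hf.mono hδU).continuousOn hp hq
  symm
  apply intervalIntegral.integral_eq_sub_of_hasDerivAt_of_le hαβ
    (f := fun s => segInt f (a s) (b s)) ?_ ?_ hint
  · intro s₀ hs₀
    obtain ⟨G, V, hV, hav, hbv, hG, hseg⟩ := loc s₀ hs₀
    have hca := ha s₀ hs₀
    have hcb := hb s₀ hs₀
    have hc : ContinuousWithinAt (fun s => G (b s) - G (a s)) (Set.Icc α β) s₀ :=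
      ((hG _ hbv).continuousAt.comp_continuousWithinAt hcb).sub
        ((hG _ hav).continuousAt.comp_continuousWithinAt hca)
    refine hc.congr_of_eventuallyEq ?_ (hseg _ hav _ hbv)
    filter_upwards [hca (hV.mem_nhds hav), hcb (hV.mem_nhds hbv)] with s h1 h2
    exact hseg _ h1 _ h2
  · intro s₀ hs₀
    obtain ⟨G, V, hV, hav, hbv, hG, hseg⟩ := loc s₀ (Set.Ioo_subset_Icc_self hs₀)
    have hca := ha' s₀ hs₀
    have hcb := hb' s₀ hs₀
    have hc : HasDerivAt (fun s => G (b s) - G (a s)) (f (b s₀) * b' s₀ - f (a s₀) * a' s₀) s₀ :=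
      ((hG _ hbv).comp s₀ hcb).sub ((hG _ hav).comp s₀ hca)
    refine hc.congr_of_eventuallyEq ?_
    filter_upwards [hca.continuousAt (hV.mem_nhds hav), hcb.continuousAt (hV.mem_nhds hbv)]
      with s h1 h2
    exact hseg _ h1 _ h2

/-- The arc of the circle of radius `exp (re ζ)` that runs from the angle `im ζ` to the angle
`2π - im ζ`, in the logarithmic coordinate, and the integral of `f (exp ·)` along it. -/
noncomputable def arcInt (f : ℂ → ℂ) (ζ : ℂ) : ℂ :=
  segInt (fun η => f (Complex.exp η)) ζ ((starRingEnd ℂ) ζ + 2 * Real.pi * Complex.I)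

theorem exp_conj_add_two_pi (ζ : ℂ) :
    Complex.exp ((starRingEnd ℂ) ζ + 2 * Real.pi * Complex.I) = Complex.exp ((starRingEnd ℂ) ζ) :=
  Complex.exp_periodic _

/-- When the point `exp (ζ s)` moves along a curve and sweeps its arcs through the domain of holomorphy
of `f`, the arc integral changes by the difference of the integrals of `f z / z` along the complex
conjugate of the curve and along the curve.  Only integrability of `ζ'` is asked, because the
derivative may be unbounded at the end points. -/
theorem arcInt_sub_arcInt {V : Set ℂ} (hV : IsOpen V) {f : ℂ → ℂ} (hf : DifferentiableOn ℂ f V)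
    {ζ ζ' : ℝ → ℂ} {α β : ℝ} (hαβ : α ≤ β)
    (hζ : ContinuousOn ζ (Set.Icc α β)) (hζ' : ∀ s ∈ Set.Ioo α β, HasDerivAt ζ (ζ' s) s)
    (hsub : ∀ s ∈ Set.Icc α β, 0 ≤ (ζ s).im ∧ (ζ s).im ≤ Real.pi ∧
      ∀ η ∈ Set.Icc (ζ s).im (2 * Real.pi - (ζ s).im),
        Complex.exp ((ζ s).re + η * Complex.I) ∈ V)
    (hint : IntervalIntegrable ζ' MeasureTheory.volume α β) :
    arcInt f (ζ β) - arcInt f (ζ α) =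
      ∫ s in α..β, (f (Complex.exp ((starRingEnd ℂ) (ζ s))) * (starRingEnd ℂ) (ζ' s)
        - f (Complex.exp (ζ s)) * ζ' s) := by
  have hsub' : ∀ s ∈ Set.Icc α β,
      segment ℝ (ζ s) ((starRingEnd ℂ) (ζ s) + 2 * Real.pi * Complex.I) ⊆ Complex.exp ⁻¹' V := by
    intro s hs z hz
    obtain ⟨h0, hπ, hmem⟩ := hsub s hs
    rw [segment_eq_image_lineMap] at hz
    obtain ⟨t, ht, rfl⟩ := hz
    have := hmem ((ζ s).im + t * (2 * Real.pi - 2 * (ζ s).im))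
      ⟨by nlinarith [ht.1, ht.2], by nlinarith [ht.1, ht.2]⟩
    rw [Set.mem_preimage]
    convert this using 2
    apply Complex.ext
    · simp [AffineMap.lineMap_apply]
    · simp [AffineMap.lineMap_apply]; ring
  have hconjc : ContinuousOn (fun s => (starRingEnd ℂ) (ζ s) + 2 * Real.pi * Complex.I)
      (Set.Icc α β) := (Complex.continuous_conj.comp_continuousOn hζ).add continuousOn_const
  have hcomp : ContinuousOn (fun s => f (Complex.exp (ζ s))) (Set.Icc α β) :=
    hf.continuousOn.comp (Complex.continuous_exp.comp_continuousOn hζ)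
      fun s hs => hsub' s hs (left_mem_segment ℝ _ _)
  have hcomp2 : ContinuousOn (fun s => f (Complex.exp ((starRingEnd ℂ) (ζ s)))) (Set.Icc α β) :=
    hf.continuousOn.comp (Complex.continuous_exp.comp_continuousOn
      (Complex.continuous_conj.comp_continuousOn hζ))
      fun s hs => by
        have := hsub' s hs (right_mem_segment ℝ _ _)
        rwa [Set.mem_preimage, exp_conj_add_two_pi] at this
  have key := segInt_sub_segInt (hV.preimage Complex.continuous_exp)
    (f := fun η => f (Complex.exp η))
    (hf.comp Complex.differentiable_exp.differentiableOn (fun z hz => hz))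
    hαβ hζ hconjc hsub' hζ' (b' := fun s => (starRingEnd ℂ) (ζ' s))
    (fun s hs => ((hζ' s hs).star).add_const _)
    (by
      simp only [exp_conj_add_two_pi]
      apply IntervalIntegrable.sub
      · have : IntervalIntegrable (fun s => (starRingEnd ℂ) (ζ' s)) MeasureTheory.volume α β := by
          rw [intervalIntegrable_iff] at hint ⊢
          exact (Complex.conjCLE.toContinuousLinearMap.integrable_comp hint)
        exact this.continuousOn_mul (by rwa [Set.uIcc_of_le hαβ])
      · exact hint.continuousOn_mul (by rwa [Set.uIcc_of_le hαβ]))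
  simp only [exp_conj_add_two_pi] at key
  exact key

theorem circleIntegral_eq_arcInt (f : ℂ → ℂ) (σ : ℝ) :
    (∮ z in C(0, Real.exp σ), f z / z) = arcInt f σ := by
  have h1 : (∮ z in C(0, Real.exp σ), f z / z) =
      ∫ θ in (0 : ℝ)..(2 * Real.pi), f (Complex.exp (σ + θ * Complex.I)) * Complex.I := by
    unfold circleIntegral
    apply intervalIntegral.integral_congr
    intro θ _
    have : circleMap 0 (Real.exp σ) θ = Complex.exp (σ + θ * Complex.I) := by
      simp [circleMap, Complex.exp_add]
    simp only [deriv_circleMap, smul_eq_mul, this]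
    field_simp [Complex.exp_ne_zero]
  have h3 := intervalIntegral.smul_integral_comp_mul_left (a := 0) (b := 1)
    (fun θ : ℝ => f (Complex.exp (σ + θ * Complex.I)) * Complex.I) (2 * Real.pi)
  rw [h1]
  simp only [mul_zero, mul_one] at h3
  rw [← h3, arcInt, segInt, ← intervalIntegral.integral_smul]
  apply intervalIntegral.integral_congr
  intro t _
  simp only [Complex.conj_ofReal, add_sub_cancel_left, Complex.real_smul]
  push_cast
  rw [show (σ : ℂ) + t * (2 * Real.pi * Complex.I) = σ + 2 * Real.pi * t * Complex.I by ring]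
  ring

/-- The arc integral over a degenerate arc at the negative real axis vanishes. -/
theorem arcInt_eq_zero (f : ℂ → ℂ) {ζ : ℂ} (h : ζ.im = Real.pi) : arcInt f ζ = 0 := by
  have : (starRingEnd ℂ) ζ + 2 * Real.pi * Complex.I = ζ := by
    apply Complex.ext <;> simp [h]; ring
  rw [arcInt, this, segInt_self]

theorem circleIntegral_swap {F : ℂ → ℂ → ℂ} {c₁ c₂ : ℂ} {r₁ r₂ : ℝ}
    (hF : ContinuousOn (Function.uncurry F) (Metric.sphere c₁ |r₁| ×ˢ Metric.sphere c₂ |r₂|)) :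
    (∮ w in C(c₁, r₁), ∮ z in C(c₂, r₂), F w z) = ∮ z in C(c₂, r₂), ∮ w in C(c₁, r₁), F w z := by
  have hcont : Continuous (fun p : ℝ × ℝ => deriv (circleMap c₁ r₁) p.1 *
      (deriv (circleMap c₂ r₂) p.2 * F (circleMap c₁ r₁ p.1) (circleMap c₂ r₂ p.2))) := by
    have h1 : Continuous (fun p : ℝ × ℝ => F (circleMap c₁ r₁ p.1) (circleMap c₂ r₂ p.2)) := by
      have := hF.comp_continuous (f := fun p : ℝ × ℝ => (circleMap c₁ r₁ p.1, circleMap c₂ r₂ p.2))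
        (by fun_prop) (fun p => ⟨by simp, by simp⟩)
      exact this
    have h2 (r : ℝ) := continuous_circleMap 0 r
    simp only [deriv_circleMap]
    exact (((h2 r₁).comp continuous_fst).mul continuous_const).mul
      ((((h2 r₂).comp continuous_snd).mul continuous_const).mul h1)
  unfold circleIntegral
  simp only [smul_eq_mul, ← intervalIntegral.integral_const_mul]
  rw [MeasureTheory.intervalIntegral_intervalIntegral_swap]
  · simp only [mul_left_comm]
  · apply (hcont.continuousOn.integrableOn_compact (isCompact_uIcc.prod isCompact_uIcc)).mono_set
    exact Set.prod_mono Set.uIoc_subset_uIcc Set.uIoc_subset_uIcc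

/-! ### The diagonal of the kernel as a contour integral -/

/-- The Cauchy integral `∮ g(w) / (w - z) dw` over the circle of radius `r` around `0`, without
the factor `1 / (2πi)`. -/
noncomputable def cauchyInt (g : ℂ → ℂ) (r : ℝ) (z : ℂ) : ℂ := ∮ w in C(0, r), g w / (w - z)

theorem circleIntegral_eq_of_annulus {f : ℂ → ℂ} {r R : ℝ} (hr : 0 < r) (hrR : r ≤ R)
    (hf : ∀ z : ℂ, r ≤ ‖z‖ → ‖z‖ ≤ R → DifferentiableAt ℂ f z) :
    (∮ z in C(0, R), f z) = ∮ z in C(0, r), f z := by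
  apply Complex.circleIntegral_eq_of_differentiable_on_annulus_off_countable hr hrR
    Set.countable_empty
  · intro z hz
    exact (hf z (by simpa using hz.2) (by simpa using hz.1)).continuousAt.continuousWithinAt
  · intro z hz
    have h1 : ‖z‖ < R := by simpa using hz.1.1
    have h2 : r < ‖z‖ := by simpa using hz.1.2
    exact hf z h2.le h1.le

theorem ne_zero_of_le_norm {r : ℝ} (hr : 0 < r) {z : ℂ} (h : r ≤ ‖z‖) : z ≠ 0 := by
  rintro rfl
  simp at h
  linarith

theorem cauchyInt_eq_of_norm_lt {g : ℂ → ℂ} (hg : DifferentiableOn ℂ g {0}ᶜ) {r R : ℝ}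
    (hrR : r ≤ R) {z : ℂ} (hz : ‖z‖ < r) : cauchyInt g R z = cauchyInt g r z := by
  have hr : 0 < r := (norm_nonneg z).trans_lt hz
  apply circleIntegral_eq_of_annulus hr hrR
  intro w hw _
  have hgw : DifferentiableAt ℂ g w :=
    hg.differentiableAt (isOpen_compl_singleton.mem_nhds (ne_zero_of_le_norm hr hw))
  refine hgw.div (by fun_prop) ?_
  intro h
  rw [sub_eq_zero.1 h] at hw
  linarith

/-- Enlarging the circle past `z` adds the residue `2πi g(z)` to the Cauchy integral. -/
theorem cauchyInt_eq_add_of_lt_norm {g : ℂ → ℂ} (hg : DifferentiableOn ℂ g {0}ᶜ) {r R : ℝ}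
    (hr : 0 < r) {z : ℂ} (hz : r < ‖z‖) (hzR : ‖z‖ < R) :
    cauchyInt g R z = cauchyInt g r z + 2 * Real.pi * Complex.I * g z := by
  have hR : 0 < R := hr.trans (hz.trans hzR)
  have hz0 : z ≠ 0 := ne_zero_of_le_norm hr hz.le
  have hnhds : ({0}ᶜ : Set ℂ) ∈ 𝓝 z := isOpen_compl_singleton.mem_nhds hz0
  have hd : DifferentiableOn ℂ (dslope g z) {0}ᶜ := (Complex.differentiableOn_dslope hnhds).2 hg
  have h1 : (∮ w in C(0, R), dslope g z w) = ∮ w in C(0, r), dslope g z w :=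
    circleIntegral_eq_of_annulus hr (hz.trans hzR).le fun w hw _ =>
      hd.differentiableAt (isOpen_compl_singleton.mem_nhds (ne_zero_of_le_norm hr hw))
  have h2 : ∀ ρ : ℝ, 0 < ρ → ρ ≠ ‖z‖ → (∮ w in C(0, ρ), dslope g z w) =
      cauchyInt g ρ z - g z * ∮ w in C(0, ρ), (w - z)⁻¹ := by
    intro ρ hρ hρz
    have hne : ∀ w ∈ Metric.sphere (0 : ℂ) ρ, w - z ≠ 0 := by
      intro w hw h
      rw [sub_eq_zero.1 h] at hw
      simp at hw
      exact hρz hw.symm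
    have hc1 : ContinuousOn (fun w => g w / (w - z)) (Metric.sphere (0 : ℂ) ρ) := by
      apply ContinuousOn.div _ (by fun_prop) hne
      apply hg.continuousOn.mono
      intro w hw
      exact ne_zero_of_le_norm hρ (by simpa using hw.ge)
    have hc2 : ContinuousOn (fun w => g z * (w - z)⁻¹) (Metric.sphere (0 : ℂ) ρ) :=
      continuousOn_const.mul (ContinuousOn.inv₀ (by fun_prop) hne)
    rw [cauchyInt, ← circleIntegral.integral_const_mul,
      ← circleIntegral.integral_sub (hc1.circleIntegrable hρ.le) (hc2.circleIntegrable hρ.le)]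
    apply circleIntegral.integral_congr hρ.le
    intro w hw
    have := hne w hw
    rw [dslope_of_ne _ (sub_ne_zero.1 this), slope_def_field]
    field_simp
  rw [h2 R hR hzR.ne', h2 r hr hz.ne, circleIntegral.integral_sub_inv_of_mem_ball (by simpa using hzR),
    Complex.circleIntegral_eq_zero_of_differentiable_on_off_countable (c := 0) (R := r)
      (f := fun w => (w - z)⁻¹) hr.le Set.countable_empty] at h1
  · linear_combination h1
  · apply ContinuousOn.inv₀ (by fun_prop)
    intro w hw h
    rw [sub_eq_zero.1 h] at hw
    simp at hw
    linarith
  · intro w hw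
    apply DifferentiableAt.inv (by fun_prop)
    intro h
    have hw := hw.1
    rw [sub_eq_zero.1 h] at hw
    simp at hw
    linarith

theorem differentiableOn_cauchyInt {g : ℂ → ℂ} (hg : DifferentiableOn ℂ g {0}ᶜ) {R : ℝ}
    (hR : 0 < R) : DifferentiableOn ℂ (cauchyInt g R) (Metric.ball 0 R) := by
  lift R to NNReal using hR.le
  have hc : CircleIntegrable g 0 R := by
    apply ContinuousOn.circleIntegrable hR.le
    apply hg.continuousOn.mono
    intro w hw
    exact ne_zero_of_le_norm hR (by simpa using hw.ge)
  have h := (hasFPowerSeriesOn_cauchy_integral hc (by exact_mod_cast hR)).differentiableOn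
  have h2 := h.const_mul (2 * Real.pi * Complex.I)
  have : Metric.eball (0 : ℂ) R = Metric.ball 0 R := Metric.eball_coe
  rw [this] at h2
  refine h2.congr ?_
  intro z _
  have hpi : (2 * Real.pi * Complex.I : ℂ) ≠ 0 := by simp [Real.pi_ne_zero]
  simp only [smul_eq_mul, cauchyInt]
  rw [mul_inv_cancel_left₀ hpi]
  congr 1
  ext w
  rw [div_eq_inv_mul]

theorem circleMap_two_pi_sub (A r s : ℝ) :
    circleMap A r (2 * Real.pi - s) = (starRingEnd ℂ) (circleMap A r s) := by
  simp only [circleMap, map_add, map_mul, Complex.conj_ofReal, ← Complex.exp_conj, Complex.conj_I]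
  rw [show ((2 * Real.pi - s : ℝ) : ℂ) * Complex.I = s * -Complex.I + 2 * Real.pi * Complex.I by
    push_cast; ring, Complex.exp_periodic]

theorem norm_exp_mul_I_sub_sq (r A η : ℝ) :
    ‖(r : ℂ) * Complex.exp (η * Complex.I) - A‖ ^ 2 = r ^ 2 + A ^ 2 - 2 * r * A * Real.cos η := by
  rw [← Complex.normSq_eq_norm_sq, Complex.exp_mul_I, Complex.normSq_apply]
  simp only [Complex.sub_re, Complex.mul_re, Complex.ofReal_re, Complex.add_re, Complex.cos_ofReal_re,
    Complex.sin_ofReal_re, Complex.I_re, mul_zero, Complex.sin_ofReal_im, Complex.I_im, mul_one,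
    Complex.ofReal_im, Complex.add_im, Complex.cos_ofReal_im, Complex.mul_im, Complex.sub_im]
  have := Real.sin_sq_add_cos_sq η
  linear_combination r ^ 2 * this

theorem cos_le_cos_of_mem_Icc {θ η : ℝ} (h0 : 0 ≤ θ)
    (hη : η ∈ Set.Icc θ (2 * Real.pi - θ)) : Real.cos η ≤ Real.cos θ := by
  rcases le_total η Real.pi with h | h
  · exact Real.cos_le_cos_of_nonneg_of_le_pi h0 h hη.1
  · rw [← Real.cos_two_pi_sub]
    exact Real.cos_le_cos_of_nonneg_of_le_pi h0 (by linarith) (by linarith [hη.2])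

/-- A circle with centre on the positive real axis that does not encircle `0` may be replaced by
the difference of the two circles around `0` that touch it, if the integrand is holomorphic
in the part of the annulus between them that lies outside the given circle. -/
theorem circleIntegral_eq_arcInt_sub {V : Set ℂ} (hV : IsOpen V) {f : ℂ → ℂ}
    (hf : DifferentiableOn ℂ f V) {A r : ℝ} (hr : 0 < r) (hrA : r < A)
    (hsub : ∀ z : ℂ, A - r ≤ ‖z‖ → ‖z‖ ≤ A + r → r ≤ ‖z - A‖ → z ∈ V) :
    (∮ z in C(A, r), f z / z) = arcInt f (Real.log (A + r)) - arcInt f (Real.log (A - r)) := by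
  set γ : ℝ → ℂ := circleMap A r with hγ
  have hre : ∀ s, 0 < (γ s).re := by
    intro s
    have : (γ s).re = A + r * Real.cos s := by simp [hγ, circleMap, Complex.exp_ofReal_mul_I_re]
    rw [this]
    nlinarith [Real.neg_one_le_cos s]
  have hslit : ∀ s, γ s ∈ Complex.slitPlane := fun s => Or.inl (hre s)
  have hne : ∀ s, γ s ≠ 0 := fun s => Complex.slitPlane_ne_zero (hslit s)
  have hγ' : ∀ s, HasDerivAt γ (circleMap 0 r s * Complex.I) s := hasDerivAt_circleMap _ _
  have hζ' : ∀ s, HasDerivAt (fun s => Complex.log (γ s)) (circleMap 0 r s * Complex.I / γ s) s :=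
    fun s => (hγ' s).clog_real (hslit s)
  have hdist : ∀ s, ‖γ s - A‖ = r := by
    intro s
    simp [hγ, circleMap, hr.le]
  have hnorm : ∀ s, A - r ≤ ‖γ s‖ ∧ ‖γ s‖ ≤ A + r := by
    intro s
    have h1 := norm_sub_norm_le (A : ℂ) (A - γ s)
    have h2 := norm_add_le (γ s - A) (A : ℂ)
    rw [norm_sub_rev, hdist] at h1
    rw [hdist] at h2
    have hA : ‖(A : ℂ)‖ = A := by simp [abs_of_pos (hr.trans hrA)]
    simp only [sub_sub_cancel, sub_add_cancel, hA] at h1 h2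
    constructor <;> linarith
  have hcont' : Continuous (fun s => circleMap 0 r s * Complex.I / γ s) :=
    ((continuous_circleMap 0 r).mul continuous_const).div (continuous_circleMap _ _) hne
  -- For the upper half of the circle, the arcs centred at `0` that start on it and end on its mirror
  -- image sweep the part of the annulus outside the circle.
  have key := arcInt_sub_arcInt hV hf (ζ := fun s => Complex.log (γ s)) Real.pi_pos.le
    (fun s _ => (hζ' s).continuousAt.continuousWithinAt) (fun s _ => hζ' s)
    (by
      intro s hs
      have him : 0 ≤ (γ s).im := by
        have : (γ s).im = r * Real.sin s := by simp [hγ, circleMap, Complex.exp_ofReal_mul_I_im]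
        rw [this]
        exact mul_nonneg hr.le (Real.sin_nonneg_of_mem_Icc hs)
      have harg : 0 ≤ (γ s).arg := Complex.arg_nonneg_iff.2 him
      simp only [Complex.log_im, Complex.log_re]
      refine ⟨harg, Complex.arg_le_pi _, fun η hη => ?_⟩
      have hpos : 0 < ‖γ s‖ := norm_pos_iff.2 (hne s)
      have hexp : Complex.exp ((Real.log ‖γ s‖ : ℝ) + η * Complex.I) =
          (‖γ s‖ : ℂ) * Complex.exp (η * Complex.I) := by
        rw [Complex.exp_add, ← Complex.ofReal_exp, Real.exp_log hpos]
      have hself : γ s = (‖γ s‖ : ℂ) * Complex.exp ((γ s).arg * Complex.I) :=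
        (Complex.norm_mul_exp_arg_mul_I _).symm
      have hcos := cos_le_cos_of_mem_Icc harg hη
      have h1 := norm_exp_mul_I_sub_sq ‖γ s‖ A η
      have h2 := norm_exp_mul_I_sub_sq ‖γ s‖ A (γ s).arg
      rw [← hself, hdist] at h2
      have hn : ‖(‖γ s‖ : ℂ) * Complex.exp (η * Complex.I)‖ = ‖γ s‖ := by
        simp [Complex.norm_exp_ofReal_mul_I]
      rw [hexp]
      apply hsub
      · rw [hn]; exact (hnorm s).1
      · rw [hn]; exact (hnorm s).2
      · apply le_of_sq_le_sq _ (norm_nonneg _)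
        rw [h1, h2]
        have : 0 ≤ 2 * ‖γ s‖ * A := by have := hr.trans hrA; positivity
        nlinarith)
    (hcont'.intervalIntegrable _ _)
  have hfc : Continuous (fun s => f (γ s)) := by
    apply hf.continuousOn.comp_continuous (continuous_circleMap _ _)
    intro s
    exact hsub _ (hnorm s).1 (hnorm s).2 (hdist s).ge
  have hint : Continuous (fun s => circleMap 0 r s * Complex.I * (f (γ s) / γ s)) :=
    ((continuous_circleMap 0 r).mul continuous_const).mul (hfc.div (continuous_circleMap _ _) hne)
  have hlhs : (∮ z in C(A, r), f z / z) =
      ∫ s in (0 : ℝ)..2 * Real.pi, circleMap 0 r s * Complex.I * (f (γ s) / γ s) := by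
    simp only [circleIntegral, deriv_circleMap, smul_eq_mul, hγ]
  have hsplit := intervalIntegral.integral_add_adjacent_intervals
    (hint.intervalIntegrable (μ := MeasureTheory.volume) 0 Real.pi)
    (hint.intervalIntegrable Real.pi (2 * Real.pi))
  -- The lower half of the circle is the complex conjugate of the upper half.
  have hrefl := intervalIntegral.integral_comp_sub_left (a := 0) (b := Real.pi)
    (fun s => circleMap 0 r s * Complex.I * (f (γ s) / γ s)) (2 * Real.pi)
  rw [sub_zero, show 2 * Real.pi - Real.pi = Real.pi by ring] at hrefl
  have hint2 : Continuous (fun s => circleMap 0 r (2 * Real.pi - s) * Complex.I *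
      (f (γ (2 * Real.pi - s)) / γ (2 * Real.pi - s))) :=
    hint.comp (continuous_const.sub continuous_id)
  rw [hlhs, ← hsplit, ← hrefl, ← intervalIntegral.integral_add (hint.intervalIntegrable _ _)
    (hint2.intervalIntegrable _ _)]
  have h0 : γ 0 = ((A + r : ℝ) : ℂ) := by simp [hγ, circleMap]
  have hpi : γ Real.pi = ((A - r : ℝ) : ℂ) := by simp [hγ, circleMap]; ring
  rw [h0, hpi, ← Complex.ofReal_log (by linarith), ← Complex.ofReal_log (by linarith)] at key
  rw [← neg_sub (arcInt f _), key, ← intervalIntegral.integral_neg]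
  apply intervalIntegral.integral_congr
  intro s _
  have e1 : circleMap 0 r (2 * Real.pi - s) = (starRingEnd ℂ) (circleMap 0 r s) := by
    have := circleMap_two_pi_sub 0 r s
    simpa using this
  have e2 : γ (2 * Real.pi - s) = (starRingEnd ℂ) (γ s) := circleMap_two_pi_sub A r s
  have hz := hne s
  have hz' : (starRingEnd ℂ) (γ s) ≠ 0 := by simpa using hz
  simp only [e1, e2, Complex.exp_conj, Complex.exp_log hz, map_div₀, map_mul, Complex.conj_I]
  field_simp
  ring

/-- The function whose values at `w` and `z` form the quotient in the double integral of the
kernel: `k` and `l` are the exponents of the two linear factors, `x` is the position. -/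
noncomputable def weight (ε t : ℝ) (k l : ℕ) (x : ℤ) (w : ℂ) : ℂ :=
  Complex.exp (t * (w + 1 / w)) * (1 - ε * w) ^ k * (1 - ε / w) ^ l * w ^ x

theorem differentiableAt_weight (ε t : ℝ) (k l : ℕ) (x : ℤ) {w : ℂ} (hw : w ≠ 0) :
    DifferentiableAt ℂ (weight ε t k l x) w := by
  unfold weight
  have h1 : DifferentiableAt ℂ (fun w : ℂ => 1 / w) w :=
    (differentiableAt_const _).div differentiableAt_id hw
  have h2 : DifferentiableAt ℂ (fun w : ℂ => (ε : ℂ) / w) w :=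
    (differentiableAt_const _).div differentiableAt_id hw
  have h3 : DifferentiableAt ℂ (fun w : ℂ => w ^ x) w := differentiableAt_zpow.2 (Or.inl hw)
  fun_prop

theorem differentiableOn_weight (ε t : ℝ) (k l : ℕ) (x : ℤ) :
    DifferentiableOn ℂ (weight ε t k l x) {0}ᶜ :=
  fun _ hw => (differentiableAt_weight ε t k l x hw).differentiableWithinAt

theorem weight_ne_zero {ε : ℝ} (hε : 0 < ε) (t : ℝ) (k l : ℕ) (x : ℤ) {w : ℂ} (hw : w ≠ 0)
    (h1 : w ≠ ε) (h2 : w ≠ (ε⁻¹ : ℝ)) : weight ε t k l x w ≠ 0 := by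
  have hεc : (ε : ℂ) ≠ 0 := by exact_mod_cast hε.ne'
  unfold weight
  refine mul_ne_zero (mul_ne_zero (mul_ne_zero (Complex.exp_ne_zero _) (pow_ne_zero _ ?_))
    (pow_ne_zero _ ?_)) (zpow_ne_zero _ hw)
  · intro h
    apply h2
    push_cast
    field_simp
    linear_combination -h
  · intro h
    apply h1
    field_simp at h
    linear_combination h

/-- The diagonal of the kernel as a single contour integral: the `w`-circle has been moved out to
a circle of radius `R` around everything.  The residue at `w = z` that is picked up contributes
a multiple of `∮ dz / z = 0`. -/
theorem corrKernel_diag_eq {ε : ℝ} (hε : 0 < ε) (t : ℝ) (x : ℤ) (m : ℕ) {R : ℝ}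
    (hR : (ε + ε⁻¹) / 2 + max ε ε⁻¹ / 2 < R) :
    (2 * Real.pi * Complex.I) ^ 2 * corrKernel ε t x m x m =
      ∮ z in C(((ε + ε⁻¹) / 2 : ℝ), max ε ε⁻¹ / 2),
        cauchyInt (weight ε t (m / 2) ((m + 1) / 2) x) R z /
          weight ε t (m / 2) ((m + 1) / 2) x z / z := by
  set g := weight ε t (m / 2) ((m + 1) / 2) x with hg
  have hgd : DifferentiableOn ℂ g {0}ᶜ := differentiableOn_weight _ _ _ _ _
  have hε' : 0 < ε⁻¹ := inv_pos.2 hε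
  set δ := min ε ε⁻¹ with hδ
  set D := max ε ε⁻¹ with hD
  have hδ0 : 0 < δ := lt_min hε hε'
  have hδD : δ ≤ D := min_le_max
  have hsum : ε + ε⁻¹ = δ + D := (min_add_max _ _).symm
  have hD0 : 0 < D := hδ0.trans_le hδD
  have hεD : ε ≤ D := le_max_left _ _
  have hεD' : ε⁻¹ ≤ D := le_max_right _ _
  have hεδ : δ ≤ ε := min_le_left _ _
  have hεδ' : δ ≤ ε⁻¹ := min_le_right _ _
  have hsph : ∀ z ∈ Metric.sphere (((ε + ε⁻¹) / 2 : ℝ) : ℂ) (D / 2),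
      δ / 2 ≤ ‖z‖ ∧ ‖z‖ < R ∧ z ≠ ε ∧ z ≠ (ε⁻¹ : ℝ) := by
    intro z hz
    have hz' : ‖z - ((ε + ε⁻¹) / 2 : ℝ)‖ = D / 2 := by simpa [dist_eq_norm] using hz
    have hA : ‖(((ε + ε⁻¹) / 2 : ℝ) : ℂ)‖ = (ε + ε⁻¹) / 2 := by
      rw [Complex.norm_real, Real.norm_of_nonneg (by positivity)]
    have h1 := norm_sub_norm_le (((ε + ε⁻¹) / 2 : ℝ) : ℂ) ((((ε + ε⁻¹) / 2 : ℝ) : ℂ) - z)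
    have h2 := norm_add_le (z - ((ε + ε⁻¹) / 2 : ℝ)) (((ε + ε⁻¹) / 2 : ℝ) : ℂ)
    rw [norm_sub_rev, norm_sub_rev (((ε + ε⁻¹) / 2 : ℝ) : ℂ), hz', hA] at h1
    rw [hz', hA, sub_add_cancel] at h2
    refine ⟨?_, by linarith, ?_, ?_⟩
    · have : ‖((((ε + ε⁻¹) / 2 : ℝ) : ℂ) - z) - (((ε + ε⁻¹) / 2 : ℝ) : ℂ)‖ = ‖z‖ := by
        rw [sub_sub_cancel_left, norm_neg]
      linarith
    · rintro rfl
      rw [← Complex.ofReal_sub, Complex.norm_real, Real.norm_eq_abs] at hz'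
      rcases abs_cases (ε - (ε + ε⁻¹) / 2) with h | h <;> linarith
    · rintro rfl
      rw [← Complex.ofReal_sub, Complex.norm_real, Real.norm_eq_abs] at hz'
      rcases abs_cases (ε⁻¹ - (ε + ε⁻¹) / 2) with h | h <;> linarith
  have hz0 : ∀ z ∈ Metric.sphere (((ε + ε⁻¹) / 2 : ℝ) : ℂ) (D / 2), z ≠ 0 := fun z hz =>
    ne_zero_of_le_norm (half_pos hδ0) (hsph z hz).1
  have hgz : ∀ z ∈ Metric.sphere (((ε + ε⁻¹) / 2 : ℝ) : ℂ) (D / 2), g z ≠ 0 := fun z hz =>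
    weight_ne_zero hε _ _ _ _ (hz0 z hz) (hsph z hz).2.2.1 (hsph z hz).2.2.2
  have hgcont : ContinuousOn g (Metric.sphere (((ε + ε⁻¹) / 2 : ℝ) : ℂ) (D / 2)) :=
    hgd.continuousOn.mono fun z hz => hz0 z hz
  have hpi : (2 * Real.pi * Complex.I : ℂ) ≠ 0 := by simp [Real.pi_ne_zero]
  have hR0 : 0 < R := by have : 0 < (ε + ε⁻¹) / 2 + D / 2 := by positivity
                         linarith
  have hker : (2 * Real.pi * Complex.I) ^ 2 * corrKernel ε t x m x m =
      ∮ w in C(0, δ / 4), ∮ z in C(((ε + ε⁻¹) / 2 : ℝ), D / 2),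
        g w / g z * (1 / (z * (w - z))) := by
    -- On the diagonal the single integral is absent and the powers of `w` and `z` have the same exponents.
    rw [corrKernel]
    simp only [lt_irrefl, if_false, neg_zero, zero_div, zero_mul, zero_add, Int.floor_intCast]
    rw [one_div, mul_inv_cancel_left₀ (pow_ne_zero _ hpi)]
    rfl
  rw [hker, circleIntegral_swap]
  · have hsub : ∀ z ∈ Metric.sphere (((ε + ε⁻¹) / 2 : ℝ) : ℂ) (D / 2),
        (∮ w in C(0, δ / 4), g w / g z * (1 / (z * (w - z)))) =
          cauchyInt g R z / g z / z - 2 * Real.pi * Complex.I * z⁻¹ := by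
      intro z hz
      obtain ⟨h1, h2, -, -⟩ := hsph z hz
      have e : (fun w => g w / g z * (1 / (z * (w - z)))) =
          fun w => (1 / (g z * z)) * (g w / (w - z)) := by
        ext w
        rw [div_mul_div_comm, div_mul_div_comm]
        ring_nf
      rw [e, circleIntegral.integral_const_mul,
        cauchyInt_eq_add_of_lt_norm hgd (r := δ / 4) (by linarith) (by linarith) h2, cauchyInt]
      have := hgz z hz
      have := hz0 z hz
      field_simp
      ring
    -- The pole `w = z` lies between the two `w`-circles; `0` lies outside the `z`-circle, so what the
    -- pole contributes integrates to zero.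
    rw [circleIntegral.integral_congr (by positivity) hsub, circleIntegral.integral_sub,
      circleIntegral.integral_const_mul,
      Complex.circleIntegral_eq_zero_of_differentiable_on_off_countable
        (f := fun z => z⁻¹) (by positivity) Set.countable_empty, mul_zero, sub_zero]
    · apply ContinuousOn.inv₀ (by fun_prop)
      rintro z hz rfl
      simp only [Metric.mem_closedBall, dist_zero_left, Complex.norm_real, Real.norm_eq_abs] at hz
      rw [abs_of_pos (by positivity)] at hz
      linarith
    · rintro z hz
      apply differentiableAt_inv
      rintro rfl
      have hz := hz.1
      simp only [Metric.mem_ball, dist_zero_left, Complex.norm_real, Real.norm_eq_abs] at hz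
      rw [abs_of_pos (by positivity)] at hz
      linarith
    · apply ContinuousOn.circleIntegrable (by positivity)
      refine ContinuousOn.div (ContinuousOn.div ?_ hgcont hgz) continuousOn_id hz0
      apply (differentiableOn_cauchyInt hgd hR0).continuousOn.mono
      intro z hz
      simpa using (hsph z hz).2.1
    · apply ContinuousOn.circleIntegrable (by positivity)
      exact continuousOn_const.mul (ContinuousOn.inv₀ continuousOn_id hz0)
  · rw [abs_of_pos (by positivity), abs_of_pos (by positivity)]
    have hw0 : ∀ w ∈ Metric.sphere (0 : ℂ) (δ / 4), w ≠ 0 := fun w hw =>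
      ne_zero_of_le_norm (r := δ / 4) (by positivity) (by simpa using hw.ge)
    have c1 : ContinuousOn (fun p : ℂ × ℂ => g p.1)
        (Metric.sphere (0 : ℂ) (δ / 4) ×ˢ Metric.sphere (((ε + ε⁻¹) / 2 : ℝ) : ℂ) (D / 2)) :=
      hgd.continuousOn.comp continuousOn_fst fun p hp => hw0 _ hp.1
    have c2 : ContinuousOn (fun p : ℂ × ℂ => g p.2)
        (Metric.sphere (0 : ℂ) (δ / 4) ×ˢ Metric.sphere (((ε + ε⁻¹) / 2 : ℝ) : ℂ) (D / 2)) :=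
      hgcont.comp continuousOn_snd fun p hp => hp.2
    refine (c1.div c2 fun p hp => hgz _ hp.2).mul (ContinuousOn.div (by fun_prop) (by fun_prop) ?_)
    rintro ⟨w, z⟩ ⟨hw, hz⟩
    refine mul_ne_zero (hz0 z hz) ?_
    intro h
    have h : w - z = 0 := h
    have h1 : ‖w‖ = δ / 4 := by simpa using hw
    have h2 := (hsph z hz).1
    rw [← sub_eq_zero.1 h, h1] at h2
    linarith

/-- The domain on which the reduced integrand `cauchyInt g R / g` is holomorphic. -/
def regularSet (ε R : ℝ) : Set ℂ := {z | z ≠ 0 ∧ z ≠ ε ∧ z ≠ (ε⁻¹ : ℝ) ∧ ‖z‖ < R}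

theorem isOpen_regularSet (ε R : ℝ) : IsOpen (regularSet ε R) :=
  isOpen_ne.inter (isOpen_ne.inter (isOpen_ne.inter (isOpen_lt continuous_norm continuous_const)))

theorem differentiableOn_cauchyInt_div_weight {ε : ℝ} (hε : 0 < ε) (t : ℝ) (k l : ℕ) (x : ℤ)
    {R : ℝ} (hR : 0 < R) :
    DifferentiableOn ℂ (fun z => cauchyInt (weight ε t k l x) R z / weight ε t k l x z)
      (regularSet ε R) := by
  intro z hz
  obtain ⟨h0, h1, h2, h3⟩ := hz
  refine DifferentiableAt.differentiableWithinAt (DifferentiableAt.div ?_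
    (differentiableAt_weight ε t k l x h0) (weight_ne_zero hε t k l x h0 h1 h2))
  exact (differentiableOn_cauchyInt (differentiableOn_weight ε t k l x) hR).differentiableAt
    (Metric.isOpen_ball.mem_nhds (by simpa using h3))

/-- The diagonal of the kernel as the difference of integrals over two circles around `0`, a large
one around `ε` and `ε⁻¹` and a small one. -/
theorem corrKernel_diag_eq_arcInt {ε : ℝ} (hε : 0 < ε) (t : ℝ) (x : ℤ) (m : ℕ) {R σ₁ σ₂ : ℝ}
    (hR : (ε + ε⁻¹) / 2 + max ε ε⁻¹ / 2 < R) (hσ₁ : max ε ε⁻¹ < Real.exp σ₁)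
    (hσ₁R : Real.exp σ₁ < R) (hσ₂ : Real.exp σ₂ < min ε ε⁻¹) :
    (2 * Real.pi * Complex.I) ^ 2 * corrKernel ε t x m x m =
      arcInt (fun z => cauchyInt (weight ε t (m / 2) ((m + 1) / 2) x) R z /
          weight ε t (m / 2) ((m + 1) / 2) x z) σ₁ -
      arcInt (fun z => cauchyInt (weight ε t (m / 2) ((m + 1) / 2) x) R z /
          weight ε t (m / 2) ((m + 1) / 2) x z) σ₂ := by
  rw [corrKernel_diag_eq hε t x m hR]
  have hε' : 0 < ε⁻¹ := inv_pos.2 hε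
  have hR0 : 0 < R := (Real.exp_pos _).trans hσ₁R
  set N : ℂ → ℂ := fun z => cauchyInt (weight ε t (m / 2) ((m + 1) / 2) x) R z /
          weight ε t (m / 2) ((m + 1) / 2) x z with hN
  have hNd : DifferentiableOn ℂ N (regularSet ε R) :=
    differentiableOn_cauchyInt_div_weight hε t _ _ x hR0
  set δ := min ε ε⁻¹ with hδ
  set D := max ε ε⁻¹ with hD
  have hδ0 : 0 < δ := lt_min hε hε'
  have hδD : δ ≤ D := min_le_max
  have hsum : ε + ε⁻¹ = δ + D := (min_add_max _ _).symm
  have hD0 : 0 < D := hδ0.trans_le hδD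
  have hεD : ε ≤ D := le_max_left _ _
  have hεD' : ε⁻¹ ≤ D := le_max_right _ _
  have hεδ : δ ≤ ε := min_le_left _ _
  have hεδ' : δ ≤ ε⁻¹ := min_le_right _ _
  have e1 : (ε + ε⁻¹) / 2 + D / 2 = D + δ / 2 := by rw [hsum]; ring
  have e2 : (ε + ε⁻¹) / 2 - D / 2 = δ / 2 := by rw [hsum]; ring
  rw [e1] at hR
  have hcirc : ∀ r₁ r₂ : ℝ, 0 < r₁ → r₁ ≤ r₂ → r₂ < R → (D < r₁ ∨ r₂ < δ) →
      (∮ z in C(0, r₂), N z / z) = ∮ z in C(0, r₁), N z / z := by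
    intro r₁ r₂ h0 h12 h2R hor
    apply circleIntegral_eq_of_annulus h0 h12
    intro z hz1 hz2
    have hz0 : z ≠ 0 := ne_zero_of_le_norm h0 hz1
    have hreal : ∀ y : ℝ, 0 < y → δ ≤ y → y ≤ D → z ≠ y := by
      rintro y hy hy1 hy2 rfl
      rw [Complex.norm_real, Real.norm_of_nonneg hy.le] at hz1 hz2
      rcases hor with h | h <;> linarith
    refine (hNd.differentiableAt ((isOpen_regularSet ε R).mem_nhds
      ⟨hz0, hreal ε hε hεδ hεD, hreal ε⁻¹ hε' hεδ' hεD', hz2.trans_lt h2R⟩)).div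
      differentiableAt_id hz0
  have hcirc' : ∀ r₁ r₂ : ℝ, 0 < r₁ → 0 < r₂ → r₁ < R → r₂ < R →
      ((D < r₁ ∧ D < r₂) ∨ (r₁ < δ ∧ r₂ < δ)) →
      (∮ z in C(0, r₂), N z / z) = ∮ z in C(0, r₁), N z / z := by
    intro r₁ r₂ h1 h2 h1R h2R hor
    rcases le_total r₁ r₂ with h | h
    · exact hcirc r₁ r₂ h1 h h2R (hor.imp (fun h => h.1) (fun h => h.2))
    · exact (hcirc r₂ r₁ h2 h h1R (hor.imp (fun h => h.2) (fun h => h.1))).symm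
  rw [circleIntegral_eq_arcInt_sub (isOpen_regularSet ε R) hNd (by positivity)
    (by rw [hsum]; linarith), ← circleIntegral_eq_arcInt, ← circleIntegral_eq_arcInt,
    ← circleIntegral_eq_arcInt, ← circleIntegral_eq_arcInt, e1, e2, Real.exp_log (by positivity),
    Real.exp_log (by positivity),
    hcirc' (Real.exp σ₁) (D + δ / 2) (by positivity) (by positivity) hσ₁R hR
      (Or.inl ⟨hσ₁, by linarith⟩),
    hcirc' (Real.exp σ₂) (δ / 2) (by positivity) (by positivity) (by linarith) (by linarith)
      (Or.inr ⟨hσ₂, by linarith⟩)]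
  intro z h1 h2 h3
  rw [e2] at h1
  rw [e1] at h2
  refine ⟨ne_zero_of_le_norm (by positivity) h1, ?_, ?_, by linarith⟩
  · rintro rfl
    rw [← Complex.ofReal_sub, Complex.norm_real, Real.norm_eq_abs] at h3
    rcases abs_cases (ε - (ε + ε⁻¹) / 2) with h | h <;> linarith
  · rintro rfl
    rw [← Complex.ofReal_sub, Complex.norm_real, Real.norm_eq_abs] at h3
    rcases abs_cases (ε⁻¹ - (ε + ε⁻¹) / 2) with h | h <;> linarith

/-- At level `0` there are no poles inside the `z`-contour, so the kernel vanishes. -/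
theorem corrKernel_diag_zero {ε : ℝ} (hε : 0 < ε) (t : ℝ) (x : ℤ) :
    corrKernel ε t x 0 x 0 = 0 := by
  have hε' : 0 < ε⁻¹ := inv_pos.2 hε
  have hD0 : 0 < max ε ε⁻¹ := hε.trans_le (le_max_left _ _)
  have hlt : max ε ε⁻¹ < ε + ε⁻¹ := max_lt (by linarith) (by linarith)
  set R := (ε + ε⁻¹) / 2 + max ε ε⁻¹ / 2 + 1 with hR
  have hd : ∀ z ∈ Metric.closedBall (((ε + ε⁻¹) / 2 : ℝ) : ℂ) (max ε ε⁻¹ / 2),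
      DifferentiableAt ℂ (fun z => cauchyInt (weight ε t 0 0 x) R z / weight ε t 0 0 x z / z) z := by
    intro z hz
    have hA : ‖(((ε + ε⁻¹) / 2 : ℝ) : ℂ)‖ = (ε + ε⁻¹) / 2 := by
      rw [Complex.norm_real, Real.norm_of_nonneg (by positivity)]
    have hz' : ‖z - ((ε + ε⁻¹) / 2 : ℝ)‖ ≤ max ε ε⁻¹ / 2 := by simpa [dist_eq_norm] using hz
    have hz0 : z ≠ 0 := by
      rintro rfl
      rw [zero_sub, norm_neg, hA] at hz'
      linarith
    have hzR : ‖z‖ < R := by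
      have h2 := norm_add_le (z - ((ε + ε⁻¹) / 2 : ℝ)) (((ε + ε⁻¹) / 2 : ℝ) : ℂ)
      rw [hA, sub_add_cancel] at h2
      linarith
    have hw : weight ε t 0 0 x z ≠ 0 := by
      simp [weight, hz0, zpow_ne_zero]
    refine (DifferentiableAt.div ?_ (differentiableAt_weight ε t 0 0 x hz0) hw).div
      differentiableAt_id hz0
    exact (differentiableOn_cauchyInt (differentiableOn_weight ε t 0 0 x)
      (by positivity)).differentiableAt (Metric.isOpen_ball.mem_nhds (by simpa using hzR))
  have h := corrKernel_diag_eq hε t x 0 (R := R) (by linarith)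
  have hpi : (2 * Real.pi * Complex.I : ℂ) ^ 2 ≠ 0 := by simp [Real.pi_ne_zero]
  have h0 : (∮ z in C(((ε + ε⁻¹) / 2 : ℝ), max ε ε⁻¹ / 2),
      cauchyInt (weight ε t 0 0 x) R z / weight ε t 0 0 x z / z) = 0 :=
    Complex.circleIntegral_eq_zero_of_differentiable_on_off_countable (by positivity)
      Set.countable_empty (fun z hz => (hd z hz).continuousAt.continuousWithinAt)
      (fun z hz => hd z (Metric.ball_subset_closedBall hz.1))
  exact (mul_eq_zero.1 (h.trans h0)).resolve_left hpi

/-! ### Elliptic coordinates on the level curve -/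

theorem exp_add_exp_neg (x θ : ℝ) :
    Complex.exp (x + θ * Complex.I) + Complex.exp (-(x + θ * Complex.I)) =
      ((2 * Real.cosh x * Real.cos θ : ℝ) : ℂ) + ((2 * Real.sinh x * Real.sin θ : ℝ) : ℂ) * Complex.I := by
  have h := Complex.cosh_add x (θ * Complex.I)
  rw [Complex.cosh_mul_I, Complex.sinh_mul_I] at h
  have h2 : Complex.cosh (x + θ * Complex.I) =
    (Complex.exp (x + θ * Complex.I) + Complex.exp (-(x + θ * Complex.I))) / 2 := rfl
  push_cast
  linear_combination 2 * h - 2 * h2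

/-- The elliptic coordinates `C ≥ 1` and `c ∈ [-1, 1]` of `u` with foci `±2`. -/
noncomputable def ellC (u : ℂ) : ℝ := (‖u - 2‖ + ‖u + 2‖) / 4

/-- The second elliptic coordinate. -/
noncomputable def ellc (u : ℂ) : ℝ := (‖u + 2‖ - ‖u - 2‖) / 4

theorem norm_sub_two_sq (u : ℂ) : ‖u - 2‖ ^ 2 = (u.re - 2) ^ 2 + u.im ^ 2 := by
  rw [← Complex.normSq_eq_norm_sq, Complex.normSq_apply]
  simp
  ring

theorem norm_add_two_sq (u : ℂ) : ‖u + 2‖ ^ 2 = (u.re + 2) ^ 2 + u.im ^ 2 := by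
  rw [← Complex.normSq_eq_norm_sq, Complex.normSq_apply]
  simp
  ring

theorem one_le_ellC (u : ℂ) : 1 ≤ ellC u := by
  have h := norm_sub_le (u + 2) (u - 2)
  have e : ‖u + 2 - (u - 2)‖ = 4 := by
    rw [show u + 2 - (u - 2) = 4 by ring]; simp
  unfold ellC
  linarith

theorem abs_ellc_le_one (u : ℂ) : |ellc u| ≤ 1 := by
  have h := abs_norm_sub_norm_le (u + 2) (u - 2)
  have e : ‖u + 2 - (u - 2)‖ = 4 := by
    rw [show u + 2 - (u - 2) = 4 by ring]; simp
  unfold ellc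
  rw [e] at h
  rw [abs_div]
  norm_num
  linarith

theorem two_mul_ellC_mul_ellc (u : ℂ) : 2 * ellC u * ellc u = u.re := by
  unfold ellC ellc
  linear_combination (norm_add_two_sq u - norm_sub_two_sq u) / 8

theorem ellC_sq_sub_one_mul (u : ℂ) : 4 * ((ellC u ^ 2 - 1) * (1 - ellc u ^ 2)) = u.im ^ 2 := by
  have h1 := two_mul_ellC_mul_ellc u
  have h2 : ellC u ^ 2 + ellc u ^ 2 = (u.re ^ 2 + u.im ^ 2) / 4 + 1 := by
    unfold ellC ellc
    linear_combination (norm_add_two_sq u + norm_sub_two_sq u) / 8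
  have h3 : 4 * (ellC u ^ 2 * ellc u ^ 2) = u.re ^ 2 := by rw [← h1]; ring
  linear_combination 4 * h2 - h3

/-- The polar angle parametrizes the level curve `‖a - u‖ = ρ`, in the plane of `u = z + z⁻¹`. -/
noncomputable def levelU (a ρ ψ : ℝ) : ℂ := a - ρ * Complex.exp (ψ * Complex.I)

/-- `log ‖z‖` for the outer one of the two solutions of `z + z⁻¹ = levelU a ρ ψ`; the inner
one has the opposite logarithm of the modulus. -/
noncomputable def levelσ (a ρ ψ : ℝ) : ℝ := Real.arcosh (ellC (levelU a ρ ψ))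

/-- The modulus of the argument of the two solutions of `z + z⁻¹ = levelU a ρ ψ`. -/
noncomputable def levelθ (a ρ ψ : ℝ) : ℝ := Real.arccos (ellc (levelU a ρ ψ))

/-- The derivative with respect to `ψ` of the logarithm `-levelσ + i levelθ` of the inner
solution. -/
noncomputable def levelDeriv (a ρ ψ : ℝ) : ℂ :=
  -(ρ * (Complex.exp (ψ * Complex.I) * Complex.I)) /
    (Complex.exp (-levelσ a ρ ψ + levelθ a ρ ψ * Complex.I) -
      Complex.exp (-(-levelσ a ρ ψ + levelθ a ρ ψ * Complex.I)))

theorem levelU_re (a ρ ψ : ℝ) : (levelU a ρ ψ).re = a - ρ * Real.cos ψ := by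
  simp [levelU, Complex.exp_ofReal_mul_I_re]

theorem levelU_im (a ρ ψ : ℝ) : (levelU a ρ ψ).im = -(ρ * Real.sin ψ) := by
  simp [levelU, Complex.exp_ofReal_mul_I_im]

theorem continuous_levelU (a ρ : ℝ) : Continuous (levelU a ρ) := by
  unfold levelU
  fun_prop

theorem continuous_ellC : Continuous ellC := by unfold ellC; fun_prop

theorem continuous_ellc : Continuous ellc := by unfold ellc; fun_prop

theorem continuous_levelσ (a ρ : ℝ) : Continuous (levelσ a ρ) :=
  Real.continuousOn_arcosh.comp_continuous (continuous_ellC.comp (continuous_levelU a ρ))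
    fun _ => one_le_ellC _

theorem continuous_levelθ (a ρ : ℝ) : Continuous (levelθ a ρ) :=
  Real.continuous_arccos.comp (continuous_ellc.comp (continuous_levelU a ρ))

theorem cosh_levelσ (a ρ ψ : ℝ) : Real.cosh (levelσ a ρ ψ) = ellC (levelU a ρ ψ) :=
  Real.cosh_arcosh (one_le_ellC _)

theorem cos_levelθ (a ρ ψ : ℝ) : Real.cos (levelθ a ρ ψ) = ellc (levelU a ρ ψ) :=
  Real.cos_arccos (abs_le.1 (abs_ellc_le_one _)).1 (abs_le.1 (abs_ellc_le_one _)).2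

theorem levelσ_nonneg (a ρ ψ : ℝ) : 0 ≤ levelσ a ρ ψ := Real.arcosh_nonneg (one_le_ellC _)

theorem sinh_levelσ_mul_sin_levelθ {a ρ ψ : ℝ} (hρ : 0 < ρ) (hψ : ψ ∈ Set.Icc 0 Real.pi) :
    2 * Real.sinh (levelσ a ρ ψ) * Real.sin (levelθ a ρ ψ) = ρ * Real.sin ψ := by
  have h1 : 0 ≤ Real.sinh (levelσ a ρ ψ) := Real.sinh_nonneg_iff.2 (levelσ_nonneg _ _ _)
  have h2 : 0 ≤ Real.sin (levelθ a ρ ψ) :=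
    Real.sin_nonneg_of_nonneg_of_le_pi (Real.arccos_nonneg _) (Real.arccos_le_pi _)
  have h3 : 0 ≤ Real.sin ψ := Real.sin_nonneg_of_mem_Icc hψ
  apply (sq_eq_sq₀ (by positivity) (by positivity)).1
  have h4 := ellC_sq_sub_one_mul (levelU a ρ ψ)
  rw [← cosh_levelσ, ← cos_levelθ, levelU_im] at h4
  have h5 := Real.cosh_sq (levelσ a ρ ψ)
  have h6 := Real.sin_sq_add_cos_sq (levelθ a ρ ψ)
  have h7 : Real.sinh (levelσ a ρ ψ) ^ 2 = Real.cosh (levelσ a ρ ψ) ^ 2 - 1 := by linarith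
  have h8 : Real.sin (levelθ a ρ ψ) ^ 2 = 1 - Real.cos (levelθ a ρ ψ) ^ 2 := by linarith
  rw [mul_pow, mul_pow, h7, h8]
  linear_combination h4

/-- The elliptic coordinates `cosh σ` and `cos θ` of `u` give a solution `exp (-σ + iθ)` of `z + z⁻¹ = u`.
The inner solution is taken because `Im u ≤ 0` for `ψ` in `[0, π]` puts it into the upper half plane. -/
theorem exp_level_add_exp_neg {a ρ ψ : ℝ} (hρ : 0 < ρ) (hψ : ψ ∈ Set.Icc 0 Real.pi) :
    Complex.exp (-levelσ a ρ ψ + levelθ a ρ ψ * Complex.I) +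
      Complex.exp (-(-levelσ a ρ ψ + levelθ a ρ ψ * Complex.I)) = levelU a ρ ψ := by
  have h := exp_add_exp_neg (-levelσ a ρ ψ) (levelθ a ρ ψ)
  rw [Complex.ofReal_neg] at h
  rw [h]
  have h1 := sinh_levelσ_mul_sin_levelθ (a := a) hρ hψ
  have h2 := two_mul_ellC_mul_ellc (levelU a ρ ψ)
  rw [← cosh_levelσ, ← cos_levelθ] at h2
  apply Complex.ext
  · simp [-Complex.ofReal_mul, -Complex.ofReal_cosh, -Complex.ofReal_sinh, -Complex.ofReal_cos,
      -Complex.ofReal_sin, Real.cosh_neg, h2]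
  · simp [-Complex.ofReal_mul, -Complex.ofReal_cosh, -Complex.ofReal_sinh, -Complex.ofReal_cos,
      -Complex.ofReal_sin, Real.sinh_neg, h1, levelU_im]

/-- The denominator of `levelDeriv` has modulus `√(‖u - 2‖ ‖u + 2‖)`. -/
theorem norm_exp_sub_exp_neg_sq {a ρ ψ : ℝ} (hρ : 0 < ρ) (hψ : ψ ∈ Set.Icc 0 Real.pi) :
    ‖Complex.exp (-levelσ a ρ ψ + levelθ a ρ ψ * Complex.I) -
      Complex.exp (-(-levelσ a ρ ψ + levelθ a ρ ψ * Complex.I))‖ ^ 2 =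
      ‖levelU a ρ ψ - 2‖ * ‖levelU a ρ ψ + 2‖ := by
  rw [← norm_mul, ← norm_pow, ← exp_level_add_exp_neg hρ hψ]
  congr 1
  have h : Complex.exp (-levelσ a ρ ψ + levelθ a ρ ψ * Complex.I) *
      Complex.exp (-(-levelσ a ρ ψ + levelθ a ρ ψ * Complex.I)) = 1 := by
    rw [← Complex.exp_add, add_neg_cancel, Complex.exp_zero]
  linear_combination -4 * h

theorem norm_levelU_sub_two_sq (a ρ ψ : ℝ) :
    ‖levelU a ρ ψ - 2‖ ^ 2 = (a - 2 - ρ) ^ 2 + 2 * (a - 2) * ρ * (1 - Real.cos ψ) := by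
  rw [norm_sub_two_sq, levelU_re, levelU_im]
  linear_combination ρ ^ 2 * Real.sin_sq_add_cos_sq ψ

theorem norm_levelU_add_two_sq (a ρ ψ : ℝ) :
    ‖levelU a ρ ψ + 2‖ ^ 2 = (a + 2 - ρ) ^ 2 + 2 * (a + 2) * ρ * (1 - Real.cos ψ) := by
  rw [norm_add_two_sq, levelU_re, levelU_im]
  linear_combination ρ ^ 2 * Real.sin_sq_add_cos_sq ψ

theorem one_sub_cos_ge {ψ : ℝ} (hψ : ψ ∈ Set.Icc 0 Real.pi) :
    2 / Real.pi ^ 2 * ψ ^ 2 ≤ 1 - Real.cos ψ := by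
  have := Real.cos_le_one_sub_mul_cos_sq (x := ψ) (by rw [abs_of_nonneg hψ.1]; exact hψ.2)
  linarith

/-- The two solutions stay away from the branch points, up to a square root singularity at
`ψ = 0`. -/
theorem exists_norm_mul_norm_ge {a ρ : ℝ} (ha : 2 ≤ a) (hρ : 0 < ρ) :
    ∃ κ > 0, ∀ ψ ∈ Set.Icc 0 Real.pi, κ * ψ ≤ ‖levelU a ρ ψ - 2‖ * ‖levelU a ρ ψ + 2‖ := by
  have hpi := Real.pi_pos
  obtain ⟨κ₁, hκ₁, h1⟩ : ∃ κ > 0, ∀ ψ ∈ Set.Icc 0 Real.pi, κ * ψ ≤ ‖levelU a ρ ψ - 2‖ := by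
    rcases ha.eq_or_lt with rfl | ha
    · refine ⟨ρ / Real.pi, by positivity, fun ψ hψ => ?_⟩
      have h := norm_levelU_sub_two_sq 2 ρ ψ
      have : ‖levelU 2 ρ ψ - 2‖ = ρ := by
        apply (sq_eq_sq₀ (norm_nonneg _) hρ.le).1
        rw [h]; ring
      rw [this, div_mul_eq_mul_div, div_le_iff₀ hpi]
      exact mul_le_mul_of_nonneg_left hψ.2 hρ.le
    · have h0 : 0 < 2 * (a - 2) * ρ * (2 / Real.pi ^ 2) := by
        have : 0 < a - 2 := by linarith
        positivity
      refine ⟨√(2 * (a - 2) * ρ * (2 / Real.pi ^ 2)), Real.sqrt_pos.2 h0, fun ψ hψ => ?_⟩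
      apply le_of_sq_le_sq _ (norm_nonneg _)
      rw [norm_levelU_sub_two_sq, mul_pow, Real.sq_sqrt h0.le]
      have := mul_le_mul_of_nonneg_left (one_sub_cos_ge hψ)
        (show 0 ≤ 2 * (a - 2) * ρ by have : 0 < a - 2 := by linarith
                                     positivity)
      nlinarith [sq_nonneg (a - 2 - ρ)]
  obtain ⟨κ₂, hκ₂, h2⟩ : ∃ κ > 0, ∀ ψ ∈ Set.Icc 0 Real.pi, κ * ψ ≤ ‖levelU a ρ ψ + 2‖ := by
    have h0 : 0 < 2 * (a + 2) * ρ * (2 / Real.pi ^ 2) := by positivity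
    refine ⟨√(2 * (a + 2) * ρ * (2 / Real.pi ^ 2)), Real.sqrt_pos.2 h0, fun ψ hψ => ?_⟩
    apply le_of_sq_le_sq _ (norm_nonneg _)
    rw [norm_levelU_add_two_sq, mul_pow, Real.sq_sqrt h0.le]
    have := mul_le_mul_of_nonneg_left (one_sub_cos_ge hψ)
      (show 0 ≤ 2 * (a + 2) * ρ by positivity)
    nlinarith [sq_nonneg (a + 2 - ρ)]
  refine ⟨2 * min κ₁ κ₂, by positivity, fun ψ hψ => ?_⟩
  -- The branch points are at distance `4`, so one of the two factors is at least `2`.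
  have hsum : 4 ≤ ‖levelU a ρ ψ - 2‖ + ‖levelU a ρ ψ + 2‖ := by
    have := one_le_ellC (levelU a ρ ψ)
    unfold ellC at this
    linarith
  have hA := norm_nonneg (levelU a ρ ψ - 2)
  have hB := norm_nonneg (levelU a ρ ψ + 2)
  have h1 := h1 ψ hψ
  have h2 := h2 ψ hψ
  have m1 : min κ₁ κ₂ * ψ ≤ κ₁ * ψ := mul_le_mul_of_nonneg_right (min_le_left _ _) hψ.1
  have m2 : min κ₁ κ₂ * ψ ≤ κ₂ * ψ := mul_le_mul_of_nonneg_right (min_le_right _ _) hψ.1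
  rcases le_total 2 ‖levelU a ρ ψ - 2‖ with h | h
  · nlinarith
  · nlinarith

theorem exists_norm_levelDeriv_le {a ρ : ℝ} (ha : 2 ≤ a) (hρ : 0 < ρ) :
    ∃ M > 0, ∀ ψ ∈ Set.Ioc 0 Real.pi, ‖levelDeriv a ρ ψ‖ ≤ M * ψ ^ (-(1 / 2) : ℝ) := by
  obtain ⟨κ, hκ, h⟩ := exists_norm_mul_norm_ge ha hρ
  refine ⟨ρ / √κ, by positivity, fun ψ hψ => ?_⟩
  have hψ' : ψ ∈ Set.Icc 0 Real.pi := ⟨hψ.1.le, hψ.2⟩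
  have h1 := norm_exp_sub_exp_neg_sq (a := a) hρ hψ'
  have h2 : √(κ * ψ) ≤ ‖Complex.exp (-levelσ a ρ ψ + levelθ a ρ ψ * Complex.I) -
      Complex.exp (-(-levelσ a ρ ψ + levelθ a ρ ψ * Complex.I))‖ := by
    apply Real.sqrt_le_iff.2
    exact ⟨norm_nonneg _, by rw [h1]; exact h ψ hψ'⟩
  have hpos : 0 < √(κ * ψ) := Real.sqrt_pos.2 (mul_pos hκ hψ.1)
  have e : ρ / √κ * ψ ^ (-(1 / 2) : ℝ) = ρ / √(κ * ψ) := by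
    rw [Real.sqrt_mul hκ.le, Real.rpow_neg hψ.1.le, ← Real.sqrt_eq_rpow]
    field_simp
  rw [e, levelDeriv, norm_div, norm_neg, norm_mul, norm_mul, Complex.norm_exp_ofReal_mul_I,
    Complex.norm_I, Complex.norm_real, Real.norm_of_nonneg hρ.le, one_mul, mul_one]
  exact div_le_div_of_nonneg_left hρ.le hpos h2

theorem measurable_levelDeriv (a ρ : ℝ) : Measurable (levelDeriv a ρ) := by
  have h1 := (continuous_levelσ a ρ)
  have h2 := (continuous_levelθ a ρ)
  unfold levelDeriv
  apply Measurable.div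
  · exact Continuous.measurable (by fun_prop)
  · exact Continuous.measurable (by fun_prop)

theorem intervalIntegrable_levelDeriv {a ρ : ℝ} (ha : 2 ≤ a) (hρ : 0 < ρ) :
    IntervalIntegrable (levelDeriv a ρ) MeasureTheory.volume 0 Real.pi := by
  obtain ⟨M, hM, h⟩ := exists_norm_levelDeriv_le ha hρ
  have hi : IntervalIntegrable (fun ψ : ℝ => M * ψ ^ (-(1 / 2) : ℝ)) MeasureTheory.volume 0 Real.pi :=
    (intervalIntegral.intervalIntegrable_rpow' (by norm_num)).const_mul M
  refine hi.mono_fun' (measurable_levelDeriv a ρ).aestronglyMeasurable ?_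
  rw [Set.uIoc_of_le Real.pi_pos.le]
  filter_upwards [MeasureTheory.ae_restrict_mem measurableSet_Ioc] with ψ hψ
  exact h ψ hψ

/-- Differentiability comes from the elliptic coordinates, which are smooth off the real axis; the value of the derivative comes from `z + z⁻¹ = u`. -/
theorem hasDerivAt_level {a ρ ψ : ℝ} (hρ : 0 < ρ) (hψ : ψ ∈ Set.Ioo 0 Real.pi) :
    HasDerivAt (levelσ a ρ) (-(levelDeriv a ρ ψ).re) ψ ∧
      HasDerivAt (levelθ a ρ) (levelDeriv a ρ ψ).im ψ := by
  have him : (levelU a ρ ψ).im < 0 := by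
    rw [levelU_im]
    have := Real.sin_pos_of_mem_Ioo hψ
    nlinarith
  have hu : HasDerivAt (levelU a ρ) (-(ρ * (Complex.exp (ψ * Complex.I) * Complex.I))) ψ := by
    have h1 : HasDerivAt (fun ψ : ℝ => Complex.exp (ψ * Complex.I))
        (Complex.exp (ψ * Complex.I) * Complex.I) ψ := by
      have := ((Complex.ofRealCLM.hasDerivAt (x := ψ)).mul_const Complex.I).cexp
      simpa using this
    exact (h1.const_mul (ρ : ℂ)).const_sub (a : ℂ)
  have hne : ∀ y : ℂ, y.im = 0 → levelU a ρ ψ + y ≠ 0 := by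
    intro y hy h
    have := congrArg Complex.im h
    simp [hy] at this
    linarith
  have hA : DifferentiableAt ℝ (fun ψ => ‖levelU a ρ ψ - 2‖) ψ :=
    (hu.differentiableAt.sub_const 2).norm ℝ (by simpa [sub_eq_add_neg] using hne (-2) (by simp))
  have hB : DifferentiableAt ℝ (fun ψ => ‖levelU a ρ ψ + 2‖) ψ :=
    (hu.differentiableAt.add_const 2).norm ℝ (hne 2 (by simp))
  have hC : DifferentiableAt ℝ (fun ψ => ellC (levelU a ρ ψ)) ψ := (hA.add hB).div_const 4
  have hc : DifferentiableAt ℝ (fun ψ => ellc (levelU a ρ ψ)) ψ := (hB.sub hA).div_const 4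
  have hprod := ellC_sq_sub_one_mul (levelU a ρ ψ)
  have hpos : 0 < (levelU a ρ ψ).im ^ 2 := by nlinarith
  have hC1 := one_le_ellC (levelU a ρ ψ)
  have hc1 := abs_le.1 (abs_ellc_le_one (levelU a ρ ψ))
  have hCgt : 1 < ellC (levelU a ρ ψ) := by
    rcases hC1.eq_or_lt with h | h
    · rw [← h] at hprod; norm_num at hprod; linarith
    · exact h
  have hcne : ellc (levelU a ρ ψ) ≠ -1 ∧ ellc (levelU a ρ ψ) ≠ 1 := by
    constructor <;> intro h <;> rw [h] at hprod <;> norm_num at hprod <;> linarith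
  have hσ : DifferentiableAt ℝ (levelσ a ρ) ψ :=
    (Real.differentiableAt_arcosh (Set.mem_Ioi.2 hCgt)).comp ψ hC
  have hθ : DifferentiableAt ℝ (levelθ a ρ) ψ :=
    (Real.differentiableAt_arccos.2 hcne).comp ψ hc
  set d : ℂ := -((deriv (levelσ a ρ) ψ : ℝ) : ℂ) + ((deriv (levelθ a ρ) ψ : ℝ) : ℂ) * Complex.I with hd
  have hζ : HasDerivAt (fun ψ => (-levelσ a ρ ψ + levelθ a ρ ψ * Complex.I : ℂ)) d ψ :=
    hσ.hasDerivAt.ofReal_comp.neg.add (hθ.hasDerivAt.ofReal_comp.mul_const Complex.I)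
  have hsum := hζ.cexp.add hζ.neg.cexp
  have heq : (fun ψ => Complex.exp (-levelσ a ρ ψ + levelθ a ρ ψ * Complex.I) +
      Complex.exp (-(-levelσ a ρ ψ + levelθ a ρ ψ * Complex.I))) =ᶠ[𝓝 ψ] levelU a ρ := by
    filter_upwards [isOpen_Ioo.mem_nhds hψ] with s hs
    exact exp_level_add_exp_neg hρ (Set.Ioo_subset_Icc_self hs)
  have hval := (hsum.congr_of_eventuallyEq heq.symm).unique hu
  have hne2 : Complex.exp (-levelσ a ρ ψ + levelθ a ρ ψ * Complex.I) -
      Complex.exp (-(-levelσ a ρ ψ + levelθ a ρ ψ * Complex.I)) ≠ 0 := by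
    intro h
    have h1 := norm_exp_sub_exp_neg_sq (a := a) hρ (Set.Ioo_subset_Icc_self hψ)
    rw [h, norm_zero] at h1
    have h2 : levelU a ρ ψ - 2 ≠ 0 := by simpa [sub_eq_add_neg] using hne (-2) (by simp)
    have h3 := hne 2 (by simp)
    have : 0 < ‖levelU a ρ ψ - 2‖ * ‖levelU a ρ ψ + 2‖ := by positivity
    norm_num at h1
    rcases h1 with h1 | h1
    · exact h2 h1
    · exact h3 h1
  have hdeq : levelDeriv a ρ ψ = d := by
    rw [Pi.neg_apply] at hval
    rw [levelDeriv, div_eq_iff hne2, ← hval]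
    ring
  rw [hdeq]
  constructor
  · simpa [hd] using hσ.hasDerivAt
  · simpa [hd] using hθ.hasDerivAt

theorem levelU_pi (a ρ : ℝ) : levelU a ρ Real.pi = ((a + ρ : ℝ) : ℂ) := by
  simp [levelU]

theorem levelU_zero (a ρ : ℝ) : levelU a ρ 0 = ((a - ρ : ℝ) : ℂ) := by
  simp [levelU]

theorem ellC_ofReal {u : ℝ} (hu : 2 ≤ u) : ellC u = u / 2 := by
  have h1 : ‖(u : ℂ) - 2‖ = u - 2 := by
    rw [show (u : ℂ) - 2 = ((u - 2 : ℝ) : ℂ) by push_cast; ring, Complex.norm_real,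
      Real.norm_of_nonneg (by linarith)]
  have h2 : ‖(u : ℂ) + 2‖ = u + 2 := by
    rw [show (u : ℂ) + 2 = ((u + 2 : ℝ) : ℂ) by push_cast; ring, Complex.norm_real,
      Real.norm_of_nonneg (by linarith)]
  rw [ellC, h1, h2]; ring

theorem ellc_ofReal {u : ℝ} (hu : 2 ≤ u) : ellc u = 1 := by
  have h1 : ‖(u : ℂ) - 2‖ = u - 2 := by
    rw [show (u : ℂ) - 2 = ((u - 2 : ℝ) : ℂ) by push_cast; ring, Complex.norm_real,
      Real.norm_of_nonneg (by linarith)]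
  have h2 : ‖(u : ℂ) + 2‖ = u + 2 := by
    rw [show (u : ℂ) + 2 = ((u + 2 : ℝ) : ℂ) by push_cast; ring, Complex.norm_real,
      Real.norm_of_nonneg (by linarith)]
  rw [ellc, h1, h2]; ring

theorem ellc_ofReal_of_le_neg {u : ℝ} (hu : u ≤ -2) : ellc u = -1 := by
  have h1 : ‖(u : ℂ) - 2‖ = 2 - u := by
    rw [show (u : ℂ) - 2 = ((u - 2 : ℝ) : ℂ) by push_cast; ring, Complex.norm_real,
      Real.norm_of_nonpos (by linarith)]; ring
  have h2 : ‖(u : ℂ) + 2‖ = -u - 2 := by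
    rw [show (u : ℂ) + 2 = ((u + 2 : ℝ) : ℂ) by push_cast; ring, Complex.norm_real,
      Real.norm_of_nonpos (by linarith)]; ring
  rw [ellc, h1, h2]; ring

theorem ellC_ofReal_of_abs_le {u : ℝ} (hu : |u| ≤ 2) : ellC u = 1 := by
  have hu := abs_le.1 hu
  have h1 : ‖(u : ℂ) - 2‖ = 2 - u := by
    rw [show (u : ℂ) - 2 = ((u - 2 : ℝ) : ℂ) by push_cast; ring, Complex.norm_real,
      Real.norm_of_nonpos (by linarith)]; ring
  have h2 : ‖(u : ℂ) + 2‖ = u + 2 := by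
    rw [show (u : ℂ) + 2 = ((u + 2 : ℝ) : ℂ) by push_cast; ring, Complex.norm_real,
      Real.norm_of_nonneg (by linarith)]
  rw [ellC, h1, h2]; ring

/-! ### The kernel as an integral along the level curve -/

/-- The logarithm of the point of the level curve with parameter `ψ`: in the closed upper half
plane, outside the unit circle for `s = 1` and inside for `s = -1`. -/
noncomputable def levelζ (a ρ s ψ : ℝ) : ℂ := ((s * levelσ a ρ ψ : ℝ) : ℂ) + levelθ a ρ ψ * Complex.I

/-- The derivative of `levelζ` with respect to `ψ`. -/
noncomputable def levelζDeriv (a ρ s ψ : ℝ) : ℂ :=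
  ((-(s * (levelDeriv a ρ ψ).re) : ℝ) : ℂ) + ((levelDeriv a ρ ψ).im : ℂ) * Complex.I

theorem levelζ_re (a ρ s ψ : ℝ) : (levelζ a ρ s ψ).re = s * levelσ a ρ ψ := by simp [levelζ]

theorem levelζ_im (a ρ s ψ : ℝ) : (levelζ a ρ s ψ).im = levelθ a ρ ψ := by simp [levelζ]

theorem continuous_levelζ (a ρ s : ℝ) : Continuous (levelζ a ρ s) := by
  have h1 := continuous_levelσ a ρ
  have h2 := continuous_levelθ a ρ
  unfold levelζ
  fun_prop

theorem hasDerivAt_levelζ {a ρ ψ : ℝ} (s : ℝ) (hρ : 0 < ρ) (hψ : ψ ∈ Set.Ioo 0 Real.pi) :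
    HasDerivAt (levelζ a ρ s) (levelζDeriv a ρ s ψ) ψ := by
  obtain ⟨h1, h2⟩ := hasDerivAt_level (a := a) hρ hψ
  have := (h1.const_mul s).ofReal_comp.add (h2.ofReal_comp.mul_const Complex.I)
  rwa [mul_neg] at this

theorem norm_levelζDeriv (a ρ ψ : ℝ) {s : ℝ} (hs : s ^ 2 = 1) :
    ‖levelζDeriv a ρ s ψ‖ = ‖levelDeriv a ρ ψ‖ := by
  apply (sq_eq_sq₀ (norm_nonneg _) (norm_nonneg _)).1
  rw [← Complex.normSq_eq_norm_sq, ← Complex.normSq_eq_norm_sq, Complex.normSq_apply,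
    Complex.normSq_apply, levelζDeriv]
  simp
  linear_combination (levelDeriv a ρ ψ).re ^ 2 * hs

theorem measurable_levelζDeriv (a ρ s : ℝ) : Measurable (levelζDeriv a ρ s) := by
  have h := measurable_levelDeriv a ρ
  unfold levelζDeriv
  fun_prop

theorem intervalIntegrable_levelζDeriv {a ρ s : ℝ} (ha : 2 ≤ a) (hρ : 0 < ρ) (hs : s ^ 2 = 1) :
    IntervalIntegrable (levelζDeriv a ρ s) MeasureTheory.volume 0 Real.pi := by
  refine (intervalIntegrable_levelDeriv ha hρ).mono_fun
    (measurable_levelζDeriv a ρ s).aestronglyMeasurable ?_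
  exact Eventually.of_forall fun ψ => (norm_levelζDeriv a ρ ψ hs).le

theorem norm_levelU_le {a ρ ψ₁ ψ₂ : ℝ} (ha : 2 ≤ a) (hρ : 0 < ρ)
    (h : Real.cos ψ₂ ≤ Real.cos ψ₁) :
    ‖levelU a ρ ψ₁ - 2‖ ≤ ‖levelU a ρ ψ₂ - 2‖ ∧ ‖levelU a ρ ψ₁ + 2‖ ≤ ‖levelU a ρ ψ₂ + 2‖ := by
  constructor
  · apply le_of_sq_le_sq _ (norm_nonneg _)
    rw [norm_levelU_sub_two_sq, norm_levelU_sub_two_sq]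
    have : 0 ≤ 2 * (a - 2) * ρ := by have : 0 ≤ a - 2 := by linarith
                                     positivity
    nlinarith
  · apply le_of_sq_le_sq _ (norm_nonneg _)
    rw [norm_levelU_add_two_sq, norm_levelU_add_two_sq]
    have : 0 ≤ 2 * (a + 2) * ρ := by positivity
    nlinarith

theorem levelσ_le_levelσ_pi {a ρ : ℝ} (ha : 2 ≤ a) (hρ : 0 < ρ) (ψ : ℝ) :
    levelσ a ρ ψ ≤ levelσ a ρ Real.pi := by
  have h := norm_levelU_le (ψ₁ := ψ) (ψ₂ := Real.pi) ha hρ (by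
    rw [Real.cos_pi]; exact Real.neg_one_le_cos ψ)
  apply (Real.arcosh_le_arcosh (by linarith [one_le_ellC (levelU a ρ ψ)])
    (by linarith [one_le_ellC (levelU a ρ Real.pi)])).2
  unfold ellC
  linarith

theorem exp_mul_levelσ_le {a ρ s : ℝ} (ha : 2 ≤ a) (hρ : 0 < ρ) (hs : s = 1 ∨ s = -1) (ψ : ℝ) :
    Real.exp (s * levelσ a ρ ψ) ≤ Real.exp (levelσ a ρ Real.pi) := by
  apply Real.exp_le_exp.2
  have h1 := levelσ_le_levelσ_pi ha hρ ψ
  have h2 := levelσ_nonneg a ρ ψ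
  rcases hs with rfl | rfl <;> linarith

theorem levelθ_mem (a ρ ψ : ℝ) : 0 ≤ levelθ a ρ ψ ∧ levelθ a ρ ψ ≤ Real.pi :=
  ⟨Real.arccos_nonneg _, Real.arccos_le_pi _⟩

theorem two_le_add_inv {ε : ℝ} (hε : 0 < ε) : 2 ≤ ε + ε⁻¹ := by
  have := Real.one_le_cosh (Real.log ε)
  rw [Real.cosh_log hε] at this
  linarith

theorem levelU_ne {a ρ ψ : ℝ} (hρ : 0 < ρ) : levelU a ρ ψ ≠ a := by
  intro h
  have : (ρ : ℂ) * Complex.exp (ψ * Complex.I) = 0 := by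
    unfold levelU at h
    linear_combination -h
  rcases mul_eq_zero.1 this with h | h
  · exact hρ.ne' (by exact_mod_cast h)
  · exact Complex.exp_ne_zero _ h

/-- The arcs that start on the level curve and run around `0` through the negative real axis do not meet
the poles `ε` and `ε⁻¹`: a pole could only be the starting point of its arc, and the poles, where
`z + z⁻¹ = ε + ε⁻¹`, do not lie on the level curve. -/
theorem exp_ne_of_mem_arc {ε ρ s ψ η : ℝ} (hρ : 0 < ρ)
    (hs : s = 1 ∨ s = -1)
    (hη : η ∈ Set.Icc (levelθ (ε + ε⁻¹) ρ ψ) (2 * Real.pi - levelθ (ε + ε⁻¹) ρ ψ)) {y : ℝ}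
    (hy : 0 < y) (hyε : y + y⁻¹ = ε + ε⁻¹) :
    Complex.exp ((s * levelσ (ε + ε⁻¹) ρ ψ : ℝ) + η * Complex.I) ≠ y := by
  intro h
  set a := ε + ε⁻¹ with ha
  set σ := levelσ a ρ ψ with hσ
  have hn := congrArg norm h
  rw [Complex.norm_exp] at hn
  simp [-Complex.ofReal_mul, abs_of_pos hy] at hn
  have hre := congrArg Complex.re h
  rw [Complex.exp_re] at hre
  simp [-Complex.ofReal_mul] at hre
  rw [hn] at hre
  have hcos : Real.cos η = 1 := mul_left_cancel₀ hy.ne' (by linarith)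
  have hcosθ : Real.cos (levelθ a ρ ψ) = 1 :=
    le_antisymm (Real.cos_le_one _) (by
      rw [← hcos]; exact cos_le_cos_of_mem_Icc (levelθ_mem a ρ ψ).1 hη)
  have hcosh : Real.cosh σ = a / 2 := by
    have h1 : Real.cosh (s * σ) = Real.cosh σ := by
      rcases hs with rfl | rfl
      · rw [one_mul]
      · rw [neg_one_mul, Real.cosh_neg]
    rw [← h1, Real.cosh_eq, Real.exp_neg, hn, hyε]
  have hU1 := two_mul_ellC_mul_ellc (levelU a ρ ψ)
  have hU2 := ellC_sq_sub_one_mul (levelU a ρ ψ)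
  rw [← cosh_levelσ, ← cos_levelθ, hcosθ, ← hσ, hcosh] at hU1 hU2
  apply levelU_ne (a := a) (ψ := ψ) hρ
  apply Complex.ext
  · rw [← hU1, Complex.ofReal_re]
    ring
  · rw [Complex.ofReal_im]
    exact pow_eq_zero_iff two_ne_zero |>.1 (by rw [← hU2]; ring)

/-- The level curve crosses the positive real axis outside both poles, and by inversion also inside them. -/
theorem abs_log_lt_levelσ_pi {ε ρ : ℝ} (hε : 0 < ε) (hρ : 0 < ρ) :
    |Real.log ε| < levelσ (ε + ε⁻¹) ρ Real.pi := by
  have ha := two_le_add_inv hε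
  rw [← abs_of_nonneg (levelσ_nonneg (ε + ε⁻¹) ρ Real.pi)]
  apply Real.cosh_lt_cosh.1
  rw [Real.cosh_log hε, cosh_levelσ, levelU_pi, ellC_ofReal (by linarith)]
  linarith

theorem lt_exp_of_abs_log_lt {ε σ : ℝ} (hε : 0 < ε) (h : |Real.log ε| < σ) :
    max ε ε⁻¹ < Real.exp σ ∧ Real.exp (-σ) < min ε ε⁻¹ := by
  have h1 := abs_lt.1 h
  have h2 : ε⁻¹ = Real.exp (-Real.log ε) := by rw [Real.exp_neg, Real.exp_log hε]
  refine ⟨max_lt ?_ ?_, lt_min ?_ ?_⟩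
  · exact (Real.log_lt_iff_lt_exp hε).1 h1.2
  · rw [h2]; exact Real.exp_lt_exp.2 (by linarith)
  · exact (Real.lt_log_iff_exp_lt hε).1 h1.1
  · rw [h2]; exact Real.exp_lt_exp.2 (by linarith)

/-- The kernel as an integral along the level curve `‖a - (z + z⁻¹)‖ = ρ`.  The inner and the outer
half of the curve start on the same circle, or else on circles with no pole between them, or
on the negative real axis, and end on circles within and around the two poles. -/
theorem corrKernel_diag_eq_level {ε : ℝ} (hε : 0 < ε) {ρ : ℝ} (hρ : 0 < ρ) (t : ℝ) (x : ℤ) (m : ℕ)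
    {R : ℝ} (hR : (ε + ε⁻¹) / 2 + max ε ε⁻¹ / 2 < R)
    (hR' : Real.exp (levelσ (ε + ε⁻¹) ρ Real.pi) < R) {N : ℂ → ℂ}
    (hN : N = fun z => cauchyInt (weight ε t (m / 2) ((m + 1) / 2) x) R z /
      weight ε t (m / 2) ((m + 1) / 2) x z) {I : ℝ → ℂ}
    (hI : I = fun s => ∫ ψ in (0 : ℝ)..Real.pi,
      (N (Complex.exp ((starRingEnd ℂ) (levelζ (ε + ε⁻¹) ρ s ψ))) *
          (starRingEnd ℂ) (levelζDeriv (ε + ε⁻¹) ρ s ψ) -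
        N (Complex.exp (levelζ (ε + ε⁻¹) ρ s ψ)) * levelζDeriv (ε + ε⁻¹) ρ s ψ)) :
    (2 * Real.pi * Complex.I) ^ 2 * corrKernel ε t x m x m = I 1 - I (-1) := by
  set a := ε + ε⁻¹ with ha
  have ha2 : 2 ≤ a := two_le_add_inv hε
  have hR0 : 0 < R := (Real.exp_pos _).trans hR'
  have hNd : DifferentiableOn ℂ N (regularSet ε R) := by
    rw [hN]; exact differentiableOn_cauchyInt_div_weight hε t _ _ x hR0
  have hε' : 0 < ε⁻¹ := inv_pos.2 hε
  have hεinv : ε⁻¹ + (ε⁻¹)⁻¹ = a := by rw [inv_inv, ha]; ring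
  have hsweep : ∀ s : ℝ, s = 1 ∨ s = -1 →
      arcInt N (levelζ a ρ s Real.pi) - arcInt N (levelζ a ρ s 0) = I s := by
    intro s hs
    rw [hI]
    apply arcInt_sub_arcInt (isOpen_regularSet ε R) hNd Real.pi_pos.le
      (continuous_levelζ a ρ s).continuousOn (fun ψ hψ => hasDerivAt_levelζ s hρ hψ)
    · intro ψ _
      rw [levelζ_im, levelζ_re]
      refine ⟨(levelθ_mem a ρ ψ).1, (levelθ_mem a ρ ψ).2, fun η hη => ?_⟩
      refine ⟨Complex.exp_ne_zero _, exp_ne_of_mem_arc hρ hs hη hε rfl,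
        exp_ne_of_mem_arc hρ hs hη hε' hεinv, ?_⟩
      rw [Complex.norm_exp]
      have := exp_mul_levelσ_le ha2 hρ hs ψ
      simp [-Complex.ofReal_mul]
      linarith
    · exact intervalIntegrable_levelζDeriv ha2 hρ (by rcases hs with rfl | rfl <;> norm_num)
  have hπ : ∀ s : ℝ, levelζ a ρ s Real.pi = ((s * levelσ a ρ Real.pi : ℝ) : ℂ) := by
    intro s
    have : levelθ a ρ Real.pi = 0 := by
      rw [levelθ, levelU_pi, ellc_ofReal (by linarith), Real.arccos_one]
    simp [levelζ, this]
  have h0 : arcInt N (levelζ a ρ 1 0) = arcInt N (levelζ a ρ (-1) 0) := by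
    -- The parameter `ψ = 0` belongs to the real point `u = a - ρ`.  For `|u| ≤ 2` both halves of the curve
    -- start at the same point of the unit circle.
    rcases le_or_gt |a - ρ| 2 with h | h
    · have : levelσ a ρ 0 = 0 := by
        rw [levelσ, levelU_zero, ellC_ofReal_of_abs_le h, Real.arcosh_zero]
      simp [levelζ, this]
    rcases lt_abs.1 h with h | h
    · -- For `u > 2` they start on the positive real axis, on circles without a pole between them.
      have hθ : levelθ a ρ 0 = 0 := by
        rw [levelθ, levelU_zero, ellc_ofReal h.le, Real.arccos_one]
      have e1 : levelζ a ρ 1 0 = ((levelσ a ρ 0 : ℝ) : ℂ) := by simp [levelζ, hθ]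
      have e2 : levelζ a ρ (-1) 0 = ((-levelσ a ρ 0 : ℝ) : ℂ) := by simp [levelζ, hθ]
      rw [e1, e2, ← circleIntegral_eq_arcInt, ← circleIntegral_eq_arcInt]
      have hlt : levelσ a ρ 0 < |Real.log ε| := by
        rw [← abs_of_nonneg (levelσ_nonneg a ρ 0)]
        apply Real.cosh_lt_cosh.1
        rw [Real.cosh_log hε, cosh_levelσ, levelU_zero, ellC_ofReal h.le]
        linarith
      apply circleIntegral_eq_of_annulus (Real.exp_pos _)
        (Real.exp_le_exp.2 (by linarith [levelσ_nonneg a ρ 0]))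
      intro z hz1 hz2
      have hz0 : z ≠ 0 := ne_zero_of_le_norm (Real.exp_pos _) hz1
      have hne : ∀ y : ℝ, 0 < y → |Real.log y| = |Real.log ε| → z ≠ y := by
        rintro y hy hlog rfl
        rw [Complex.norm_real, Real.norm_of_nonneg hy.le] at hz1 hz2
        have h1 := (Real.le_log_iff_exp_le hy).2 hz1
        have h2 := (Real.log_le_iff_le_exp hy).2 hz2
        have := abs_le.2 ⟨h1, h2⟩
        linarith
      refine (hNd.differentiableAt ((isOpen_regularSet ε R).mem_nhds
        ⟨hz0, hne ε hε rfl, hne ε⁻¹ hε' (by rw [Real.log_inv, abs_neg]), ?_⟩)).div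
        differentiableAt_id hz0
      have := Real.exp_le_exp.2 (levelσ_le_levelσ_pi ha2 hρ 0)
      linarith
    · -- For `u < -2` they start on the negative real axis, where the arcs are degenerate.
      have hθ : levelθ a ρ 0 = Real.pi := by
        rw [levelθ, levelU_zero, ellc_ofReal_of_le_neg (by linarith), Real.arccos_neg_one]
      rw [arcInt_eq_zero _ (by rw [levelζ_im, hθ]), arcInt_eq_zero _ (by rw [levelζ_im, hθ])]
  obtain ⟨h1, h2⟩ := lt_exp_of_abs_log_lt hε (abs_log_lt_levelσ_pi hε hρ)
  have hK := corrKernel_diag_eq_arcInt hε t x m (σ₁ := 1 * levelσ a ρ Real.pi)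
    (σ₂ := -1 * levelσ a ρ Real.pi) hR (by rwa [one_mul]) (by rwa [one_mul])
    (by rwa [neg_one_mul])
  rw [hK, ← hN, ← hsweep 1 (Or.inl rfl), ← hsweep (-1) (Or.inr rfl), hπ, hπ, h0]
  ring

/-! ### Bounds for the weight -/

theorem norm_weight {ε t : ℝ} {k l : ℕ} {x : ℤ} {z : ℂ} (σ : ℝ) (hz : ‖z‖ = Real.exp σ) :
    ‖weight ε t k l x z‖ = Real.exp (t * (z + 1 / z).re) * ‖1 - ε * z‖ ^ k * ‖1 - ε / z‖ ^ l *
      Real.exp (x * σ) := by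
  rw [weight, norm_mul, norm_mul, norm_mul, Complex.norm_exp, Complex.re_ofReal_mul, norm_pow,
    norm_pow, norm_zpow, hz, mul_comm (x : ℝ), Real.exp_mul σ, Real.rpow_intCast]

theorem norm_one_sub_mul_sq (ε : ℝ) (z : ℂ) :
    ‖1 - ε * z‖ ^ 2 = 1 + ε ^ 2 * ‖z‖ ^ 2 - 2 * ε * z.re := by
  rw [← Complex.normSq_eq_norm_sq, ← Complex.normSq_eq_norm_sq, Complex.normSq_apply,
    Complex.normSq_apply]
  simp
  ring

theorem one_sub_mul_one_sub {ε : ℝ} (hε : ε ≠ 0) {z : ℂ} (hz : z ≠ 0) :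
    (1 - ε * z) * (1 - ε / z) = ε * ((ε + ε⁻¹ : ℝ) - (z + 1 / z)) := by
  have : (ε : ℂ) ≠ 0 := by exact_mod_cast hε
  push_cast
  field_simp
  ring

/-- The bound `y ≤ exp (y - 1)`, applied to the square of a modulus. -/
theorem norm_le_mul_exp {p p₀ : ℝ} (hp₀ : 0 < p₀) :
    p ≤ p₀ * Real.exp ((p ^ 2 - p₀ ^ 2) / (2 * p₀ ^ 2)) := by
  apply le_of_sq_le_sq _ (by positivity)
  rw [mul_pow, ← Real.exp_nat_mul]
  have h := Real.add_one_le_exp (p ^ 2 / p₀ ^ 2 - 1)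
  have e : ((2 : ℕ) : ℝ) * ((p ^ 2 - p₀ ^ 2) / (2 * p₀ ^ 2)) = p ^ 2 / p₀ ^ 2 - 1 := by
    field_simp
    push_cast
    ring
  rw [e]
  have h2 : p ^ 2 / p₀ ^ 2 ≤ Real.exp (p ^ 2 / p₀ ^ 2 - 1) := by linarith
  calc p ^ 2 = p₀ ^ 2 * (p ^ 2 / p₀ ^ 2) := by field_simp
    _ ≤ _ := by gcongr

theorem re_add_one_div {σ θ : ℝ} {z : ℂ} (hz : z = Complex.exp (σ + θ * Complex.I)) :
    (z + 1 / z).re = 2 * Real.cosh σ * Real.cos θ := by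
  rw [hz, one_div, ← Complex.exp_neg, exp_add_exp_neg]
  simp [-Complex.ofReal_mul, -Complex.ofReal_cosh, -Complex.ofReal_sinh, -Complex.ofReal_cos,
      -Complex.ofReal_sin]

/-- On the circle of radius `exp σ` the real part of the exponent is a concave function
of `cos φ`: it is the sum of a linear function and of logarithms of linear functions.  So the weight
is bounded, up to a constant, by its value at the angle `θ` at which the tangent of this concave
function has the slope required in `hT`. -/
theorem exists_norm_weight_le {ε τ μ σ θ ρ : ℝ} (hε : 0 < ε)
    (hρ : 0 < ρ) (hρ2 : ρ ^ 2 = 4 * (Real.cosh σ ^ 2 + Real.cos θ ^ 2 -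
      (ε + ε⁻¹) * Real.cosh σ * Real.cos θ) + (ε + ε⁻¹) ^ 2 - 4)
    (hT : ∀ y ∈ Set.Icc (-1 : ℝ) 1, (y - Real.cos θ) * (2 * τ * Real.cosh σ -
      μ * ((ε + ε⁻¹) * Real.cosh σ - 2 * Real.cos θ) / ρ ^ 2) ≤ 0) :
    ∃ M > 0, ∀ L : ℝ, 0 ≤ L → ∀ k l : ℕ, |k - μ * L / 2| ≤ 1 → |l - μ * L / 2| ≤ 1 →
      ∀ x : ℤ, ∀ w : ℂ, ‖w‖ = Real.exp σ →
      ‖weight ε (τ * L) k l x w‖ ≤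
        M * ‖weight ε (τ * L) k l x (Complex.exp (σ + θ * Complex.I))‖ := by
  set zc := Complex.exp (σ + θ * Complex.I) with hzc
  have hzcn : ‖zc‖ = Real.exp σ := by rw [hzc, Complex.norm_exp]; simp
  have hzc0 : zc ≠ 0 := Complex.exp_ne_zero _
  set r := Real.exp σ with hr
  have hr0 : 0 < r := Real.exp_pos σ
  have hzcre : zc.re = r * Real.cos θ := by rw [hzc, Complex.exp_re]; simp [hr]
  have hC : Real.cosh σ = (r + r⁻¹) / 2 := by rw [Real.cosh_eq, Real.exp_neg]
  set p := ‖1 - ε * zc‖ with hp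
  set q := ‖1 - ε / zc‖ with hq
  have hinv : ∀ w : ℂ, ‖w‖ = r → (1 / w : ℂ).re = w.re / r ^ 2 ∧ ‖1 / w‖ = r⁻¹ := by
    intro w hw
    constructor
    · rw [one_div, Complex.inv_re, Complex.normSq_eq_norm_sq, hw]
    · rw [norm_div, hw, norm_one, one_div]
  have hp2 : ∀ w : ℂ, ‖w‖ = r → ‖1 - ε * w‖ ^ 2 = 1 + ε ^ 2 * r ^ 2 - 2 * ε * w.re := by
    intro w hw
    rw [norm_one_sub_mul_sq, hw]
  have hq2 : ∀ w : ℂ, ‖w‖ = r →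
      ‖1 - ε / w‖ ^ 2 = 1 + ε ^ 2 * (r⁻¹) ^ 2 - 2 * ε * (w.re / r ^ 2) := by
    intro w hw
    rw [div_eq_mul_one_div, norm_one_sub_mul_sq, (hinv w hw).1, (hinv w hw).2]
  have hpq : (p * q) ^ 2 = ε ^ 2 * ρ ^ 2 := by
    rw [mul_pow, hp, hq, hp2 _ hzcn, hq2 _ hzcn, hzcre, hρ2, hC]
    field_simp
    ring
  have hpq0 : p * q ≠ 0 := by
    intro h
    rw [h] at hpq
    have : 0 < ε ^ 2 * ρ ^ 2 := by positivity
    norm_num at hpq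
    rcases hpq with h | h <;> linarith
  have hp0 : 0 < p := lt_of_le_of_ne (norm_nonneg _) fun h => hpq0 (by rw [← h, zero_mul])
  have hq0 : 0 < q := lt_of_le_of_ne (norm_nonneg _) fun h => hpq0 (by rw [← h, mul_zero])
  set α := ε * r / p ^ 2 with hα
  set β := ε * r⁻¹ / q ^ 2 with hβ
  have hα0 : 0 < α := by positivity
  have hβ0 : 0 < β := by positivity
  have hαβ : α + β = 2 * ((ε + ε⁻¹) * Real.cosh σ - 2 * Real.cos θ) / ρ ^ 2 := by
    have e1 : α + β = ε * (r * q ^ 2 + r⁻¹ * p ^ 2) / (p * q) ^ 2 := by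
      rw [hα, hβ]; field_simp
    rw [e1, hpq, hp, hq, hp2 _ hzcn, hq2 _ hzcn, hzcre, hC]
    field_simp
    ring
  refine ⟨Real.exp (2 * (α + β)), Real.exp_pos _, fun L hL k l hk hl x w hw => ?_⟩
  rw [norm_weight σ hw, norm_weight σ hzcn, ← hp, ← hq]
  set y := w.re / r with hy
  have hyabs : |y| ≤ 1 := by
    rw [hy, abs_div, abs_of_pos hr0, div_le_one hr0, ← hw]
    exact Complex.abs_re_le_norm w
  have hy1 := abs_le.1 hyabs
  have hwre : w.re = r * y := by rw [hy]; field_simp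
  have h1 : ‖1 - ε * w‖ ≤ p * Real.exp (-(α * (y - Real.cos θ))) := by
    have h := norm_le_mul_exp (p := ‖1 - ε * w‖) hp0
    have e : (‖1 - ε * w‖ ^ 2 - p ^ 2) / (2 * p ^ 2) = -(α * (y - Real.cos θ)) := by
      have : ‖1 - ε * w‖ ^ 2 - p ^ 2 = -(2 * (ε * r) * (y - Real.cos θ)) := by
        rw [hp, hp2 _ hzcn, hp2 _ hw, hzcre, hwre]; ring
      rw [this, hα]; field_simp
    rwa [e] at h
  have h2 : ‖1 - ε / w‖ ≤ q * Real.exp (-(β * (y - Real.cos θ))) := by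
    have h := norm_le_mul_exp (p := ‖1 - ε / w‖) hq0
    have e : (‖1 - ε / w‖ ^ 2 - q ^ 2) / (2 * q ^ 2) = -(β * (y - Real.cos θ)) := by
      have : ‖1 - ε / w‖ ^ 2 - q ^ 2 = -(2 * (ε * r⁻¹) * (y - Real.cos θ)) := by
        rw [hq, hq2 _ hzcn, hq2 _ hw, hzcre, hwre]; field_simp; ring
      rw [this, hβ]; field_simp
    rwa [e] at h
  have h3 : (w + 1 / w).re = 2 * Real.cosh σ * y := by
    rw [Complex.add_re, (hinv w hw).1, hwre, hC]; field_simp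
  have h4 := re_add_one_div hzc
  rw [h3, h4]
  set d := y - Real.cos θ with hd
  have hd2 : |d| ≤ 2 := by
    rw [hd, abs_le]
    have := Real.neg_one_le_cos θ
    have := Real.cos_le_one θ
    constructor <;> linarith
  -- The exponents `k` and `l` differ from `μ L / 2` by at most `1`; this costs the factor
  -- `exp (2 (α + β))`, uniformly in `L`.
  have hexp : τ * L * (2 * Real.cosh σ * y) + k * (-(α * d)) + l * (-(β * d)) ≤
      2 * (α + β) + τ * L * (2 * Real.cosh σ * Real.cos θ) := by
    have hTy := mul_le_mul_of_nonneg_left (hT y ⟨hy1.1, hy1.2⟩) hL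
    have e1 : (k - μ * L / 2) * (-(α * d)) ≤ 2 * α := by
      calc (k - μ * L / 2) * (-(α * d)) ≤ |(k - μ * L / 2) * (-(α * d))| := le_abs_self _
        _ = |k - μ * L / 2| * (α * |d|) := by rw [abs_mul, abs_neg, abs_mul, abs_of_pos hα0]
        _ ≤ 1 * (α * 2) := by gcongr
        _ = 2 * α := by ring
    have e2 : (l - μ * L / 2) * (-(β * d)) ≤ 2 * β := by
      calc (l - μ * L / 2) * (-(β * d)) ≤ |(l - μ * L / 2) * (-(β * d))| := le_abs_self _
        _ = |l - μ * L / 2| * (β * |d|) := by rw [abs_mul, abs_neg, abs_mul, abs_of_pos hβ0]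
        _ ≤ 1 * (β * 2) := by gcongr
        _ = 2 * β := by ring
    have e3 : μ * ((ε + ε⁻¹) * Real.cosh σ - 2 * Real.cos θ) / ρ ^ 2 = μ / 2 * (α + β) := by
      rw [hαβ]; ring
    rw [e3] at hTy
    have e4 : y = d + Real.cos θ := by rw [hd]; ring
    rw [e4]
    linarith
  have e5 := Real.exp_le_exp.2 hexp
  rw [Real.exp_add, Real.exp_add, Real.exp_add, Real.exp_nat_mul _ k, Real.exp_nat_mul _ l] at e5
  have h5 := pow_le_pow_left₀ (norm_nonneg _) h1 k
  have h6 := pow_le_pow_left₀ (norm_nonneg _) h2 l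
  clear_value p q α β d y
  calc Real.exp (τ * L * (2 * Real.cosh σ * y)) * ‖1 - ε * w‖ ^ k * ‖1 - ε / w‖ ^ l *
        Real.exp (x * σ)
      ≤ Real.exp (τ * L * (2 * Real.cosh σ * y)) * (p * Real.exp (-(α * d))) ^ k *
        (q * Real.exp (-(β * d))) ^ l * Real.exp (x * σ) :=
        mul_le_mul_of_nonneg_right (mul_le_mul (mul_le_mul_of_nonneg_left h5 (Real.exp_pos _).le)
          h6 (by positivity) (by positivity)) (Real.exp_pos _).le
    _ = (Real.exp (τ * L * (2 * Real.cosh σ * y)) * Real.exp (-(α * d)) ^ k *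
        Real.exp (-(β * d)) ^ l) * (p ^ k * q ^ l * Real.exp (x * σ)) := by
        rw [mul_pow, mul_pow]; ring
    _ ≤ (Real.exp (2 * (α + β)) * Real.exp (τ * L * (2 * Real.cosh σ * Real.cos θ))) *
        (p ^ k * q ^ l * Real.exp (x * σ)) := mul_le_mul_of_nonneg_right e5 (by positivity)
    _ = _ := by ring

/-- Along the level curve `‖a - (z + z⁻¹)‖ = ρ` the product of the two linear factors of the weight
has constant modulus, so the ratio of two weights involves only the exponential factor and the
power of `z`. -/
theorem exists_norm_weight_ratio_le {ε τ ξ σ ρ b : ℝ} (hε : 0 < ε) (hρ : 0 < ρ)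
    {zc : ℂ} (hzc : ‖zc‖ = Real.exp σ)
    (hlev : ‖((ε + ε⁻¹ : ℝ) : ℂ) - (zc + 1 / zc)‖ = ρ) :
    ∃ M > 0, ∀ L : ℝ, 0 ≤ L → ∀ k l : ℕ, k = l ∨ l = k + 1 → ∀ x : ℤ, |x - ξ * L| ≤ 1 →
      ∀ z : ℂ, ∀ s : ℝ, ‖z‖ = Real.exp s → |s| ≤ b →
      ‖((ε + ε⁻¹ : ℝ) : ℂ) - (z + 1 / z)‖ = ρ →
      ‖weight ε (τ * L) k l x zc‖ ≤ M * ‖weight ε (τ * L) k l x z‖ *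
        Real.exp (-(L * (τ * ((z + 1 / z).re - (zc + 1 / zc).re) + ξ * (s - σ)))) := by
  have hne : ∀ {z : ℂ} {s : ℝ}, ‖z‖ = Real.exp s → z ≠ 0 := fun h =>
    ne_zero_of_le_norm (Real.exp_pos _) h.ge
  have hprod : ∀ {z : ℂ} {s : ℝ}, ‖z‖ = Real.exp s →
      ‖((ε + ε⁻¹ : ℝ) : ℂ) - (z + 1 / z)‖ = ρ → ‖1 - ε * z‖ * ‖1 - ε / z‖ = ε * ρ := by
    intro z s hz h
    rw [← norm_mul, one_sub_mul_one_sub hε.ne' (hne hz), norm_mul, h, Complex.norm_real,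
      Real.norm_of_nonneg hε.le]
  set κ := ε * ρ / (1 + ε * Real.exp b) with hκ
  have hκ0 : 0 < κ := by positivity
  set M₁ := max 1 (‖1 - ε / zc‖ / κ) with hM₁
  have hM₁1 : 1 ≤ M₁ := le_max_left _ _
  refine ⟨M₁ * Real.exp (b + |σ|), by positivity, fun L hL k l hkl x hx z s hz hs hz' => ?_⟩
  -- If `l = k + 1`, one factor `1 - ε / z` is unpaired; on the level curve it is bounded below.
  have hq : κ ≤ ‖1 - ε / z‖ := by
    rw [hκ, div_le_iff₀ (by positivity), ← hprod hz hz', mul_comm]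
    gcongr
    calc ‖1 - ε * z‖ ≤ ‖(1 : ℂ)‖ + ‖ε * z‖ := norm_sub_le _ _
      _ = 1 + ε * Real.exp s := by
        rw [norm_one, norm_mul, hz, Complex.norm_real, Real.norm_of_nonneg hε.le]
      _ ≤ _ := by gcongr; exact (abs_le.1 hs).2
  have hqc : ‖1 - ε / zc‖ ≤ M₁ * ‖1 - ε / z‖ := by
    calc ‖1 - ε / zc‖ = ‖1 - ε / zc‖ / κ * κ := by field_simp
      _ ≤ M₁ * ‖1 - ε / z‖ := by gcongr; exact le_max_right _ _
  have hfac : ‖1 - ε * zc‖ ^ k * ‖1 - ε / zc‖ ^ l ≤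
      M₁ * (‖1 - ε * z‖ ^ k * ‖1 - ε / z‖ ^ l) := by
    have e1 : (‖1 - ε * zc‖ * ‖1 - ε / zc‖) ^ k = (‖1 - ε * z‖ * ‖1 - ε / z‖) ^ k := by
      rw [hprod hzc hlev, hprod hz hz']
    rw [mul_pow, mul_pow] at e1
    rcases hkl with rfl | rfl
    · rw [e1]
      exact le_mul_of_one_le_left (by positivity) hM₁1
    · rw [pow_succ, pow_succ, ← mul_assoc, ← mul_assoc, e1]
      calc ‖1 - ε * z‖ ^ k * ‖1 - ε / z‖ ^ k * ‖1 - ε / zc‖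
          ≤ ‖1 - ε * z‖ ^ k * ‖1 - ε / z‖ ^ k * (M₁ * ‖1 - ε / z‖) := by gcongr
        _ = _ := by ring
  have hexp : τ * L * (zc + 1 / zc).re + x * σ ≤
      (b + |σ|) + (τ * L * (z + 1 / z).re + x * s) +
        -(L * (τ * ((z + 1 / z).re - (zc + 1 / zc).re) + ξ * (s - σ))) := by
    have : (x - ξ * L) * (σ - s) ≤ b + |σ| := by
      calc (x - ξ * L) * (σ - s) ≤ |(x - ξ * L) * (σ - s)| := le_abs_self _
        _ = |x - ξ * L| * |σ - s| := abs_mul _ _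
        _ ≤ 1 * (|σ| + |s|) := by gcongr; exact abs_sub _ _
        _ ≤ b + |σ| := by linarith
    nlinarith
  have e5 := Real.exp_le_exp.2 hexp
  rw [Real.exp_add, Real.exp_add, Real.exp_add, Real.exp_add (τ * L * (z + 1 / z).re)] at e5
  rw [norm_weight σ hzc, norm_weight s hz]
  calc Real.exp (τ * L * (zc + 1 / zc).re) * ‖1 - ε * zc‖ ^ k * ‖1 - ε / zc‖ ^ l * Real.exp (x * σ)
      = (Real.exp (τ * L * (zc + 1 / zc).re) * Real.exp (x * σ)) *
        (‖1 - ε * zc‖ ^ k * ‖1 - ε / zc‖ ^ l) := by ring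
    _ ≤ (Real.exp (b + |σ|) * (Real.exp (τ * L * (z + 1 / z).re) * Real.exp (x * s)) *
        Real.exp (-(L * (τ * ((z + 1 / z).re - (zc + 1 / zc).re) + ξ * (s - σ))))) *
        (M₁ * (‖1 - ε * z‖ ^ k * ‖1 - ε / z‖ ^ l)) := by gcongr
    _ = _ := by ring

/-! ### Singular integrals and the action on the level curve -/

theorem intervalIntegrable_abs_sin_rpow (a b : ℝ) :
    IntervalIntegrable (fun x => |Real.sin x| ^ (-(7 / 8) : ℝ)) MeasureTheory.volume a b := by
  have hpi := Real.pi_pos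
  have hmeas : Measurable (fun x => |Real.sin x| ^ (-(7 / 8) : ℝ)) := by fun_prop
  have h1 : IntervalIntegrable (fun x => |Real.sin x| ^ (-(7 / 8) : ℝ)) MeasureTheory.volume 0
      (Real.pi / 2) := by
    have hi : IntervalIntegrable (fun x : ℝ => (2 / Real.pi) ^ (-(7 / 8) : ℝ) * x ^ (-(7 / 8) : ℝ))
        MeasureTheory.volume 0 (Real.pi / 2) :=
      (intervalIntegral.intervalIntegrable_rpow' (by norm_num)).const_mul _
    refine hi.mono_fun' hmeas.aestronglyMeasurable ?_
    rw [Set.uIoc_of_le (by positivity)]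
    filter_upwards [MeasureTheory.ae_restrict_mem measurableSet_Ioc] with x hx
    have hs := Real.mul_le_sin hx.1.le hx.2
    have hpos : 0 < 2 / Real.pi * x := mul_pos (by positivity) hx.1
    rw [Real.norm_of_nonneg (by positivity), ← Real.mul_rpow (by positivity) hx.1.le]
    apply Real.rpow_le_rpow_of_nonpos hpos _ (by norm_num)
    exact hs.trans (le_abs_self _)
  have h2 : IntervalIntegrable (fun x => |Real.sin x| ^ (-(7 / 8) : ℝ)) MeasureTheory.volume
      (Real.pi / 2) Real.pi := by
    have h := (h1.comp_sub_left Real.pi).symm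
    simp only [Real.sin_pi_sub, sub_zero] at h
    rwa [show Real.pi - Real.pi / 2 = Real.pi / 2 by ring] at h
  have hper : Function.Periodic (fun x => |Real.sin x| ^ (-(7 / 8) : ℝ)) Real.pi := by
    intro x
    simp [Real.sin_add_pi]
  exact hper.intervalIntegrable₀ hpi.ne' (h1.trans h2) a b

/-- The Cauchy integral of a function of modulus at most `B` on the circle grows at most like the
power `-1/8` of the distance to the circle. -/
theorem exists_norm_cauchyInt_le {r : ℝ} (hr : 0 < r) :
    ∃ M > 0, ∀ (g : ℂ → ℂ) (B : ℝ), 0 ≤ B → (∀ w, ‖w‖ = r → ‖g w‖ ≤ B) →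
      ∀ z : ℂ, z ≠ 0 → ‖z‖ ≠ r → ‖cauchyInt g r z‖ ≤ M * B * |‖z‖ - r| ^ (-(1 / 8) : ℝ) := by
  set J := ∫ x in (0 : ℝ)..2 * Real.pi, |Real.sin x| ^ (-(7 / 8) : ℝ) with hJ
  have hper : Function.Periodic (fun x => |Real.sin x| ^ (-(7 / 8) : ℝ)) (2 * Real.pi) := by
    intro x
    simp
  have hJ0 : 0 ≤ J := intervalIntegral.integral_nonneg (by positivity) fun x _ => by positivity
  refine ⟨r * r ^ (-(7 / 8) : ℝ) * (J + 1), by positivity, fun g B hB hg z hz hzr => ?_⟩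
  set d := |‖z‖ - r| with hd
  have hd0 : 0 < d := abs_pos.2 (sub_ne_zero.2 hzr)
  have hpt : ∀ φ : ℝ, Real.sin (φ - z.arg) ≠ 0 →
      ‖deriv (circleMap 0 r) φ • (g (circleMap 0 r φ) / (circleMap 0 r φ - z))‖ ≤
      r * r ^ (-(7 / 8) : ℝ) * B * d ^ (-(1 / 8) : ℝ) * |Real.sin (φ - z.arg)| ^ (-(7 / 8) : ℝ) := by
    intro φ hsin
    set w := circleMap 0 r φ with hw
    have hwn : ‖w‖ = r := by simp [hw, hr.le]
    have h1 : d ≤ ‖w - z‖ := by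
      rw [hd, ← hwn, abs_sub_comm]
      exact abs_norm_sub_norm_le _ _
    have h2 : r * |Real.sin (φ - z.arg)| ≤ ‖w - z‖ := by
      have e1 : ‖w - z‖ = ‖(w - z) * Complex.exp ((-z.arg : ℝ) * Complex.I)‖ := by
        rw [norm_mul, Complex.norm_exp_ofReal_mul_I, mul_one]
      have e2 : (w - z) * Complex.exp ((-z.arg : ℝ) * Complex.I) =
          r * Complex.exp ((φ - z.arg : ℝ) * Complex.I) - ‖z‖ := by
        have hz2 : z = ‖z‖ * Complex.exp (z.arg * Complex.I) :=
          (Complex.norm_mul_exp_arg_mul_I z).symm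
        rw [sub_mul]
        congr 1
        · simp only [hw, circleMap, zero_add, mul_assoc, ← Complex.exp_add]
          congr 2
          push_cast
          ring
        · nth_rw 1 [hz2]
          rw [mul_assoc, ← Complex.exp_add]
          push_cast
          rw [show (z.arg : ℂ) * Complex.I + -z.arg * Complex.I = 0 by ring, Complex.exp_zero, mul_one]
      rw [e1, e2]
      refine le_trans (le_of_eq ?_) (Complex.abs_im_le_norm _)
      rw [Complex.sub_im, Complex.im_ofReal_mul, Complex.exp_ofReal_mul_I_im, Complex.ofReal_im,
        sub_zero, abs_mul, abs_of_pos hr]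
    have hs0 : 0 < |Real.sin (φ - z.arg)| := abs_pos.2 hsin
    have h3 : 0 < ‖w - z‖ := hd0.trans_le h1
    -- The power `7/8` of the singularity is integrable along the circle, and the remaining power `1/8` is
    -- bounded through the distance to the circle.  The latter exponent is small enough to be integrable later, where
    -- the level curve may be tangent to the circle and its parametrization has a square root singularity.
    have h4 : ‖w - z‖⁻¹ ≤ d ^ (-(1 / 8) : ℝ) * (r * |Real.sin (φ - z.arg)|) ^ (-(7 / 8) : ℝ) := by
      calc ‖w - z‖⁻¹ = ‖w - z‖ ^ (-(1 / 8) : ℝ) * ‖w - z‖ ^ (-(7 / 8) : ℝ) := by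
            rw [← Real.rpow_add h3, ← Real.rpow_neg_one]; norm_num
        _ ≤ _ := by
          apply mul_le_mul
          · exact Real.rpow_le_rpow_of_nonpos hd0 h1 (by norm_num)
          · exact Real.rpow_le_rpow_of_nonpos (by positivity) h2 (by norm_num)
          · positivity
          · positivity
    rw [norm_smul, norm_div, deriv_circleMap, norm_mul, Complex.norm_I, mul_one, ← hw, hwn,
      div_eq_mul_inv]
    rw [Real.mul_rpow hr.le hs0.le] at h4
    calc r * (‖g w‖ * ‖w - z‖⁻¹) ≤ r * (B * (d ^ (-(1 / 8) : ℝ) *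
          (r ^ (-(7 / 8) : ℝ) * |Real.sin (φ - z.arg)| ^ (-(7 / 8) : ℝ)))) := by
          gcongr; exact hg w hwn
      _ = _ := by ring
  have hae : ∀ᵐ φ : ℝ, Real.sin (φ - z.arg) ≠ 0 := by
    have hc : {φ : ℝ | Real.sin (φ - z.arg) = 0}.Countable := by
      have : {φ : ℝ | Real.sin (φ - z.arg) = 0} ⊆ Set.range fun n : ℤ => z.arg + n * Real.pi := by
        intro φ hφ
        obtain ⟨n, hn⟩ := Real.sin_eq_zero_iff.1 hφ
        exact ⟨n, by simp only; linarith⟩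
      exact (Set.countable_range _).mono this
    exact (hc.ae_notMem MeasureTheory.volume)
  have hint : IntervalIntegrable (fun φ => |Real.sin (φ - z.arg)| ^ (-(7 / 8) : ℝ))
      MeasureTheory.volume 0 (2 * Real.pi) := by
    simpa using (intervalIntegrable_abs_sin_rpow (0 - z.arg)
      (2 * Real.pi - z.arg)).comp_sub_right z.arg
  have hbound := intervalIntegral.norm_integral_le_of_norm_le (μ := MeasureTheory.volume)
    (a := 0) (b := 2 * Real.pi) (by positivity)
    (f := fun φ => deriv (circleMap 0 r) φ • (g (circleMap 0 r φ) / (circleMap 0 r φ - z)))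
    (g := fun φ => r * r ^ (-(7 / 8) : ℝ) * B * d ^ (-(1 / 8) : ℝ) *
      |Real.sin (φ - z.arg)| ^ (-(7 / 8) : ℝ))
    (by filter_upwards [hae] with φ hφ _ using hpt φ hφ)
    (hint.const_mul _)
  have hshift : (∫ φ in (0 : ℝ)..2 * Real.pi, |Real.sin (φ - z.arg)| ^ (-(7 / 8) : ℝ)) = J := by
    rw [intervalIntegral.integral_comp_sub_right (fun x => |Real.sin x| ^ (-(7 / 8) : ℝ)) z.arg]
    have := hper.intervalIntegral_add_eq (0 - z.arg) 0
    rw [zero_add] at this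
    rw [hJ, ← this]
    congr 1
    ring
  rw [intervalIntegral.integral_const_mul, hshift] at hbound
  calc ‖cauchyInt g r z‖ ≤ r * r ^ (-(7 / 8) : ℝ) * B * d ^ (-(1 / 8) : ℝ) * J := hbound
    _ ≤ r * r ^ (-(7 / 8) : ℝ) * B * d ^ (-(1 / 8) : ℝ) * (J + 1) := by gcongr; linarith
    _ = _ := by ring

theorem sq_le_abs_cos_sub_cos {x y : ℝ} (hx : x ∈ Set.Icc 0 Real.pi) (hy : y ∈ Set.Icc 0 Real.pi) :
    2 / Real.pi ^ 2 * |x - y| ^ 2 ≤ |Real.cos x - Real.cos y| := by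
  wlog hxy : y ≤ x generalizing x y
  · rw [abs_sub_comm, abs_sub_comm (Real.cos x)]
    exact this hy hx (le_of_not_ge hxy)
  have hpi := Real.pi_pos
  rw [abs_of_nonneg (sub_nonneg.2 hxy)]
  have h1 : 2 / Real.pi * ((x - y) / 2) ≤ Real.sin ((x - y) / 2) :=
    Real.mul_le_sin (by linarith) (by linarith [hx.2, hy.1])
  have h2 : Real.sin ((x - y) / 2) ≤ Real.sin ((x + y) / 2) := by
    have h := Real.sin_sub_sin ((x + y) / 2) ((x - y) / 2)
    rw [show ((x + y) / 2 - (x - y) / 2) / 2 = y / 2 by ring,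
      show ((x + y) / 2 + (x - y) / 2) / 2 = x / 2 by ring] at h
    have := Real.sin_nonneg_of_nonneg_of_le_pi (x := y / 2) (by linarith [hy.1]) (by linarith [hy.2])
    have := Real.cos_nonneg_of_neg_pi_div_two_le_of_le (x := x / 2) (by linarith [hx.1])
      (by linarith [hx.2])
    nlinarith
  have h3 : 0 ≤ 2 / Real.pi * ((x - y) / 2) := by
    have : 0 ≤ x - y := by linarith
    positivity
  rw [Real.cos_sub_cos, abs_mul, abs_mul]
  rw [abs_of_nonneg (h3.trans (h1.trans h2)), abs_of_nonneg (h3.trans h1)]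
  norm_num
  calc 2 / Real.pi ^ 2 * (x - y) ^ 2 =
        2 * (2 / Real.pi * ((x - y) / 2)) * (2 / Real.pi * ((x - y) / 2)) := by field_simp
    _ ≤ 2 * Real.sin ((x + y) / 2) * Real.sin ((x - y) / 2) := by
        exact mul_le_mul (mul_le_mul_of_nonneg_left (h1.trans h2) two_pos.le) h1 h3
          (mul_nonneg two_pos.le (h3.trans (h1.trans h2)))

/-- The elliptic coordinate `C` separates the points of the level curve quadratically. -/
theorem exists_abs_ellC_sub_ge {a ρ : ℝ} (ha : 2 ≤ a) (hρ : 0 < ρ) :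
    ∃ κ > 0, ∀ ψ ∈ Set.Icc 0 Real.pi, ∀ ψ' ∈ Set.Icc 0 Real.pi,
      κ * |ψ - ψ'| ^ 2 ≤ |ellC (levelU a ρ ψ) - ellC (levelU a ρ ψ')| := by
  have hB : ∀ ψ, ‖levelU a ρ ψ + 2‖ ≤ a + 2 + ρ := by
    intro ψ
    have h1 : ‖levelU a ρ ψ + 2‖ ≤ ‖levelU a ρ Real.pi + 2‖ :=
      (norm_levelU_le ha hρ (by rw [Real.cos_pi]; exact Real.neg_one_le_cos ψ)).2
    have h2 : ‖levelU a ρ Real.pi + 2‖ = a + 2 + ρ := by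
      rw [levelU_pi, show ((a + ρ : ℝ) : ℂ) + 2 = ((a + 2 + ρ : ℝ) : ℂ) by push_cast; ring,
        Complex.norm_real, Real.norm_of_nonneg (by linarith)]
    linarith
  refine ⟨(a + 2) * ρ / (4 * (a + 2 + ρ)) * (2 / Real.pi ^ 2), by positivity, ?_⟩
  have key : ∀ ψ ψ', Real.cos ψ' ≤ Real.cos ψ →
      (a + 2) * ρ / (4 * (a + 2 + ρ)) * (Real.cos ψ - Real.cos ψ') ≤
        ellC (levelU a ρ ψ') - ellC (levelU a ρ ψ) := by
    intro ψ ψ' h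
    obtain ⟨h1, h2⟩ := norm_levelU_le ha hρ h
    have h3 := norm_levelU_add_two_sq a ρ ψ
    have h4 := norm_levelU_add_two_sq a ρ ψ'
    have h5 := hB ψ
    have h6 := hB ψ'
    set A := ‖levelU a ρ ψ + 2‖
    set A' := ‖levelU a ρ ψ' + 2‖
    have h7 : 2 * (a + 2) * ρ * (Real.cos ψ - Real.cos ψ') = (A' - A) * (A' + A) := by
      linear_combination h3 - h4
    have h8 : (a + 2) * ρ / (4 * (a + 2 + ρ)) * (Real.cos ψ - Real.cos ψ') ≤ (A' - A) / 4 := by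
      have e : (a + 2) * ρ / (4 * (a + 2 + ρ)) * (Real.cos ψ - Real.cos ψ') =
          (A' - A) * (A' + A) / (8 * (a + 2 + ρ)) := by
        rw [← h7]; field_simp; ring
      rw [e, div_le_div_iff₀ (by positivity) (by norm_num)]
      nlinarith [sub_nonneg.2 h2]
    unfold ellC
    linarith
  intro ψ hψ ψ' hψ'
  rw [mul_assoc]
  have hc := sq_le_abs_cos_sub_cos hψ hψ'
  have hpos : 0 ≤ (a + 2) * ρ / (4 * (a + 2 + ρ)) := by positivity
  refine (mul_le_mul_of_nonneg_left hc hpos).trans ?_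
  rcases le_total (Real.cos ψ') (Real.cos ψ) with h | h
  · rw [abs_of_nonneg (sub_nonneg.2 h), abs_sub_comm]
    exact (key _ _ h).trans (le_abs_self _)
  · rw [abs_of_nonpos (sub_nonpos.2 h), neg_sub]
    exact (key _ _ h).trans (le_abs_self _)

theorem cosh_add_sinh_mul_lt {x y : ℝ} (h : y ≠ x) :
    Real.cosh x + Real.sinh x * (y - x) < Real.cosh y := by
  have hgen : ∀ d : ℝ, d ≠ 0 → Real.cosh x + Real.sinh x * d < Real.cosh (x + d) := by
    intro d hd
    have h1 := mul_lt_mul_of_pos_left (Real.add_one_lt_exp hd) (Real.exp_pos x)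
    have h2 := mul_lt_mul_of_pos_left (Real.add_one_lt_exp (neg_ne_zero.2 hd)) (Real.exp_pos (-x))
    rw [Real.cosh_eq, Real.sinh_eq, Real.cosh_eq, neg_add, Real.exp_add, Real.exp_add]
    linarith
  simpa using hgen (y - x) (sub_ne_zero.2 h)

/-- The square root lies below its tangents. -/
theorem sub_le_of_sq_sub_sq {p q d : ℝ} (hp : 0 < p) (h : q ^ 2 - p ^ 2 = d) :
    q - p ≤ d / (2 * p) := by
  rw [le_div_iff₀ (by positivity)]
  linarith [sq_nonneg (q - p)]

/-- The comparison of the values of the action at the points of the level curve with its value at the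
critical point: on the curve `4 C` is the sum of the square roots of two affine functions of
`Re u`, so it lies below its tangent, while `cosh` lies above its tangent. -/
theorem level_action_pos {a τ ξ ρ C c σ C₁ c₁ σ₁ : ℝ} (ha : 2 ≤ a) (hτ : 0 < τ)
    (hC : C = Real.cosh σ) (hC₁ : C₁ = Real.cosh σ₁) (hc : |c| ≤ 1) (hc₁ : |c₁| ≤ 1)
    (hden : 0 < a * C - 2 * c)
    (hξ : ξ = -(4 * τ * Real.sinh σ * (C ^ 2 - c ^ 2) / (a * C - 2 * c)))
    (hlev : ρ ^ 2 = 4 * (C ^ 2 + c ^ 2 - a * C * c) + a ^ 2 - 4)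
    (hlev₁ : ρ ^ 2 = 4 * (C₁ ^ 2 + c₁ ^ 2 - a * C₁ * c₁) + a ^ 2 - 4) (hne : σ₁ ≠ σ) :
    0 < τ * (2 * C₁ * c₁ - 2 * C * c) + ξ * (σ₁ - σ) := by
  have hC1 : 1 ≤ C := hC ▸ Real.one_le_cosh σ
  have hC₁1 : 1 ≤ C₁ := hC₁ ▸ Real.one_le_cosh σ₁
  have hc' := abs_le.1 hc
  have hc₁' := abs_le.1 hc₁
  obtain ⟨X, hX⟩ : ∃ X, X = 2 * C₁ * c₁ - 2 * C * c := ⟨_, rfl⟩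
  have hpp : (C₁ - c₁) ^ 2 - (C - c) ^ 2 = (a - 2) * X / 2 := by
    rw [hX]; linear_combination (hlev - hlev₁) / 4
  have hqq : (C₁ + c₁) ^ 2 - (C + c) ^ 2 = (a + 2) * X / 2 := by
    rw [hX]; linear_combination (hlev - hlev₁) / 4
  rw [← hX]
  -- For `σ = 0` the real point `C = |c| = 1` is possible, where one of the square roots vanishes and
  -- has no tangent.
  by_cases hσ : σ = 0
  · rw [hσ, Real.sinh_zero] at hξ
    have hξ0 : ξ = 0 := by rw [hξ]; simp
    have hC1' : C = 1 := by rw [hC, hσ, Real.cosh_zero]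
    have hC₁' : 1 < C₁ := by rw [hC₁]; exact Real.one_lt_cosh.2 (by rwa [hσ] at hne)
    have hXpos : 0 < X := by
      by_contra hX0
      have h1 : C₁ - c₁ ≤ C - c := by
        apply le_of_sq_le_sq _ (by linarith)
        have := mul_nonneg (sub_nonneg.2 ha) (neg_nonneg.2 (not_lt.1 hX0))
        linarith
      have h2 : C₁ + c₁ ≤ C + c := by
        apply le_of_sq_le_sq _ (by linarith)
        have := mul_nonneg (by linarith : 0 ≤ a + 2) (neg_nonneg.2 (not_lt.1 hX0))
        linarith
      linarith
    rw [hξ0, zero_mul, add_zero]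
    positivity
  · have hC1' : 1 < C := by rw [hC]; exact Real.one_lt_cosh.2 hσ
    obtain ⟨p, hp⟩ : ∃ p, p = C - c := ⟨_, rfl⟩
    obtain ⟨q, hq⟩ : ∃ q, q = C + c := ⟨_, rfl⟩
    have hp0 : 0 < p := by linarith
    have hq0 : 0 < q := by linarith
    have htan : Real.sinh σ * (σ₁ - σ) < C₁ - C := by
      have := cosh_add_sinh_mul_lt hne
      rw [hC, hC₁]
      linarith
    have hsum : C₁ - C ≤ X * (a * C - 2 * c) / (4 * (p * q)) := by
      have h1 := sub_le_of_sq_sub_sq (by linarith) hpp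
      have h2 := sub_le_of_sq_sub_sq (by linarith) hqq
      rw [← hp] at h1
      rw [← hq] at h2
      have e : X * (a * C - 2 * c) / (4 * (p * q)) =
          ((a - 2) * X / 2 / (2 * p) + (a + 2) * X / 2 / (2 * q)) / 2 := by
        have : a * C - 2 * c = ((a - 2) * q + (a + 2) * p) / 2 := by rw [hp, hq]; ring
        rw [this]
        field_simp
        ring
      rw [e]
      linarith
    have hpq : C ^ 2 - c ^ 2 = p * q := by rw [hp, hq]; ring
    have hlt := htan.trans_le hsum
    rw [lt_div_iff₀ (by positivity)] at hlt
    have e : τ * X + ξ * (σ₁ - σ) = τ * (X * (a * C - 2 * c) -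
        Real.sinh σ * (σ₁ - σ) * (4 * (p * q))) / (a * C - 2 * c) := by
      rw [hξ, hpq]; field_simp; ring
    rw [e]
    exact div_pos (mul_pos hτ (sub_pos.2 hlt)) hden

/-! ### Saddle points -/

/-- The point `exp (σ + i θ)` of the closed upper half plane is a saddle point for the parameters
`(ξ, μ)`.  Here `ρ` is the distance between `ε + ε⁻¹` and `z + z⁻¹`, and the condition `slope`
says that, asymptotically, the modulus of the weight is maximal on the circle of radius `exp σ` at
this point: the derivative with respect to `y = cos φ` of the logarithm of the modulus, which is
concave, vanishes there or points out of `[-1, 1]`.  In the interior of the upper half plane this is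
an equation for `μ`, at the real points an inequality. -/
structure IsSaddle (ε τ ξ μ σ θ ρ : ℝ) : Prop where
  angle_mem : θ ∈ Set.Icc 0 Real.pi
  den_pos : 0 < (ε + ε⁻¹) * Real.cosh σ - 2 * Real.cos θ
  radius_pos : 0 < ρ
  radius_sq : ρ ^ 2 = 4 * (Real.cosh σ ^ 2 + Real.cos θ ^ 2 -
    (ε + ε⁻¹) * Real.cosh σ * Real.cos θ) + (ε + ε⁻¹) ^ 2 - 4
  speed : ξ = -(4 * τ * Real.sinh σ * (Real.cosh σ ^ 2 - Real.cos θ ^ 2) /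
    ((ε + ε⁻¹) * Real.cosh σ - 2 * Real.cos θ))
  slope : ∀ y ∈ Set.Icc (-1 : ℝ) 1, (y - Real.cos θ) * (2 * τ * Real.cosh σ -
    μ * ((ε + ε⁻¹) * Real.cosh σ - 2 * Real.cos θ) / ρ ^ 2) ≤ 0

/-- Points of the level curve in terms of the elliptic coordinates. -/
theorem exists_level_param {a ρ σ θ : ℝ} (hρ : 0 < ρ) (hθ : θ ∈ Set.Icc 0 Real.pi)
    (hlev : ρ ^ 2 = 4 * (Real.cosh σ ^ 2 + Real.cos θ ^ 2 -
      a * Real.cosh σ * Real.cos θ) + a ^ 2 - 4) :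
    ∃ ψ ∈ Set.Icc 0 Real.pi, ellC (levelU a ρ ψ) = Real.cosh σ ∧ levelσ a ρ ψ = |σ| ∧
      levelθ a ρ ψ = θ := by
  obtain ⟨C, hC⟩ : ∃ C, C = Real.cosh σ := ⟨_, rfl⟩
  obtain ⟨c, hc⟩ : ∃ c, c = Real.cos θ := ⟨_, rfl⟩
  have hC1 : 1 ≤ C := hC ▸ Real.one_le_cosh σ
  have hc1 : c ≤ 1 := hc ▸ Real.cos_le_one θ
  have hc2 : -1 ≤ c := hc ▸ Real.neg_one_le_cos θ
  rw [← hC, ← hc] at hlev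
  have hdiff : ρ ^ 2 - (a - 2 * C * c) ^ 2 = 4 * ((C ^ 2 - 1) * (1 - c ^ 2)) := by
    rw [hlev]; ring
  have hnn : 0 ≤ (C ^ 2 - 1) * (1 - c ^ 2) := by
    apply mul_nonneg <;> nlinarith
  have habs : |a - 2 * C * c| ≤ ρ := abs_le_of_sq_le_sq (by linarith) hρ.le
  obtain ⟨h1, h2⟩ := abs_le.1 habs
  have hcos : Real.cos (Real.arccos ((a - 2 * C * c) / ρ)) = (a - 2 * C * c) / ρ := by
    apply Real.cos_arccos
    · rw [le_div_iff₀ hρ]; linarith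
    · rw [div_le_iff₀ hρ]; linarith
  have hcos' : ρ * Real.cos (Real.arccos ((a - 2 * C * c) / ρ)) = a - 2 * C * c := by
    rw [hcos]; field_simp
  refine ⟨Real.arccos ((a - 2 * C * c) / ρ), ⟨Real.arccos_nonneg _, Real.arccos_le_pi _⟩, ?_⟩
  set ψ := Real.arccos ((a - 2 * C * c) / ρ)
  have hm : ‖levelU a ρ ψ - 2‖ = 2 * (C - c) := by
    apply (sq_eq_sq₀ (norm_nonneg _) (by linarith)).1
    rw [norm_levelU_sub_two_sq]
    linear_combination hlev + (-2 * (a - 2)) * hcos'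
  have hp : ‖levelU a ρ ψ + 2‖ = 2 * (C + c) := by
    apply (sq_eq_sq₀ (norm_nonneg _) (by linarith)).1
    rw [norm_levelU_add_two_sq]
    linear_combination hlev + (-2 * (a + 2)) * hcos'
  have e1 : ellC (levelU a ρ ψ) = C := by unfold ellC; rw [hm, hp]; ring
  have e2 : ellc (levelU a ρ ψ) = c := by unfold ellc; rw [hm, hp]; ring
  refine ⟨by rw [e1, hC], ?_, ?_⟩
  · rw [levelσ, e1, hC, ← Real.cosh_abs, Real.arcosh_cosh (abs_nonneg _)]
  · rw [levelθ, e2, hc, Real.arccos_cos hθ.1 hθ.2]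

theorem abs_cosh_sub_cosh_le {x y b : ℝ} (hx : |x| ≤ b) (hy : |y| ≤ b) :
    |Real.cosh x - Real.cosh y| ≤ (1 + Real.exp (2 * b)) / 2 * |Real.exp x - Real.exp y| := by
  have e : Real.cosh x - Real.cosh y =
      (1 - Real.exp (-(x + y))) / 2 * (Real.exp x - Real.exp y) := by
    have h1 := Real.exp_ne_zero x
    have h2 := Real.exp_ne_zero y
    rw [Real.cosh_eq, Real.cosh_eq, neg_add, Real.exp_add, Real.exp_neg, Real.exp_neg]
    field_simp
    ring
  rw [e, abs_mul]
  gcongr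
  have h1 := Real.exp_pos (-(x + y))
  have h2 : Real.exp (-(x + y)) ≤ Real.exp (2 * b) := by
    apply Real.exp_le_exp.2
    linarith [(abs_le.1 hx).1, (abs_le.1 hy).1]
  rw [abs_le]
  constructor <;> linarith

theorem intervalIntegrable_abs_sub_rpow {p q c r : ℝ} (hc : c ∈ Set.Icc p q) (hr : -1 < r) :
    IntervalIntegrable (fun x => |x - c| ^ r) MeasureTheory.volume p q := by
  have h1 : IntervalIntegrable (fun x => |x - c| ^ r) MeasureTheory.volume p c := by
    have h := (intervalIntegral.intervalIntegrable_rpow' (a := c - p) (b := c - c) hr).comp_sub_left c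
    simp only [sub_sub_cancel] at h
    refine h.congr_uIoo ?_
    rw [Set.uIoo_of_le hc.1]
    intro x hx
    simp only
    rw [abs_sub_comm, abs_of_pos (sub_pos.2 hx.2)]
  have h2 : IntervalIntegrable (fun x => |x - c| ^ r) MeasureTheory.volume c q := by
    have h := (intervalIntegral.intervalIntegrable_rpow' (a := c - c) (b := q - c) hr).comp_sub_right c
    simp only [sub_add_cancel] at h
    refine h.congr_uIoo ?_
    rw [Set.uIoo_of_le hc.2]
    intro x hx
    simp only
    rw [abs_of_pos (sub_pos.2 hx.1)]
  exact h1.trans h2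

/-- This separates the two singularities of the integrand on the level curve, at the end of the curve and
at the saddle point. -/
theorem rpow_mul_rpow_le {x y : ℝ} (hx : 0 < x) (hy : 0 < y) :
    x ^ (-(1 / 2) : ℝ) * y ^ (-(1 / 4) : ℝ) ≤ x ^ (-(3 / 4) : ℝ) + y ^ (-(3 / 4) : ℝ) := by
  have e : ∀ w : ℝ, 0 < w → w ^ (-(3 / 4) : ℝ) = w ^ (-(1 / 2) : ℝ) * w ^ (-(1 / 4) : ℝ) := by
    intro w hw
    rw [← Real.rpow_add hw]
    norm_num
  rcases le_total x y with h | h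
  · have h1 : y ^ (-(1 / 4) : ℝ) ≤ x ^ (-(1 / 4) : ℝ) :=
      Real.rpow_le_rpow_of_nonpos hx h (by norm_num)
    have h2 : 0 ≤ y ^ (-(3 / 4) : ℝ) := by positivity
    rw [e x hx]
    have := mul_le_mul_of_nonneg_left h1 (by positivity : 0 ≤ x ^ (-(1 / 2) : ℝ))
    linarith
  · have h1 : x ^ (-(1 / 2) : ℝ) ≤ y ^ (-(1 / 2) : ℝ) :=
      Real.rpow_le_rpow_of_nonpos hy h (by norm_num)
    have h2 : 0 ≤ x ^ (-(3 / 4) : ℝ) := by positivity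
    rw [e y hy]
    have := mul_le_mul_of_nonneg_right h1 (by positivity : 0 ≤ y ^ (-(1 / 4) : ℝ))
    linarith

theorem exp_levelζ_add_one_div {a ρ s ψ : ℝ} (hρ : 0 < ρ) (hψ : ψ ∈ Set.Icc 0 Real.pi)
    (hs : s = 1 ∨ s = -1) {z : ℂ} (hz : z = Complex.exp (levelζ a ρ s ψ) ∨
      z = Complex.exp ((starRingEnd ℂ) (levelζ a ρ s ψ))) :
    z + 1 / z = levelU a ρ ψ ∨ z + 1 / z = (starRingEnd ℂ) (levelU a ρ ψ) := by
  have h := exp_level_add_exp_neg (a := a) hρ hψ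
  have h' := congrArg (starRingEnd ℂ) h
  rw [map_add, ← Complex.exp_conj, ← Complex.exp_conj] at h'
  have key : ∀ η : ℂ, Complex.exp η + 1 / Complex.exp η = Complex.exp η + Complex.exp (-η) := by
    intro η; rw [Complex.exp_neg, one_div]
  rcases hs with rfl | rfl <;> rcases hz with rfl | rfl
  · right
    rw [key, ← h', add_comm]
    congr 2 <;> simp [levelζ] <;> ring
  · left
    rw [key, ← h, add_comm]
    congr 2 <;> simp [levelζ] <;> ring
  · left
    rw [key, ← h]
    congr 2 <;> simp [levelζ]
  · right
    rw [key, ← h']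
    congr 2 <;> simp [levelζ]

theorem floor_half_sub_le {y : ℝ} (hy : 0 ≤ y) :
    |((⌊y⌋₊ / 2 : ℕ) : ℝ) - y / 2| ≤ 1 ∧ |(((⌊y⌋₊ + 1) / 2 : ℕ) : ℝ) - y / 2| ≤ 1 ∧
      (⌊y⌋₊ / 2 = (⌊y⌋₊ + 1) / 2 ∨ (⌊y⌋₊ + 1) / 2 = ⌊y⌋₊ / 2 + 1) := by
  have h1 := Nat.floor_le hy
  have h2 := Nat.lt_floor_add_one y
  obtain ⟨n, hn⟩ : ∃ n, n = ⌊y⌋₊ := ⟨_, rfl⟩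
  rw [← hn] at h1 h2 ⊢
  rcases Nat.even_or_odd' n with ⟨k, rfl | rfl⟩
  · rw [show 2 * k / 2 = k by omega, show (2 * k + 1) / 2 = k by omega]
    push_cast at h1 h2
    refine ⟨?_, ?_, Or.inl rfl⟩ <;> rw [abs_le] <;> constructor <;> linarith
  · rw [show (2 * k + 1) / 2 = k by omega, show (2 * k + 1 + 1) / 2 = k + 1 by omega]
    push_cast at h1 h2 ⊢
    refine ⟨?_, ?_, Or.inr rfl⟩ <;> rw [abs_le] <;> constructor <;> linarith

/-! ### Exponential decay along the level curve -/

/-- The weight at time `τ L` in the position `ξ L` on the level `μ L`. -/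
noncomputable def scaledWeight (ε τ ξ μ L : ℝ) : ℂ → ℂ :=
  weight ε (τ * L) (⌊μ * L⌋₊ / 2) ((⌊μ * L⌋₊ + 1) / 2) ⌊ξ * L⌋

/-- The quotient of the Cauchy integral of the weight by the weight, without the part produced by the
pole between the circles of radius `exp σ` and `R`. -/
noncomputable def reducedCauchy (ε τ ξ μ σ R L : ℝ) (z : ℂ) : ℂ :=
  cauchyInt (scaledWeight ε τ ξ μ L) R z / scaledWeight ε τ ξ μ L z -
    if Real.exp σ < ‖z‖ then 2 * Real.pi * Complex.I else 0

/-- On the level curve through the saddle point the reduced integrand decays exponentially, except at the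
saddle point, where it has an integrable singularity. -/
theorem IsSaddle.exists_norm_reducedCauchy_le {ε τ ξ μ σ θ ρ : ℝ} (h : IsSaddle ε τ ξ μ σ θ ρ)
    (hε : 0 < ε) (hμ : 0 ≤ μ) {R : ℝ} (hR : Real.exp (levelσ (ε + ε⁻¹) ρ Real.pi) < R) :
    ∃ M > 0, ∀ L : ℝ, 0 ≤ L → ∀ ψ ∈ Set.Icc 0 Real.pi, ∀ s : ℝ, s = 1 ∨ s = -1 →
      s * levelσ (ε + ε⁻¹) ρ ψ ≠ σ → ∀ z : ℂ,
      z = Complex.exp (levelζ (ε + ε⁻¹) ρ s ψ) ∨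
        z = Complex.exp ((starRingEnd ℂ) (levelζ (ε + ε⁻¹) ρ s ψ)) →
      ‖reducedCauchy ε τ ξ μ σ R L z‖ ≤
        M * |Real.exp (s * levelσ (ε + ε⁻¹) ρ ψ) - Real.exp σ| ^ (-(1 / 8) : ℝ) *
        Real.exp (-(L * (τ * (2 * ellC (levelU (ε + ε⁻¹) ρ ψ) * ellc (levelU (ε + ε⁻¹) ρ ψ) -
          2 * Real.cosh σ * Real.cos θ) + ξ * (s * levelσ (ε + ε⁻¹) ρ ψ - σ)))) := by
  have ha := two_le_add_inv hε
  have hρ := h.radius_pos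
  set a := ε + ε⁻¹ with hadef
  set zc := Complex.exp (σ + θ * Complex.I) with hzc
  have hzcn : ‖zc‖ = Real.exp σ := by rw [hzc, Complex.norm_exp]; simp
  have hzcre := re_add_one_div hzc
  have hlev : ‖(a : ℂ) - (zc + 1 / zc)‖ = ρ := by
    obtain ⟨hu1, hu2⟩ : (zc + 1 / zc).re = 2 * Real.cosh σ * Real.cos θ ∧
        (zc + 1 / zc).im = 2 * Real.sinh σ * Real.sin θ := by
      rw [hzc, one_div, ← Complex.exp_neg, exp_add_exp_neg]
      constructor <;> simp [-Complex.ofReal_mul, -Complex.ofReal_cosh, -Complex.ofReal_sinh,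
        -Complex.ofReal_cos, -Complex.ofReal_sin]
    apply (sq_eq_sq₀ (norm_nonneg _) hρ.le).1
    rw [h.radius_sq, ← Complex.normSq_eq_norm_sq, Complex.normSq_apply, Complex.sub_re,
      Complex.sub_im, Complex.ofReal_re, Complex.ofReal_im, hu1, hu2]
    linear_combination 4 * Real.sin θ ^ 2 * Real.sinh_sq σ +
      4 * (Real.cosh σ ^ 2 - 1) * Real.sin_sq_add_cos_sq θ
  obtain ⟨M₁, hM₁, h₁⟩ := exists_norm_weight_le hε hρ h.radius_sq h.slope
  obtain ⟨M₂, hM₂, h₂⟩ := exists_norm_weight_ratio_le (τ := τ) (ξ := ξ)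
    (b := levelσ a ρ Real.pi) hε hρ hzcn hlev
  obtain ⟨M₃, hM₃, h₃⟩ := exists_norm_cauchyInt_le (Real.exp_pos σ)
  refine ⟨M₃ * M₁ * M₂, by positivity, fun L hL ψ hψ s hs hsσ z hz => ?_⟩
  obtain ⟨hk, hl, hkl⟩ := floor_half_sub_le (mul_nonneg hμ hL)
  have hx : |((⌊ξ * L⌋ : ℤ) : ℝ) - ξ * L| ≤ 1 := by
    rw [abs_le]
    constructor <;> linarith [Int.floor_le (ξ * L), Int.lt_floor_add_one (ξ * L)]
  have hzn : ‖z‖ = Real.exp (s * levelσ a ρ ψ) := by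
    rcases hz with rfl | rfl <;> rw [Complex.norm_exp]
    · rw [levelζ_re]
    · rw [Complex.conj_re, levelζ_re]
  have hz0 : z ≠ 0 := by rcases hz with rfl | rfl <;> exact Complex.exp_ne_zero _
  have hb : |s * levelσ a ρ ψ| ≤ levelσ a ρ Real.pi := by
    have h1 := levelσ_le_levelσ_pi ha hρ ψ
    have h2 := levelσ_nonneg a ρ ψ
    rw [abs_mul, abs_of_nonneg h2]
    rcases hs with rfl | rfl <;> simpa using h1
  obtain ⟨hzre, hzlev⟩ : (z + 1 / z).re = 2 * ellC (levelU a ρ ψ) * ellc (levelU a ρ ψ) ∧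
      ‖(a : ℂ) - (z + 1 / z)‖ = ρ := by
    rw [two_mul_ellC_mul_ellc]
    have hn : ‖(a : ℂ) - levelU a ρ ψ‖ = ρ := by
      rw [levelU, sub_sub_cancel, norm_mul, Complex.norm_exp_ofReal_mul_I, mul_one,
        Complex.norm_real, Real.norm_of_nonneg hρ.le]
    rcases exp_levelζ_add_one_div hρ hψ hs hz with e | e <;> rw [e]
    · exact ⟨rfl, hn⟩
    · refine ⟨Complex.conj_re _, ?_⟩
      rw [← Complex.conj_ofReal a, ← map_sub, Complex.norm_conj, hn]
  set g := scaledWeight ε τ ξ μ L with hg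
  have hgd : DifferentiableOn ℂ g {0}ᶜ := differentiableOn_weight _ _ _ _ _
  have hne : ‖z‖ ≠ Real.exp σ := by rw [hzn]; exact fun h => hsσ (Real.exp_injective h)
  have hzR : ‖z‖ < R := by rw [hzn]; exact (exp_mul_levelσ_le ha hρ hs ψ).trans_lt hR
  have hgz := h₂ L hL _ _ hkl ⌊ξ * L⌋ hx z _ hzn hb hzlev
  rw [hzre, hzcre] at hgz
  change ‖g zc‖ ≤ M₂ * ‖g z‖ * _ at hgz
  have hgz0 : g z ≠ 0 := by
    have hne' : ∀ {e : ℝ}, 0 < e → e + e⁻¹ = a → z ≠ (e : ℂ) := by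
      intro e he hea hze
      have hec : (e : ℂ) ≠ 0 := by exact_mod_cast he.ne'
      have : (a : ℂ) - (z + 1 / z) = 0 := by rw [hze, ← hea]; push_cast; field_simp; ring
      rw [this, norm_zero] at hzlev
      exact hρ.ne hzlev
    exact weight_ne_zero hε _ _ _ _ hz0 (hne' hε rfl)
      (hne' (inv_pos.2 hε) (by rw [inv_inv, hadef]; ring))
  have hred : reducedCauchy ε τ ξ μ σ R L z = cauchyInt g (Real.exp σ) z / g z := by
    unfold reducedCauchy
    rw [← hg]
    rcases lt_or_gt_of_ne hne with hlt | hgt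
    · rw [if_neg (not_lt.2 hlt.le), sub_zero]
      rcases le_total (Real.exp σ) R with hσR | hσR
      · rw [cauchyInt_eq_of_norm_lt hgd hσR hlt]
      · rw [cauchyInt_eq_of_norm_lt hgd hσR hzR]
    · rw [if_pos hgt, cauchyInt_eq_add_of_lt_norm hgd (Real.exp_pos σ) hgt hzR, add_div,
        mul_div_cancel_right₀ _ hgz0, add_sub_cancel_right]
  have hcb := h₃ g (M₁ * ‖g zc‖) (by positivity) (fun w hw => h₁ L hL _ _ hk hl _ w hw) z hz0 hne
  rw [hred, norm_div, div_le_iff₀ (norm_pos_iff.2 hgz0), hzn.symm]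
  refine hcb.trans ?_
  calc M₃ * (M₁ * ‖g zc‖) * |‖z‖ - Real.exp σ| ^ (-(1 / 8) : ℝ) ≤
      M₃ * (M₁ * (M₂ * ‖g z‖ * _)) * |‖z‖ - Real.exp σ| ^ (-(1 / 8) : ℝ) := by gcongr
    _ = _ := by ring

/-- The distance between the level curve and the circle through the saddle point. -/
theorem exists_abs_exp_sub_exp_ge {a ρ σ : ℝ} (ha : 2 ≤ a) (hρ : 0 < ρ) {ψc : ℝ}
    (hψc : ψc ∈ Set.Icc 0 Real.pi) (hC : ellC (levelU a ρ ψc) = Real.cosh σ)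
    (hσ : levelσ a ρ ψc = |σ|) :
    ∃ κ > 0, ∀ ψ ∈ Set.Icc 0 Real.pi, ∀ s : ℝ, s = 1 ∨ s = -1 →
      κ * |ψ - ψc| ^ 2 ≤ |Real.exp (s * levelσ a ρ ψ) - Real.exp σ| := by
  obtain ⟨κ, hκ, h⟩ := exists_abs_ellC_sub_ge ha hρ
  set b := levelσ a ρ Real.pi
  refine ⟨κ / ((1 + Real.exp (2 * b)) / 2), by positivity, fun ψ hψ s hs => ?_⟩
  have hb : |s * levelσ a ρ ψ| = levelσ a ρ ψ := by
    rw [abs_mul, abs_of_nonneg (levelσ_nonneg a ρ ψ)]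
    rcases hs with rfl | rfl <;> simp
  have h1 := abs_cosh_sub_cosh_le (b := b) (hb.le.trans (levelσ_le_levelσ_pi ha hρ ψ))
    (hσ.ge.trans (levelσ_le_levelσ_pi ha hρ ψc))
  have h2 := h ψ hψ ψc hψc
  rw [← Real.cosh_abs, hb, cosh_levelσ, ← hC] at h1
  rw [div_mul_eq_mul_div, div_le_iff₀ (by positivity)]
  linarith

theorem measurable_reducedCauchy_exp {ε τ ξ μ σ R L : ℝ} {η : ℝ → ℂ} (hη : Continuous η)
    (hR : ∀ ψ, Real.exp (η ψ).re < R) :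
    Measurable fun ψ => reducedCauchy ε τ ξ μ σ R L (Complex.exp (η ψ)) := by
  have hgd : DifferentiableOn ℂ (scaledWeight ε τ ξ μ L) {0}ᶜ := differentiableOn_weight _ _ _ _ _
  have hR0 : 0 < R := (Real.exp_pos _).trans (hR 0)
  have he : Continuous fun ψ => Complex.exp (η ψ) := by fun_prop
  have h1 : Continuous fun ψ => cauchyInt (scaledWeight ε τ ξ μ L) R (Complex.exp (η ψ)) :=
    (differentiableOn_cauchyInt hgd hR0).continuousOn.comp_continuous he fun ψ => by
      simpa [Complex.norm_exp] using hR ψ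
  have h2 : Continuous fun ψ => scaledWeight ε τ ξ μ L (Complex.exp (η ψ)) :=
    hgd.continuousOn.comp_continuous he fun ψ => Complex.exp_ne_zero _
  refine (h1.measurable.div h2.measurable).sub (Measurable.ite ?_ measurable_const measurable_const)
  exact measurableSet_lt measurable_const (by fun_prop)

/-- The reduced integral along the inner or the outer half of the level curve, or along its complex
conjugate, tends to zero. -/
theorem IsSaddle.tendsto_integral_reducedCauchy {ε τ ξ μ σ θ ρ : ℝ} (h : IsSaddle ε τ ξ μ σ θ ρ)
    (hε : 0 < ε) (hτ : 0 < τ) (hμ : 0 ≤ μ) {R : ℝ}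
    (hR : Real.exp (levelσ (ε + ε⁻¹) ρ Real.pi) < R) {s : ℝ} (hs : s = 1 ∨ s = -1) {η D : ℝ → ℂ}
    (hη : η = levelζ (ε + ε⁻¹) ρ s ∨ η = fun ψ => (starRingEnd ℂ) (levelζ (ε + ε⁻¹) ρ s ψ))
    (hD : Measurable D) (hDn : ∀ ψ, ‖D ψ‖ = ‖levelDeriv (ε + ε⁻¹) ρ ψ‖) :
    (∀ L : ℝ, 0 ≤ L → IntervalIntegrable
      (fun ψ => reducedCauchy ε τ ξ μ σ R L (Complex.exp (η ψ)) * D ψ)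
        MeasureTheory.volume 0 Real.pi) ∧
    Tendsto (fun L : ℝ => ∫ ψ in (0 : ℝ)..Real.pi,
      reducedCauchy ε τ ξ μ σ R L (Complex.exp (η ψ)) * D ψ) atTop (𝓝 0) := by
  have ha := two_le_add_inv hε
  have hρ := h.radius_pos
  obtain ⟨M, hM, hbd⟩ := h.exists_norm_reducedCauchy_le hε hμ hR
  set a := ε + ε⁻¹ with hadef
  obtain ⟨ψc, hψc, hCc, hσc, -⟩ := exists_level_param hρ h.angle_mem h.radius_sq
  obtain ⟨κ, hκ, hdist⟩ := exists_abs_exp_sub_exp_ge ha hρ hψc hCc hσc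
  obtain ⟨M', hM', hder⟩ := exists_norm_levelDeriv_le ha hρ
  have hηc : Continuous η := by
    have := continuous_levelζ a ρ s
    rcases hη with rfl | rfl
    · exact this
    · exact Complex.continuous_conj.comp this
  have hηre : ∀ ψ, (η ψ).re = s * levelσ a ρ ψ := by
    intro ψ
    rcases hη with rfl | rfl
    · exact levelζ_re a ρ s ψ
    · simp only [Complex.conj_re]; exact levelζ_re a ρ s ψ
  have hmeas : ∀ L, Measurable fun ψ =>
      reducedCauchy ε τ ξ μ σ R L (Complex.exp (η ψ)) * D ψ := fun L =>
    (measurable_reducedCauchy_exp hηc fun ψ => by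
      rw [hηre]; exact (exp_mul_levelσ_le ha hρ hs ψ).trans_lt hR).mul hD
  set δ : ℝ → ℝ := fun ψ => τ * (2 * ellC (levelU a ρ ψ) * ellc (levelU a ρ ψ) -
          2 * Real.cosh σ * Real.cos θ) + ξ * (s * levelσ a ρ ψ - σ) with hδ
  have hne : ∀ ψ ∈ Set.Icc 0 Real.pi, ψ ≠ ψc → s * levelσ a ρ ψ ≠ σ := by
    intro ψ hψ hψne he
    have h1 := hdist ψ hψ s hs
    rw [he, sub_self, abs_zero] at h1
    have : 0 < |ψ - ψc| := abs_pos.2 (sub_ne_zero.2 hψne)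
    have : 0 < κ * |ψ - ψc| ^ 2 := by positivity
    linarith
  have hδpos : ∀ ψ ∈ Set.Icc 0 Real.pi, ψ ≠ ψc → 0 < δ ψ := by
    intro ψ hψ hψne
    refine level_action_pos (ρ := ρ) ha hτ rfl (σ₁ := s * levelσ a ρ ψ) ?_ (Real.abs_cos_le_one θ)
      (abs_ellc_le_one _) h.den_pos h.speed h.radius_sq ?_ (hne ψ hψ hψne)
    · rw [← cosh_levelσ]
      rcases hs with rfl | rfl
      · rw [one_mul]
      · rw [neg_one_mul, Real.cosh_neg]
    · have h1 := two_mul_ellC_mul_ellc (levelU a ρ ψ)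
      have h2 := ellC_sq_sub_one_mul (levelU a ρ ψ)
      rw [levelU_re] at h1
      rw [levelU_im] at h2
      have e1 : ρ * Real.cos ψ = a - 2 * ellC (levelU a ρ ψ) * ellc (levelU a ρ ψ) := by linarith
      linear_combination (-ρ ^ 2) * Real.sin_sq_add_cos_sq ψ - h2 +
        (ρ * Real.cos ψ + (a - 2 * ellC (levelU a ρ ψ) * ellc (levelU a ρ ψ))) * e1
  have hpt : ∀ L : ℝ, 0 ≤ L → ∀ ψ ∈ Set.Ioc 0 Real.pi, ψ ≠ ψc →
      ‖reducedCauchy ε τ ξ μ σ R L (Complex.exp (η ψ)) * D ψ‖ ≤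
        M * |Real.exp (s * levelσ a ρ ψ) - Real.exp σ| ^ (-(1 / 8) : ℝ) * ‖D ψ‖ *
          Real.exp (-(L * δ ψ)) := by
    intro L hL ψ hψ hψne
    have hψ' : ψ ∈ Set.Icc 0 Real.pi := Set.Ioc_subset_Icc_self hψ
    have := hbd L hL ψ hψ' s hs (hne ψ hψ' hψne) (Complex.exp (η ψ)) (by
      rcases hη with rfl | rfl
      · exact Or.inl rfl
      · exact Or.inr rfl)
    rw [norm_mul]
    refine (mul_le_mul_of_nonneg_right this (norm_nonneg _)).trans (le_of_eq ?_)
    simp only [hδ]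
    ring
  -- The curve has a square root singularity at `ψ = 0`, and the distance to the circle is at least
  -- quadratic in `ψ - ψc`, so its power `-1/8` is at most `|ψ - ψc| ^ (-1/4)`.
  set bound : ℝ → ℝ := fun ψ => M * κ ^ (-(1 / 8) : ℝ) * M' *
    (ψ ^ (-(3 / 4) : ℝ) + |ψ - ψc| ^ (-(3 / 4) : ℝ)) with hbound
  have hbint : IntervalIntegrable bound MeasureTheory.volume 0 Real.pi :=
    ((intervalIntegral.intervalIntegrable_rpow' (by norm_num)).add
      (intervalIntegrable_abs_sub_rpow hψc (by norm_num))).const_mul _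
  have hdom : ∀ L : ℝ, 0 ≤ L → ∀ ψ ∈ Set.Ioc 0 Real.pi, ψ ≠ ψc →
      ‖reducedCauchy ε τ ξ μ σ R L (Complex.exp (η ψ)) * D ψ‖ ≤ bound ψ := by
    intro L hL ψ hψ hψne
    refine (hpt L hL ψ hψ hψne).trans ?_
    have hψ' : ψ ∈ Set.Icc 0 Real.pi := Set.Ioc_subset_Icc_self hψ
    have h0 : 0 < |ψ - ψc| := abs_pos.2 (sub_ne_zero.2 hψne)
    have h1 : Real.exp (-(L * δ ψ)) ≤ 1 := by
      rw [Real.exp_le_one_iff]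
      have := mul_nonneg hL (hδpos ψ hψ' hψne).le
      linarith
    have h2 : |Real.exp (s * levelσ a ρ ψ) - Real.exp σ| ^ (-(1 / 8) : ℝ) ≤
        κ ^ (-(1 / 8) : ℝ) * |ψ - ψc| ^ (-(1 / 4) : ℝ) := by
      have e : κ ^ (-(1 / 8) : ℝ) * |ψ - ψc| ^ (-(1 / 4) : ℝ) =
          (κ * |ψ - ψc| ^ 2) ^ (-(1 / 8) : ℝ) := by
        rw [Real.mul_rpow hκ.le (by positivity), ← Real.rpow_natCast, ← Real.rpow_mul h0.le]
        norm_num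
      rw [e]
      exact Real.rpow_le_rpow_of_nonpos (by positivity) (hdist ψ hψ' s hs) (by norm_num)
    have h3 := hder ψ hψ
    have h4 := rpow_mul_rpow_le hψ.1 h0
    have hψ0 := hψ.1
    rw [hDn]
    calc M * |Real.exp (s * levelσ a ρ ψ) - Real.exp σ| ^ (-(1 / 8) : ℝ) * ‖levelDeriv a ρ ψ‖ *
          Real.exp (-(L * δ ψ)) ≤
          M * (κ ^ (-(1 / 8) : ℝ) * |ψ - ψc| ^ (-(1 / 4) : ℝ)) * (M' * ψ ^ (-(1 / 2) : ℝ)) * 1 := by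
          gcongr
      _ = M * κ ^ (-(1 / 8) : ℝ) * M' * (ψ ^ (-(1 / 2) : ℝ) * |ψ - ψc| ^ (-(1 / 4) : ℝ)) := by ring
      _ ≤ _ := by simp only [hbound]; gcongr
  have hae : ∀ᵐ ψ : ℝ, ψ ≠ ψc := MeasureTheory.volume.ae_ne ψc
  have hpi := Real.pi_pos.le
  constructor
  · intro L hL
    refine hbint.mono_fun' (hmeas L).aestronglyMeasurable ?_
    rw [Set.uIoc_of_le hpi]
    filter_upwards [MeasureTheory.ae_restrict_mem measurableSet_Ioc,
      MeasureTheory.ae_restrict_of_ae hae] with ψ hψ hψne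
    exact hdom L hL ψ hψ hψne
  · have h0 : (0 : ℂ) = ∫ ψ in (0 : ℝ)..Real.pi, (0 : ℂ) := by simp
    rw [h0]
    apply intervalIntegral.tendsto_integral_filter_of_dominated_convergence bound
    · exact Eventually.of_forall fun L => (hmeas L).aestronglyMeasurable
    · filter_upwards [eventually_ge_atTop (0 : ℝ)] with L hL
      filter_upwards [hae] with ψ hψne hψ
      rw [Set.uIoc_of_le hpi] at hψ
      exact hdom L hL ψ hψ hψne
    · exact hbint
    · filter_upwards [hae] with ψ hψne hψ
      rw [Set.uIoc_of_le hpi] at hψ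
      refine squeeze_zero_norm' ?_ ?_ (a := fun L =>
        M * |Real.exp (s * levelσ a ρ ψ) - Real.exp σ| ^ (-(1 / 8) : ℝ) * ‖D ψ‖ *
          Real.exp (-(L * δ ψ)))
      · filter_upwards [eventually_ge_atTop (0 : ℝ)] with L hL
        exact hpt L hL ψ hψ hψne
      · rw [show (0 : ℝ) = M * |Real.exp (s * levelσ a ρ ψ) - Real.exp σ| ^ (-(1 / 8) : ℝ) *
          ‖D ψ‖ * 0 by ring]
        refine Tendsto.const_mul _ (Real.tendsto_exp_neg_atTop_nhds_zero.comp ?_)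
        exact tendsto_id.atTop_mul_const (hδpos ψ (Set.Ioc_subset_Icc_self hψ) hψne)

/-! ### The limit of the density at a saddle point -/

/-- The pole contributes on the part of the level curve outside the circle through the saddle point.
Beyond the saddle point this is the outer half only; before it, both halves or none. -/
theorem integral_indicator_levelDeriv {a ρ σ ψc : ℝ} (ha : 2 ≤ a) (hρ : 0 < ρ)
    (hψc : ψc ∈ Set.Icc 0 Real.pi) (hσ : levelσ a ρ ψc = |σ|) :
    (∫ ψ in (0 : ℝ)..Real.pi, ((if σ < levelσ a ρ ψ then 1 else 0) -
      (if σ < -levelσ a ρ ψ then 1 else 0)) * (levelDeriv a ρ ψ).im) = -levelθ a ρ ψc := by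
  have hmono : ∀ ψ ∈ Set.Icc 0 Real.pi, ∀ ψ' ∈ Set.Icc 0 Real.pi, ψ < ψ' →
      levelσ a ρ ψ < levelσ a ρ ψ' := by
    intro ψ hψ ψ' hψ' hlt
    obtain ⟨κ, hκ, hsep⟩ := exists_abs_ellC_sub_ge ha hρ
    have h1 := norm_levelU_le ha hρ (Real.cos_le_cos_of_nonneg_of_le_pi hψ.1 hψ'.2 hlt.le)
    have h2 := hsep ψ hψ ψ' hψ'
    have h3 : 0 < |ψ - ψ'| := abs_pos.2 (sub_ne_zero.2 hlt.ne)
    have h4 : 0 < κ * |ψ - ψ'| ^ 2 := by positivity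
    have h5 : ellC (levelU a ρ ψ) ≤ ellC (levelU a ρ ψ') := by unfold ellC; linarith
    rw [abs_of_nonpos (sub_nonpos.2 h5)] at h2
    exact (Real.arcosh_lt_arcosh (by linarith [one_le_ellC (levelU a ρ ψ)])
      (by linarith [one_le_ellC (levelU a ρ ψ')])).2 (by linarith)
  have hint : ∀ p ∈ Set.Icc 0 Real.pi, ∀ q ∈ Set.Icc 0 Real.pi,
      IntervalIntegrable (fun ψ => (levelDeriv a ρ ψ).im) MeasureTheory.volume p q := by
    intro p hp q hq
    have h : IntervalIntegrable (fun ψ => (levelDeriv a ρ ψ).im) MeasureTheory.volume 0 Real.pi :=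
      (intervalIntegrable_levelDeriv ha hρ).mono_fun
        (Complex.measurable_im.comp (measurable_levelDeriv a ρ)).aestronglyMeasurable
        (Eventually.of_forall fun ψ => Complex.abs_im_le_norm _)
    refine h.mono_set ?_
    rw [Set.uIcc_of_le Real.pi_pos.le]
    exact Set.uIcc_subset_Icc hp hq
  have h0mem : (0 : ℝ) ∈ Set.Icc 0 Real.pi := ⟨le_rfl, Real.pi_pos.le⟩
  have hpimem : Real.pi ∈ Set.Icc 0 Real.pi := ⟨Real.pi_pos.le, le_rfl⟩
  set f : ℝ → ℝ := fun ψ => ((if σ < levelσ a ρ ψ then 1 else 0) -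
      (if σ < -levelσ a ρ ψ then 1 else 0)) * (levelDeriv a ρ ψ).im with hf
  have h1 : Set.EqOn f (fun _ => 0) (Set.Ioo 0 ψc) := by
    intro ψ hψ
    have hlt := hmono ψ ⟨hψ.1.le, hψ.2.le.trans hψc.2⟩ ψc hψc hψ.2
    rw [hσ] at hlt
    have hn := levelσ_nonneg a ρ ψ
    simp only [hf]
    rcases le_total 0 σ with h | h
    · rw [abs_of_nonneg h] at hlt
      rw [if_neg (by linarith), if_neg (by linarith)]
      simp
    · rw [abs_of_nonpos h] at hlt
      rw [if_pos (by linarith), if_pos (by linarith)]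
      simp
  have h2 : Set.EqOn f (fun ψ => (levelDeriv a ρ ψ).im) (Set.Ioo ψc Real.pi) := by
    intro ψ hψ
    have hlt := hmono ψc hψc ψ ⟨hψc.1.trans hψ.1.le, hψ.2.le⟩ hψ.1
    rw [hσ] at hlt
    obtain ⟨h3, h4⟩ := abs_lt.1 hlt
    simp only [hf]
    rw [if_pos (by linarith), if_neg (by linarith)]
    simp
  have i1 : IntervalIntegrable f MeasureTheory.volume 0 ψc := by
    refine (intervalIntegrable_const (c := (0 : ℝ))).congr_uIoo ?_
    rw [Set.uIoo_of_le hψc.1]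
    exact h1.symm
  have i2 : IntervalIntegrable f MeasureTheory.volume ψc Real.pi := by
    refine (hint ψc hψc Real.pi hpimem).congr_uIoo ?_
    rw [Set.uIoo_of_le hψc.2]
    exact h2.symm
  have e1 : (∫ ψ in (0 : ℝ)..ψc, f ψ) = 0 := by
    rw [intervalIntegral.integral_congr_uIoo (g := fun _ => 0) (by rwa [Set.uIoo_of_le hψc.1])]
    simp
  have e2 : (∫ ψ in ψc..Real.pi, f ψ) = levelθ a ρ Real.pi - levelθ a ρ ψc := by
    rw [intervalIntegral.integral_congr_uIoo (g := fun ψ => (levelDeriv a ρ ψ).im)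
      (by rwa [Set.uIoo_of_le hψc.2])]
    exact intervalIntegral.integral_eq_sub_of_hasDerivAt_of_le hψc.2
      (continuous_levelθ a ρ).continuousOn
      (fun ψ hψ => (hasDerivAt_level hρ ⟨hψc.1.trans_lt hψ.1, hψ.2⟩).2)
      (hint ψc hψc Real.pi hpimem)
  have hθpi : levelθ a ρ Real.pi = 0 := by
    rw [levelθ, levelU_pi, ellc_ofReal (by linarith), Real.arccos_one]
  rw [← intervalIntegral.integral_add_adjacent_intervals i1 i2, e1, e2, hθpi]
  ring

/-- The density at a saddle point is its angle divided by `π`. -/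
theorem IsSaddle.tendsto_corrKernel {ε τ ξ μ σ θ ρ : ℝ} (h : IsSaddle ε τ ξ μ σ θ ρ)
    (hε : 0 < ε) (hτ : 0 < τ) (hμ : 0 ≤ μ) :
    Tendsto (fun L : ℝ => corrKernel ε (τ * L) ⌊ξ * L⌋ ⌊μ * L⌋₊ ⌊ξ * L⌋ ⌊μ * L⌋₊) atTop
      (𝓝 ((1 / Real.pi * θ : ℝ) : ℂ)) := by
  have ha := two_le_add_inv hε
  have hρ := h.radius_pos
  obtain ⟨ψc, hψc, hCc, hσc, hθc⟩ := exists_level_param hρ h.angle_mem h.radius_sq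
  set R := max ((ε + ε⁻¹) / 2 + max ε ε⁻¹ / 2)
    (Real.exp (levelσ (ε + ε⁻¹) ρ Real.pi)) + 1 with hRdef
  have hR1 : (ε + ε⁻¹) / 2 + max ε ε⁻¹ / 2 < R :=
    (le_max_left _ (Real.exp (levelσ (ε + ε⁻¹) ρ Real.pi))).trans_lt (lt_add_one _)
  have hR2 : Real.exp (levelσ (ε + ε⁻¹) ρ Real.pi) < R :=
    (le_max_right ((ε + ε⁻¹) / 2 + max ε ε⁻¹ / 2) _).trans_lt (lt_add_one _)
  have hpiece := fun (s : ℝ) (hs : s = 1 ∨ s = -1) =>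
    And.intro
      (h.tendsto_integral_reducedCauchy hε hτ hμ hR2 hs (Or.inr rfl)
        (D := fun ψ => (starRingEnd ℂ) (levelζDeriv (ε + ε⁻¹) ρ s ψ))
        (Complex.continuous_conj.measurable.comp (measurable_levelζDeriv _ _ _)) (fun ψ => by
          rw [Complex.norm_conj, norm_levelζDeriv]
          rcases hs with rfl | rfl <;> norm_num))
      (h.tendsto_integral_reducedCauchy hε hτ hμ hR2 hs (Or.inl rfl)
        (D := levelζDeriv (ε + ε⁻¹) ρ s) (measurable_levelζDeriv _ _ _) (fun ψ => by
          rw [norm_levelζDeriv]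
          rcases hs with rfl | rfl <;> norm_num))
  set a := ε + ε⁻¹ with hadef
  obtain ⟨A, hA⟩ : ∃ A : ℝ → ℝ → ℂ, A = fun s L =>
    (∫ ψ in (0 : ℝ)..Real.pi, reducedCauchy ε τ ξ μ σ R L
      (Complex.exp ((starRingEnd ℂ) (levelζ a ρ s ψ))) * (starRingEnd ℂ) (levelζDeriv a ρ s ψ)) -
    ∫ ψ in (0 : ℝ)..Real.pi, reducedCauchy ε τ ξ μ σ R L
      (Complex.exp (levelζ a ρ s ψ)) * levelζDeriv a ρ s ψ := ⟨_, rfl⟩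
  have hA0 : ∀ s, s = 1 ∨ s = -1 → Tendsto (A s) atTop (𝓝 0) := by
    intro s hs
    have := (hpiece s hs).1.2.sub (hpiece s hs).2.2
    rw [sub_zero] at this
    rw [hA]
    exact this
  have him : ∀ s, IntervalIntegrable
      (fun ψ => (if σ < s * levelσ a ρ ψ then (1 : ℝ) else 0) * (levelDeriv a ρ ψ).im)
      MeasureTheory.volume 0 Real.pi := by
    intro s
    refine (intervalIntegrable_levelDeriv ha hρ).mono_fun ?_ ?_
    · refine Measurable.aestronglyMeasurable (Measurable.mul (Measurable.ite ?_ measurable_const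
        measurable_const) (Complex.measurable_im.comp (measurable_levelDeriv a ρ)))
      exact measurableSet_lt measurable_const ((continuous_levelσ a ρ).measurable.const_mul s)
    · refine Eventually.of_forall fun ψ => ?_
      simp only
      split_ifs
      · rw [one_mul]
        exact Complex.abs_im_le_norm _
      · simp
  have hI : ∀ s, s = 1 ∨ s = -1 → ∀ L : ℝ, 0 ≤ L →
      (∫ ψ in (0 : ℝ)..Real.pi,
        (cauchyInt (scaledWeight ε τ ξ μ L) R (Complex.exp ((starRingEnd ℂ) (levelζ a ρ s ψ))) /
          scaledWeight ε τ ξ μ L (Complex.exp ((starRingEnd ℂ) (levelζ a ρ s ψ))) *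
          (starRingEnd ℂ) (levelζDeriv a ρ s ψ) -
        cauchyInt (scaledWeight ε τ ξ μ L) R (Complex.exp (levelζ a ρ s ψ)) /
          scaledWeight ε τ ξ μ L (Complex.exp (levelζ a ρ s ψ)) * levelζDeriv a ρ s ψ)) =
      A s L + 4 * Real.pi * ((∫ ψ in (0 : ℝ)..Real.pi,
        (if σ < s * levelσ a ρ ψ then (1 : ℝ) else 0) * (levelDeriv a ρ ψ).im : ℝ) : ℂ) := by
    intro s hs L hL
    have i1 := (hpiece s hs).1.1 L hL
    have i2 := (hpiece s hs).2.1 L hL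
    have i3 : IntervalIntegrable (fun ψ => (4 * Real.pi : ℂ) *
        (((if σ < s * levelσ a ρ ψ then (1 : ℝ) else 0) * (levelDeriv a ρ ψ).im : ℝ) : ℂ))
        MeasureTheory.volume 0 Real.pi := IntervalIntegrable.const_mul (A := ℂ)
      ⟨(him s).1.ofReal (𝕜 := ℂ), (him s).2.ofReal (𝕜 := ℂ)⟩ (4 * Real.pi : ℂ)
    rw [hA, ← intervalIntegral.integral_ofReal, ← intervalIntegral.integral_const_mul]
    simp only
    rw [← intervalIntegral.integral_sub i1 i2, ← intervalIntegral.integral_add (i1.sub i2) i3]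
    apply intervalIntegral.integral_congr
    intro ψ _
    -- The two complex conjugate halves together give the pole the factor `2πi · (-2i) = 4π`.
    have hc : (starRingEnd ℂ) (levelζDeriv a ρ s ψ) - levelζDeriv a ρ s ψ =
        -2 * (levelDeriv a ρ ψ).im * Complex.I := by
      unfold levelζDeriv
      apply Complex.ext <;> simp
      ring
    have hn1 : ‖Complex.exp (levelζ a ρ s ψ)‖ = Real.exp (s * levelσ a ρ ψ) := by
      rw [Complex.norm_exp, levelζ_re]
    have hn2 : ‖Complex.exp ((starRingEnd ℂ) (levelζ a ρ s ψ))‖ = Real.exp (s * levelσ a ρ ψ) := by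
      rw [Complex.norm_exp, Complex.conj_re, levelζ_re]
    simp only [reducedCauchy, hn1, hn2, Real.exp_lt_exp]
    by_cases hlt : σ < s * levelσ a ρ ψ
    · simp only [if_pos hlt]
      push_cast
      linear_combination (2 * Real.pi * Complex.I) * hc +
        (-4 * Real.pi * (levelDeriv a ρ ψ).im) * Complex.I_sq
    · simp only [if_neg hlt]
      push_cast
      ring
  have hdiff : (∫ ψ in (0 : ℝ)..Real.pi,
      (if σ < 1 * levelσ a ρ ψ then (1 : ℝ) else 0) * (levelDeriv a ρ ψ).im) -
      (∫ ψ in (0 : ℝ)..Real.pi,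
      (if σ < -1 * levelσ a ρ ψ then (1 : ℝ) else 0) * (levelDeriv a ρ ψ).im) = -θ := by
    rw [← intervalIntegral.integral_sub (him 1) (him (-1)), ← hθc,
      ← integral_indicator_levelDeriv ha hρ hψc hσc]
    simp only [one_mul, neg_one_mul, sub_mul]
  have hK : ∀ L : ℝ, 0 ≤ L →
      corrKernel ε (τ * L) ⌊ξ * L⌋ ⌊μ * L⌋₊ ⌊ξ * L⌋ ⌊μ * L⌋₊ =
        (A 1 L - A (-1) L - 4 * Real.pi * θ) / (2 * Real.pi * Complex.I) ^ 2 := by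
    intro L hL
    have hkey := corrKernel_diag_eq_level hε hρ (τ * L) ⌊ξ * L⌋ ⌊μ * L⌋₊ hR1 hR2 rfl rfl
    rw [eq_div_iff (by simp [Real.pi_ne_zero]), mul_comm, hkey]
    have h1 := hI 1 (Or.inl rfl) L hL
    have h2 := hI (-1) (Or.inr rfl) L hL
    simp only [scaledWeight] at h1 h2
    rw [h1, h2]
    have h3 := congrArg (fun r : ℝ => (r : ℂ)) hdiff
    push_cast at h3 ⊢
    linear_combination (4 * Real.pi : ℂ) * h3
  have hlim : Tendsto (fun L => (A 1 L - A (-1) L - 4 * Real.pi * θ) /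
      (2 * Real.pi * Complex.I) ^ 2) atTop (𝓝 ((1 / Real.pi * θ : ℝ) : ℂ)) := by
    have h1 := (((hA0 1 (Or.inl rfl)).sub (hA0 (-1) (Or.inr rfl))).sub_const
      (4 * Real.pi * θ : ℂ)).div_const ((2 * Real.pi * Complex.I) ^ 2)
    have e : ((0 : ℂ) - 0 - 4 * Real.pi * θ) / (2 * Real.pi * Complex.I) ^ 2 =
        ((1 / Real.pi * θ : ℝ) : ℂ) := by
      have hpi : (Real.pi : ℂ) ≠ 0 := by exact_mod_cast Real.pi_ne_zero
      rw [mul_pow, Complex.I_sq]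
      push_cast
      field_simp
      ring
    rwa [e] at h1
  refine hlim.congr' ?_
  filter_upwards [eventually_ge_atTop (0 : ℝ)] with L hL
  exact (hK L hL).symm

/-! ### Critical points of the action -/

theorem exp_add_inv_re_im (σ θ : ℝ) :
    (Complex.exp (σ + θ * Complex.I) + (Complex.exp (σ + θ * Complex.I))⁻¹).re =
      2 * Real.cosh σ * Real.cos θ ∧
    (Complex.exp (σ + θ * Complex.I) + (Complex.exp (σ + θ * Complex.I))⁻¹).im =
      2 * Real.sinh σ * Real.sin θ ∧
    (Complex.exp (σ + θ * Complex.I) - (Complex.exp (σ + θ * Complex.I))⁻¹).re =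
      2 * Real.sinh σ * Real.cos θ ∧
    (Complex.exp (σ + θ * Complex.I) - (Complex.exp (σ + θ * Complex.I))⁻¹).im =
      2 * Real.cosh σ * Real.sin θ := by
  rw [← Complex.exp_neg]
  simp only [Complex.add_re, Complex.sub_re, Complex.add_im, Complex.sub_im, Complex.exp_re,
    Complex.exp_im]
  simp [Real.cosh_eq, Real.sinh_eq]
  refine ⟨?_, ?_, ?_, ?_⟩ <;> ring

theorem mem_slitPlane_of_im_pos {z : ℂ} (hz : 0 < z.im) {ε : ℝ} (hε : 0 < ε) :
    1 + (ε : ℂ) ^ 2 - ε * (z + z⁻¹) ∈ Complex.slitPlane := by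
  have hz0 : z ≠ 0 := by rintro rfl; simp at hz
  have hn : 0 < Complex.normSq z := Complex.normSq_pos.2 hz0
  have hre : (1 + (ε : ℂ) ^ 2 - ε * (z + z⁻¹)).re = 1 + ε ^ 2 - ε * (z.re + z.re / Complex.normSq z) := by
    rw [Complex.sub_re, Complex.re_ofReal_mul, Complex.add_re, Complex.add_re, Complex.inv_re,
      ← Complex.ofReal_pow, Complex.ofReal_re, Complex.one_re]
  have him : (1 + (ε : ℂ) ^ 2 - ε * (z + z⁻¹)).im = - ε * (z.im + -z.im / Complex.normSq z) := by
    rw [Complex.sub_im, Complex.im_ofReal_mul, Complex.add_im, Complex.add_im, Complex.inv_im,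
      ← Complex.ofReal_pow, Complex.ofReal_im, Complex.one_im]
    ring
  rw [Complex.mem_slitPlane_iff, hre, him]
  by_cases h : Complex.normSq z = 1
  · left
    rw [h, div_one]
    have h2 : z.re * z.re + z.im * z.im = 1 := by rw [← Complex.normSq_apply, h]
    have h3 : z.re < 1 := by nlinarith [mul_pos hz hz]
    nlinarith [sq_nonneg (1 - ε), mul_pos hε (sub_pos.2 h3)]
  · right
    intro h0
    have h1 : z.im * (1 - 1 / Complex.normSq z) = 0 := by
      have : ε * (z.im * (1 - 1 / Complex.normSq z)) = 0 := by rw [← neg_eq_zero, ← h0]; ring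
      exact (mul_eq_zero.1 this).resolve_left hε.ne'
    rcases mul_eq_zero.1 h1 with h2 | h2
    · exact hz.ne' h2
    · apply h
      field_simp at h2
      linarith

/-- The critical point equation without denominators. -/
theorem isUpperCritical_iff {ε τ ξ μ : ℝ} (hε : 0 < ε) {z : ℂ} :
    IsUpperCritical ε τ ξ μ z ↔ 0 < z.im ∧ (z - z⁻¹) * (τ * ((ε + ε⁻¹ : ℝ) - (z + z⁻¹)) - μ / 2) =
      ξ * ((ε + ε⁻¹ : ℝ) - (z + z⁻¹)) := by
  unfold IsUpperCritical
  refine and_congr_right fun hz => ?_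
  have hz0 : z ≠ 0 := by rintro rfl; simp at hz
  have hεc : (ε : ℂ) ≠ 0 := by exact_mod_cast hε.ne'
  have hw := mem_slitPlane_of_im_pos hz hε
  have hw0 := Complex.slitPlane_ne_zero hw
  have hsum : HasDerivAt (fun z : ℂ => z + z⁻¹) (1 + -(z ^ 2)⁻¹) z :=
    (hasDerivAt_id z).add (hasDerivAt_inv hz0)
  have hd : HasDerivAt (actionF ε τ ξ μ)
      (τ * (1 + -(z ^ 2)⁻¹) + μ / 2 * (-(ε * (1 + -(z ^ 2)⁻¹)) / (1 + (ε : ℂ) ^ 2 - ε * (z + z⁻¹))) -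
        ξ * z⁻¹) z :=
    ((hsum.const_mul (τ : ℂ)).add
      ((((hsum.const_mul (ε : ℂ)).const_sub (1 + (ε : ℂ) ^ 2)).clog hw).const_mul (μ / 2 : ℂ))).sub
      ((Complex.hasDerivAt_log (Complex.mem_slitPlane_iff.2 (Or.inr hz.ne'))).const_mul (ξ : ℂ))
  have hfac : 1 + (ε : ℂ) ^ 2 - ε * (z + z⁻¹) = ε * ((ε + ε⁻¹ : ℝ) - (z + z⁻¹)) := by
    push_cast
    field_simp
    ring
  rw [hd.deriv, hfac]
  rw [hfac] at hw0
  have hq0 : ((ε + ε⁻¹ : ℝ) : ℂ) - (z + z⁻¹) ≠ 0 := right_ne_zero_of_mul hw0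
  obtain ⟨q, hq⟩ : ∃ q, q = ((ε + ε⁻¹ : ℝ) : ℂ) - (z + z⁻¹) := ⟨_, rfl⟩
  rw [← hq] at hq0 ⊢
  have e : (τ * (1 + -(z ^ 2)⁻¹) + μ / 2 * (-(ε * (1 + -(z ^ 2)⁻¹)) / (ε * q)) - ξ * z⁻¹) * (z * q) =
      (z - z⁻¹) * (τ * q - μ / 2) - ξ * q := by
    field_simp
    ring
  rw [← sub_eq_zero (b := (ξ : ℂ) * q), ← e]
  simp [hz0, hq0]

/-- The real and the imaginary part of the equation of critical points are linear in `ξ` and `μ`, with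
determinant `a C - 2 c` up to the factor `s`. -/
theorem critical_system_iff {a τ ξ μ C S c s : ℝ} {u v : ℂ} (h1 : u.re = 2 * C * c)
    (h2 : u.im = 2 * S * s) (h3 : v.re = 2 * S * c) (h4 : v.im = 2 * C * s)
    (hCS : C ^ 2 = S ^ 2 + 1) (hcs : s ^ 2 + c ^ 2 = 1) (hs : s ≠ 0) (hden : a * C - 2 * c ≠ 0) :
    v * (τ * (a - u) - μ / 2) = ξ * (a - u) ↔
      ξ * (a * C - 2 * c) = 4 * τ * S * (C ^ 2 - c ^ 2) ∧
      μ * (a * C - 2 * c) = 2 * τ * C * (4 * (C ^ 2 + c ^ 2 - a * C * c) + a ^ 2 - 4) := by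
  have hre : (v * (τ * (a - u) - μ / 2) - ξ * (a - u)).re =
      τ * (2 * a * S * c - 4 * S * C * (2 * c ^ 2 - 1)) - μ * S * c - ξ * (a - 2 * C * c) := by
    simp [h1, h2, h3, h4]
    linear_combination (4 * τ * C * S) * hcs
  have him : (v * (τ * (a - u) - μ / 2) - ξ * (a - u)).im =
      s * (τ * (2 * a * C - 4 * c * (2 * C ^ 2 - 1)) - μ * C + 2 * ξ * S) := by
    simp [h1, h2, h3, h4]
    linear_combination (4 * τ * c * s) * hCS
  rw [← sub_eq_zero, Complex.ext_iff, hre, him, Complex.zero_re, Complex.zero_im,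
    mul_eq_zero, or_iff_right hs]
  constructor
  · rintro ⟨e1, e2⟩
    constructor
    · linear_combination (-C) * e1 + S * c * e2 + 2 * c * ξ * hCS
    · linear_combination (-2 * S) * e1 + (-(a - 2 * C * c)) * e2 +
        (2 * c * μ - 2 * τ * (2 * a * c - 4 * C * (2 * c ^ 2 - 1))) * hCS
  · rintro ⟨e1, e2⟩
    constructor
    · apply (mul_right_inj' hden).1
      linear_combination (-(a - 2 * C * c)) * e1 - (S * c) * e2
    · apply (mul_right_inj' hden).1
      linear_combination (2 * S) * e1 - C * e2 - 8 * τ * (C ^ 2 - c ^ 2) * hCS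

theorem den_pos {a C c : ℝ} (ha : 2 ≤ a) (hC : 1 ≤ C) (hc : c < 1) : 0 < a * C - 2 * c := by
  nlinarith

/-- The equation of critical points in the coordinates `σ = log ‖z‖` and `θ = arg z` is a linear system
for `ξ` and `μ`. -/
theorem isUpperCritical_exp_iff {ε τ ξ μ σ θ : ℝ} (hε : 0 < ε) (hθ : θ ∈ Set.Ioo 0 Real.pi) :
    IsUpperCritical ε τ ξ μ (Complex.exp (σ + θ * Complex.I)) ↔
      ξ * ((ε + ε⁻¹) * Real.cosh σ - 2 * Real.cos θ) =
        4 * τ * Real.sinh σ * (Real.cosh σ ^ 2 - Real.cos θ ^ 2) ∧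
      μ * ((ε + ε⁻¹) * Real.cosh σ - 2 * Real.cos θ) = 2 * τ * Real.cosh σ *
        (4 * (Real.cosh σ ^ 2 + Real.cos θ ^ 2 - (ε + ε⁻¹) * Real.cosh σ * Real.cos θ) +
          (ε + ε⁻¹) ^ 2 - 4) := by
  have hs : 0 < Real.sin θ := Real.sin_pos_of_mem_Ioo hθ
  have him : 0 < (Complex.exp (σ + θ * Complex.I)).im := by
    rw [Complex.exp_im]
    have := mul_pos (Real.exp_pos σ) hs
    simpa using this
  rw [isUpperCritical_iff hε, and_iff_right him]
  obtain ⟨h1, h2, h3, h4⟩ := exp_add_inv_re_im σ θ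
  refine critical_system_iff h1 h2 h3 h4 (Real.cosh_sq σ) (Real.sin_sq_add_cos_sq θ) hs.ne'
    (den_pos (two_le_add_inv hε) (Real.one_le_cosh σ) ?_).ne'
  nlinarith [Real.cos_le_one θ, Real.sin_sq_add_cos_sq θ]

/-- Away from the poles the critical points are the zeros of a real quartic polynomial with negative
quotient of the lowest and the highest coefficient, hence with at most one pair of complex conjugate
zeros. -/
theorem IsUpperCritical.unique {ε τ ξ μ : ℝ} (hε : 0 < ε) (hτ : 0 < τ) {z z' : ℂ}
    (hz : IsUpperCritical ε τ ξ μ z) (hz' : IsUpperCritical ε τ ξ μ z') : z' = z := by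
  have hquart : ∀ {z : ℂ}, IsUpperCritical ε τ ξ μ z →
      τ * z ^ 4 + ((-τ * (ε + ε⁻¹) + μ / 2 - ξ : ℝ) : ℂ) * z ^ 3 + ((ξ * (ε + ε⁻¹) : ℝ) : ℂ) * z ^ 2 +
        ((τ * (ε + ε⁻¹) - μ / 2 - ξ : ℝ) : ℂ) * z - τ = 0 := by
    intro z h
    obtain ⟨him, h⟩ := (isUpperCritical_iff hε).1 h
    have hz0 : z ≠ 0 := by rintro rfl; simp at him
    obtain ⟨a, ha⟩ : ∃ a, a = ε + ε⁻¹ := ⟨_, rfl⟩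
    rw [← ha] at h ⊢
    field_simp at h
    push_cast
    linear_combination (-1 / 2) * h
  have h := hquart hz
  have h' := hquart hz'
  have him := hz.1
  have him' := hz'.1
  obtain ⟨b₃, hb₃⟩ : ∃ b : ℝ, b = -τ * (ε + ε⁻¹) + μ / 2 - ξ := ⟨_, rfl⟩
  obtain ⟨b₂, hb₂⟩ : ∃ b : ℝ, b = ξ * (ε + ε⁻¹) := ⟨_, rfl⟩
  obtain ⟨b₁, hb₁⟩ : ∃ b : ℝ, b = τ * (ε + ε⁻¹) - μ / 2 - ξ := ⟨_, rfl⟩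
  rw [← hb₃, ← hb₂, ← hb₁] at h h'
  clear hb₁ hb₂ hb₃ hquart hz hz'
  obtain ⟨s, hs⟩ : ∃ s, s = 2 * z.re := ⟨_, rfl⟩
  obtain ⟨n, hn⟩ : ∃ n, n = z.re ^ 2 + z.im ^ 2 := ⟨_, rfl⟩
  have hn0 : 0 < n := by rw [hn]; positivity
  have hroot : z ^ 2 - s * z + n = 0 := by
    rw [hs, hn]
    apply Complex.ext <;> simp [pow_two] <;> ring
  obtain ⟨p, hp⟩ : ∃ p, p = b₃ / τ + s := ⟨_, rfl⟩
  obtain ⟨q, hq⟩ : ∃ q, q = b₂ / τ - n + s * p := ⟨_, rfl⟩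
  have hp' : b₃ = τ * (p - s) := by rw [hp]; field_simp; ring
  have hq' : b₂ = τ * (q + n - s * p) := by rw [hq]; field_simp; ring
  have hfac : ∀ w : ℂ, τ * w ^ 4 + b₃ * w ^ 3 + b₂ * w ^ 2 + b₁ * w - τ =
      τ * (w ^ 2 - s * w + n) * (w ^ 2 + p * w + q) +
        (((b₁ - τ * (n * p - s * q) : ℝ) : ℂ) * w + ((-τ - τ * (n * q) : ℝ) : ℂ)) := by
    intro w
    rw [hp', hq']
    push_cast
    ring
  rw [hfac, hroot, mul_zero, zero_mul, zero_add] at h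
  -- The remainder of the division by `(w - z) (w - conj z)` is real and vanishes at the non-real point
  -- `z`.
  have h1 : b₁ - τ * (n * p - s * q) = 0 := by
    have := congrArg Complex.im h
    rw [Complex.add_im, Complex.im_ofReal_mul, Complex.ofReal_im, add_zero, Complex.zero_im] at this
    exact (mul_eq_zero.1 this).resolve_right him.ne'
  have h2 : -τ - τ * (n * q) = 0 := by
    rw [h1, Complex.ofReal_zero, zero_mul, zero_add] at h
    exact_mod_cast h
  -- The second quadratic factor has the negative constant term `q = -1 / n`, so its zeros are real.
  have hnq : n * q = -1 := by
    have : τ * (n * q + 1) = 0 := by linarith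
    have := (mul_eq_zero.1 this).resolve_left hτ.ne'
    linarith
  rw [hfac, h1, h2, Complex.ofReal_zero, zero_mul, add_zero, add_zero, mul_eq_zero, mul_eq_zero,
    or_iff_right (by exact_mod_cast hτ.ne' : (τ : ℂ) ≠ 0)] at h'
  rcases h' with h' | h'
  · have hr := congrArg Complex.re h'
    have hi := congrArg Complex.im h'
    simp [pow_two] at hr hi
    have e1 : z'.re = z.re := by
      have : z'.im * (2 * (z'.re - z.re)) = 0 := by rw [hs] at hi; linarith
      have := (mul_eq_zero.1 this).resolve_left him'.ne'
      linarith
    refine Complex.ext e1 ?_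
    rw [hs, hn, e1] at hr
    apply (sq_eq_sq₀ him'.le him.le).1
    linarith
  · have hr := congrArg Complex.re h'
    have hi := congrArg Complex.im h'
    simp [pow_two] at hr hi
    have e1 : p = -2 * z'.re := by
      have : z'.im * (2 * z'.re + p) = 0 := by linarith
      have := (mul_eq_zero.1 this).resolve_left him'.ne'
      linarith
    rw [e1] at hr
    have hq0 : q = z'.re ^ 2 + z'.im ^ 2 := by linarith
    have : 0 ≤ n * q := by rw [hq0]; positivity
    linarith

/-! ### Slices of the domain -/

/-- The value of `ξ` for which `exp (σ + i arccos c)` is a critical point; here `a = ε + ε⁻¹`. -/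
noncomputable def critSpeed (τ a σ c : ℝ) : ℝ :=
  4 * τ * Real.sinh σ * (Real.cosh σ ^ 2 - c ^ 2) / (a * Real.cosh σ - 2 * c)

/-- The value of `μ` for which `exp (σ + i arccos c)` is a critical point; here `a = ε + ε⁻¹`. -/
noncomputable def critLevel (τ a σ c : ℝ) : ℝ :=
  2 * τ * Real.cosh σ * (4 * (Real.cosh σ ^ 2 + c ^ 2 - a * Real.cosh σ * c) + a ^ 2 - 4) /
    (a * Real.cosh σ - 2 * c)

theorem critSpeed_zero (τ a c : ℝ) : critSpeed τ a 0 c = 0 := by simp [critSpeed]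

theorem critSpeed_neg (τ a σ c : ℝ) : critSpeed τ a (-σ) c = -critSpeed τ a σ c := by
  simp [critSpeed, neg_div]

theorem critLevel_zero {τ a c : ℝ} : critLevel τ a 0 c = 2 * τ * (a - 2 * c) := by
  rcases eq_or_ne (a - 2 * c) 0 with h | h
  · simp [critLevel, h]
  · unfold critLevel
    rw [Real.cosh_zero, div_eq_iff (by rwa [mul_one])]
    ring

/-- For `a = 2` the denominator cancels; the formula also holds at its zero `σ = 0`, `c = 1`. -/
theorem critSpeed_two {τ σ c : ℝ} (hc : c ≤ 1) :
    critSpeed τ 2 σ c = 2 * τ * Real.sinh σ * (Real.cosh σ + c) := by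
  unfold critSpeed
  rcases eq_or_ne (2 * Real.cosh σ - 2 * c) 0 with h | h
  · have h1 := Real.one_le_cosh σ
    have h2 : Real.cosh σ ^ 2 = 1 := by
      have : Real.cosh σ = 1 := by linarith
      rw [this]; norm_num
    have h3 : Real.sinh σ = 0 := by
      have := Real.cosh_sq σ
      exact pow_eq_zero_iff two_ne_zero |>.1 (by linarith)
    simp [h3]
  · rw [div_eq_iff h]
    ring

/-- The numerator and the denominator have the common factor `2 cosh σ - 2 c`, and where it vanishes so
do both sides. -/
theorem critLevel_two {τ σ c : ℝ} :
    critLevel τ 2 σ c = 4 * τ * Real.cosh σ * (Real.cosh σ - c) := by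
  unfold critLevel
  rcases eq_or_ne (2 * Real.cosh σ - 2 * c) 0 with h | h
  · rw [h, div_zero, show Real.cosh σ - c = 0 by linarith, mul_zero]
  · rw [div_eq_iff h]
    ring

theorem den_pos_of_two_lt {a C c : ℝ} (ha : 2 < a) (hC : 1 ≤ C) (hc : c ≤ 1) :
    0 < a * C - 2 * c := by
  nlinarith

theorem continuousOn_critSpeed {τ a : ℝ} (ha : 2 ≤ a) :
    ContinuousOn (fun p : ℝ × ℝ => critSpeed τ a p.1 p.2) (Set.univ ×ˢ Set.Icc (-1) 1) := by
  rcases ha.eq_or_lt with rfl | ha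
  · have : ContinuousOn (fun p : ℝ × ℝ => 2 * τ * Real.sinh p.1 * (Real.cosh p.1 + p.2))
        (Set.univ ×ˢ Set.Icc (-1) 1) := by fun_prop
    exact this.congr fun p hp => critSpeed_two hp.2.2
  · unfold critSpeed
    refine ContinuousOn.div (by fun_prop) (by fun_prop) fun p hp => ?_
    exact (den_pos_of_two_lt ha (Real.one_le_cosh _) hp.2.2).ne'

theorem continuousOn_critLevel {τ a : ℝ} (ha : 2 ≤ a) :
    ContinuousOn (fun p : ℝ × ℝ => critLevel τ a p.1 p.2) (Set.univ ×ˢ Set.Icc (-1) 1) := by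
  rcases ha.eq_or_lt with rfl | ha
  · have : ContinuousOn (fun p : ℝ × ℝ => 4 * τ * Real.cosh p.1 * (Real.cosh p.1 - p.2))
        (Set.univ ×ˢ Set.Icc (-1) 1) := by fun_prop
    exact this.congr fun p _ => critLevel_two
  · unfold critLevel
    refine ContinuousOn.div (by fun_prop) (by fun_prop) fun p hp => ?_
    exact (den_pos_of_two_lt ha (Real.one_le_cosh _) hp.2.2).ne'

/-- The factor of `critSpeed` beside `sinh σ` is increasing in `C = cosh σ`. -/
theorem div_le_div_of_cosh_le {a c C₁ C₂ : ℝ} (ha : 2 ≤ a) (hc : c ∈ Set.Icc (-1 : ℝ) 1)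
    (h₁ : 1 < C₁) (h : C₁ ≤ C₂) :
    0 < (C₁ ^ 2 - c ^ 2) / (a * C₁ - 2 * c) ∧
      (C₁ ^ 2 - c ^ 2) / (a * C₁ - 2 * c) ≤ (C₂ ^ 2 - c ^ 2) / (a * C₂ - 2 * c) := by
  obtain ⟨hc1, hc2⟩ := hc
  have hden : ∀ {C : ℝ}, 1 < C → 0 < a * C - 2 * c := fun hC => by nlinarith
  have hd₁ := hden h₁
  have hd₂ := hden (h₁.trans_le h)
  constructor
  · exact div_pos (by nlinarith) hd₁
  · rw [div_le_div_iff₀ hd₁ hd₂]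
    have hb : 0 ≤ a * (C₁ * C₂ + c ^ 2) - 2 * c * (C₁ + C₂) := by
      have e1 : 0 ≤ (C₁ - c) * (C₂ - c) := mul_nonneg (by linarith) (by linarith)
      have e2 : 0 ≤ (a - 2) * (C₁ * C₂ + c ^ 2) :=
        mul_nonneg (by linarith) (by have : 0 < C₁ * C₂ := by nlinarith
                                     positivity)
      linarith
    linarith [mul_nonneg (sub_nonneg.2 h) hb]

theorem strictMono_critSpeed {τ a c : ℝ} (hτ : 0 < τ) (ha : 2 ≤ a) (hc : c ∈ Set.Icc (-1 : ℝ) 1) :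
    StrictMono fun σ => critSpeed τ a σ c := by
  apply strictMono_of_odd_strictMonoOn_nonneg fun σ => critSpeed_neg τ a σ c
  intro σ₁ h₁ σ₂ h₂ hlt
  have e : ∀ σ, critSpeed τ a σ c = 4 * τ * (Real.sinh σ *
      ((Real.cosh σ ^ 2 - c ^ 2) / (a * Real.cosh σ - 2 * c))) := by
    intro σ; unfold critSpeed; ring
  simp only
  have h₁' : 0 ≤ σ₁ := h₁
  rw [e, e]
  refine mul_lt_mul_of_pos_left ?_ (by positivity)
  have hC₂ : 1 < Real.cosh σ₂ := Real.one_lt_cosh.2 (by linarith)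
  rcases h₁'.eq_or_lt with rfl | h₁'
  · rw [Real.sinh_zero, zero_mul]
    exact mul_pos (Real.sinh_pos_iff.2 hlt) (div_le_div_of_cosh_le ha hc hC₂ le_rfl).1
  · have hC₁ : 1 < Real.cosh σ₁ := Real.one_lt_cosh.2 h₁'.ne'
    have hCC : Real.cosh σ₁ ≤ Real.cosh σ₂ := by
      apply Real.cosh_le_cosh.2
      rw [abs_of_pos h₁', abs_of_pos (by linarith)]
      exact hlt.le
    obtain ⟨h3, h4⟩ := div_le_div_of_cosh_le ha hc hC₁ hCC
    exact mul_lt_mul (Real.sinh_lt_sinh.2 hlt) h4 h3 (Real.sinh_nonneg_iff.2 (by linarith))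

theorem surjective_critSpeed {τ a c : ℝ} (hτ : 0 < τ) (ha : 2 ≤ a) (hc : c ∈ Set.Icc (-1 : ℝ) 1) :
    Function.Surjective fun σ => critSpeed τ a σ c := by
  have hcont : Continuous fun σ => critSpeed τ a σ c :=
    (continuousOn_critSpeed (τ := τ) ha).comp_continuous (f := fun σ : ℝ => (σ, c)) (by fun_prop)
      fun σ => ⟨Set.mem_univ _, hc⟩
  have htop : Tendsto (fun σ => critSpeed τ a σ c) atTop atTop := by
    set k := (Real.cosh 1 ^ 2 - c ^ 2) / (a * Real.cosh 1 - 2 * c)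
    have hk : 0 < k := (div_le_div_of_cosh_le ha hc (Real.one_lt_cosh.2 one_ne_zero) le_rfl).1
    refine tendsto_atTop_mono' _ ?_ (tendsto_id.const_mul_atTop (by positivity : 0 < 4 * τ * k))
    filter_upwards [eventually_ge_atTop 1] with σ hσ
    have h1 : k ≤ _ := (div_le_div_of_cosh_le ha hc (C₂ := Real.cosh σ)
      (Real.one_lt_cosh.2 one_ne_zero) (by
        apply Real.cosh_le_cosh.2
        rwa [abs_one, abs_of_nonneg (by linarith)])).2
    have h2 : σ ≤ Real.sinh σ := Real.self_le_sinh_iff.2 (by linarith)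
    have h3 := mul_le_mul h2 h1 hk.le (by linarith : 0 ≤ Real.sinh σ)
    have e : critSpeed τ a σ c = 4 * τ * (Real.sinh σ *
        ((Real.cosh σ ^ 2 - c ^ 2) / (a * Real.cosh σ - 2 * c))) := by unfold critSpeed; ring
    rw [e, id]
    calc 4 * τ * k * σ = 4 * τ * (σ * k) := by ring
      _ ≤ _ := by gcongr
  refine hcont.surjective htop ?_
  have := tendsto_neg_atTop_atBot.comp (htop.comp tendsto_neg_atBot_atTop)
  refine this.congr fun σ => ?_
  simp [critSpeed_neg]

/-- The solution of an equation that is strictly monotone in the unknown depends continuously on the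
parameter. -/
theorem continuousOn_of_strictMono_of_eq {X : Type*} [TopologicalSpace X] {A : Set X}
    {H : ℝ → X → ℝ} {s y : X → ℝ} (hmono : ∀ x ∈ A, StrictMono fun σ => H σ x)
    (hcont : ∀ σ, ContinuousOn (H σ) A) (hy : ContinuousOn y A) (hs : ∀ x ∈ A, H (s x) x = y x) :
    ContinuousOn s A := by
  intro x hx
  refine tendsto_order.2 ⟨fun σ hσ => ?_, fun σ hσ => ?_⟩
  · have h1 : H σ x < y x := by rw [← hs x hx]; exact hmono x hx hσ
    filter_upwards [(hcont σ x hx).eventually_lt (hy x hx) h1, self_mem_nhdsWithin] with x' h2 hx'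
    rw [← hs x' hx'] at h2
    exact (hmono x' hx').lt_iff_lt.1 h2
  · have h1 : y x < H σ x := by rw [← hs x hx]; exact hmono x hx hσ
    filter_upwards [(hy x hx).eventually_lt (hcont σ x hx) h1, self_mem_nhdsWithin] with x' h2 hx'
    rw [← hs x' hx'] at h2
    exact (hmono x' hx').lt_iff_lt.1 h2

/-- For each angle, `ξ` determines the critical modulus, continuously up to the real points `c = ±1`. -/
theorem exists_critSpeed_inverse {τ a : ℝ} (hτ : 0 < τ) (ha : 2 ≤ a) :
    ∃ s : ℝ × ℝ → ℝ, ContinuousOn s (Set.univ ×ˢ Set.Icc (-1) 1) ∧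
      ∀ ξ, ∀ c ∈ Set.Icc (-1 : ℝ) 1, ∀ σ, critSpeed τ a σ c = ξ ↔ s (ξ, c) = σ := by
  have hex : ∀ p : ℝ × ℝ, ∃ σ, p.2 ∈ Set.Icc (-1 : ℝ) 1 → critSpeed τ a σ p.2 = p.1 := by
    intro p
    by_cases hp : p.2 ∈ Set.Icc (-1 : ℝ) 1
    · obtain ⟨σ, hσ⟩ := surjective_critSpeed hτ ha hp p.1
      exact ⟨σ, fun _ => hσ⟩
    · exact ⟨0, fun h => absurd h hp⟩
  choose s hs using hex
  refine ⟨s, ?_, fun ξ c hc σ => ⟨fun h => ?_, fun h => ?_⟩⟩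
  · refine continuousOn_of_strictMono_of_eq (H := fun σ p => critSpeed τ a σ p.2) (y := Prod.fst)
      (fun p hp => strictMono_critSpeed hτ ha hp.2) (fun σ => ?_) continuousOn_fst
      (fun p hp => hs p hp.2)
    exact (continuousOn_critSpeed (τ := τ) ha).comp (f := fun p : ℝ × ℝ => (σ, p.2))
      (by fun_prop) fun p hp => ⟨Set.mem_univ _, hp.2⟩
  · exact (strictMono_critSpeed hτ ha hc).injective ((hs (ξ, c) hc).trans h.symm)
  · rw [← h]; exact hs (ξ, c) hc

theorem lt_and_lt_of_strictMonoOn_Ioo {f : ℝ → ℝ} {p q : ℝ} (hf : ContinuousOn f (Set.Icc p q))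
    (hm : StrictMonoOn f (Set.Ioo p q)) {x : ℝ} (hx : x ∈ Set.Ioo p q) : f p < f x ∧ f x < f q := by
  have hpq : p < q := hx.1.trans hx.2
  constructor
  · obtain ⟨y, hy1, hy2⟩ := exists_between hx.1
    have hy : y ∈ Set.Ioo p q := ⟨hy1, hy2.trans hx.2⟩
    refine lt_of_le_of_lt ?_ (hm hy hx hy2)
    have hc : ContinuousWithinAt f (Set.Ioo p y) p :=
      (hf p ⟨le_rfl, hpq.le⟩).mono fun w hw => ⟨hw.1.le, (hw.2.trans hy.2).le⟩
    refine hc.closure_le (g := fun _ => f y) ?_ continuousWithinAt_const fun w hw =>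
      (hm ⟨hw.1, hw.2.trans hy.2⟩ hy hw.2).le
    rw [closure_Ioo hy1.ne]
    exact ⟨le_rfl, hy1.le⟩
  · obtain ⟨y, hy1, hy2⟩ := exists_between hx.2
    have hy : y ∈ Set.Ioo p q := ⟨hx.1.trans hy1, hy2⟩
    refine lt_of_lt_of_le (hm hx hy hy1) ?_
    have hc : ContinuousWithinAt f (Set.Ioo y q) q :=
      (hf q ⟨hpq.le, le_rfl⟩).mono fun w hw => ⟨(hy.1.trans hw.1).le, hw.2.le⟩
    refine ContinuousWithinAt.closure_le (f := fun _ => f y) ?_ continuousWithinAt_const hc fun w hw =>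
      (hm hy ⟨hy.1.trans hw.1, hw.2⟩ hw.1).le
    rw [closure_Ioo hy2.ne]
    exact ⟨hy2.le, le_rfl⟩

/-- A continuous function that is injective on an open interval maps it onto the open interval between
the values at the end points. -/
theorem image_Ioo_of_injOn {f : ℝ → ℝ} {p q : ℝ} (hpq : p < q) (hf : ContinuousOn f (Set.Icc p q))
    (hi : Set.InjOn f (Set.Ioo p q)) :
    f p ≠ f q ∧ (f q < f p → f '' Set.Ioo p q = Set.Ioo (f q) (f p)) := by
  obtain ⟨x, hx1, hx2⟩ := exists_between hpq
  rcases (hf.mono Set.Ioo_subset_Icc_self).strictMonoOn_of_injOn_Ioo hpq hi with h | h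
  · have h1 := lt_and_lt_of_strictMonoOn_Ioo hf h ⟨hx1, hx2⟩
    exact ⟨(h1.1.trans h1.2).ne, fun h2 => absurd h2 (h1.1.trans h1.2).not_gt⟩
  · have hneg : ∀ {x}, x ∈ Set.Ioo p q → f x < f p ∧ f q < f x := by
      intro x hx
      have := lt_and_lt_of_strictMonoOn_Ioo hf.neg h.neg hx
      exact ⟨neg_lt_neg_iff.1 this.1, neg_lt_neg_iff.1 this.2⟩
    have h1 := hneg ⟨hx1, hx2⟩
    refine ⟨(h1.2.trans h1.1).ne', fun _ => Set.Subset.antisymm ?_ (intermediate_value_Ioo' hpq.le hf)⟩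
    rintro _ ⟨x, hx, rfl⟩
    exact ⟨(hneg hx).2, (hneg hx).1⟩

/-! ### The domain between two boundary curves -/

theorem isUpperCritical_exp_iff_crit {ε τ ξ μ σ θ : ℝ} (hε : 0 < ε) (hθ : θ ∈ Set.Ioo 0 Real.pi) :
    IsUpperCritical ε τ ξ μ (Complex.exp (σ + θ * Complex.I)) ↔
      critSpeed τ (ε + ε⁻¹) σ (Real.cos θ) = ξ ∧ critLevel τ (ε + ε⁻¹) σ (Real.cos θ) = μ := by
  have hs : 0 < Real.sin θ := Real.sin_pos_of_mem_Ioo hθ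
  have hden := den_pos (two_le_add_inv hε) (Real.one_le_cosh σ) (c := Real.cos θ) (by
    nlinarith [Real.cos_le_one θ, Real.sin_sq_add_cos_sq θ])
  rw [isUpperCritical_exp_iff hε hθ, critSpeed, critLevel, div_eq_iff hden.ne', div_eq_iff hden.ne']
  exact and_congr ⟨Eq.symm, Eq.symm⟩ ⟨Eq.symm, Eq.symm⟩

theorem exists_exp_eq_of_im_pos {z : ℂ} (hz : 0 < z.im) :
    z.arg ∈ Set.Ioo 0 Real.pi ∧ z = Complex.exp (Real.log ‖z‖ + z.arg * Complex.I) := by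
  have hz0 : z ≠ 0 := by rintro rfl; simp at hz
  constructor
  · refine ⟨(Complex.arg_nonneg_iff.2 hz.le).lt_of_ne fun h => ?_,
      (Complex.arg_le_pi z).lt_of_ne fun h => ?_⟩
    · exact hz.ne' (Complex.arg_eq_zero_iff.1 h.symm).2
    · exact hz.ne' (Complex.arg_eq_pi_iff.1 h).2
  · rw [Complex.exp_add, ← Complex.ofReal_exp, Real.exp_log (norm_pos_iff.2 hz0),
      Complex.norm_mul_exp_arg_mul_I]

theorem cos_mem_Ioo {θ : ℝ} (hθ : θ ∈ Set.Ioo 0 Real.pi) : Real.cos θ ∈ Set.Ioo (-1 : ℝ) 1 := by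
  have hs : 0 < Real.sin θ := Real.sin_pos_of_mem_Ioo hθ
  have h := Real.sin_sq_add_cos_sq θ
  constructor <;> nlinarith [Real.cos_le_one θ, Real.neg_one_le_cos θ]

theorem critLevel_nonneg {τ a σ c : ℝ} (hτ : 0 < τ) (ha : 2 ≤ a) (hc : c ∈ Set.Icc (-1 : ℝ) 1) :
    0 ≤ critLevel τ a σ c := by
  have hC := Real.one_le_cosh σ
  refine div_nonneg (mul_nonneg (by positivity) ?_) (by nlinarith [hc.2])
  have : 0 ≤ (Real.cosh σ ^ 2 - 1) * (1 - c ^ 2) :=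
    mul_nonneg (by nlinarith) (by nlinarith [hc.1, hc.2])
  nlinarith [sq_nonneg (a - 2 * Real.cosh σ * c)]

/-- The domain `𝒟₁` is the region between two curves, which correspond to the real critical points: the
lower one to the positive and the upper one to the negative real axis. -/
theorem exists_domainD1_eq {ε τ : ℝ} (hε : 0 < ε) (hτ : 0 < τ) :
    ∃ lo up : ℝ → ℝ, Continuous lo ∧ Continuous up ∧ (∀ ξ, lo ξ < up ξ) ∧
      (∀ σ, lo (critSpeed τ (ε + ε⁻¹) σ 1) = critLevel τ (ε + ε⁻¹) σ 1) ∧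
      (∀ σ, up (critSpeed τ (ε + ε⁻¹) σ (-1)) = critLevel τ (ε + ε⁻¹) σ (-1)) ∧
      domainD1 ε τ = {p | lo p.1 < p.2 ∧ p.2 < up p.1} := by
  have ha := two_le_add_inv hε
  have h1 : (1 : ℝ) ∈ Set.Icc (-1 : ℝ) 1 := by norm_num
  have h1' : (-1 : ℝ) ∈ Set.Icc (-1 : ℝ) 1 := by norm_num
  obtain ⟨s, hsc, hs⟩ := exists_critSpeed_inverse (τ := τ) (a := ε + ε⁻¹) hτ ha
  obtain ⟨m, hm⟩ : ∃ m : ℝ → ℝ → ℝ, ∀ ξ c, m ξ c = critLevel τ (ε + ε⁻¹) (s (ξ, c)) c :=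
    ⟨_, fun _ _ => rfl⟩
  have hmc : ContinuousOn (fun p : ℝ × ℝ => m p.1 p.2) (Set.univ ×ˢ Set.Icc (-1) 1) := by
    simp only [hm]
    have hf : ContinuousOn (fun p : ℝ × ℝ => (s (p.1, p.2), p.2)) (Set.univ ×ˢ Set.Icc (-1) 1) :=
      hsc.prodMk continuousOn_snd
    have hmaps : Set.MapsTo (fun p : ℝ × ℝ => (s (p.1, p.2), p.2)) (Set.univ ×ˢ Set.Icc (-1) 1)
        (Set.univ ×ˢ Set.Icc (-1) 1) := fun p hp => ⟨Set.mem_univ _, hp.2⟩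
    have h := (continuousOn_critLevel (τ := τ) ha).comp hf hmaps
    exact h
  have hmξ : ∀ c ∈ Set.Icc (-1 : ℝ) 1, Continuous fun ξ => m ξ c := fun c hc =>
    hmc.comp_continuous (f := fun ξ : ℝ => (ξ, c)) (by fun_prop) fun ξ => ⟨Set.mem_univ _, hc⟩
  have hmcc : ∀ ξ, ContinuousOn (m ξ) (Set.Icc (-1) 1) := fun ξ =>
    hmc.comp (f := fun c : ℝ => (ξ, c)) (by fun_prop) fun c hc => ⟨Set.mem_univ _, hc⟩
  -- Two angles with the same `ξ` and `μ` would give two critical points.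
  have hinj : ∀ ξ, Set.InjOn (m ξ) (Set.Ioo (-1) 1) := by
    have hcrit : ∀ ξ, ∀ c ∈ Set.Ioo (-1 : ℝ) 1,
        IsUpperCritical ε τ ξ (m ξ c) (Complex.exp (s (ξ, c) + Real.arccos c * Complex.I)) := by
      intro ξ c hc
      have hcos := Real.cos_arccos hc.1.le hc.2.le
      rw [isUpperCritical_exp_iff_crit hε ⟨Real.arccos_pos.2 hc.2, Real.arccos_lt_pi.2 hc.1⟩, hcos]
      exact ⟨(hs ξ c (Set.Ioo_subset_Icc_self hc) _).2 rfl, (hm ξ c).symm⟩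
    intro ξ c hc c' hc' he
    have hz := hcrit ξ c hc
    have hz' := hcrit ξ c' hc'
    rw [← he] at hz'
    have e := hz.unique hε hτ hz'
    have en := congrArg norm e
    have er := congrArg Complex.re e
    rw [Complex.norm_exp, Complex.norm_exp] at en
    rw [Complex.exp_re, Complex.exp_re, en] at er
    have := mul_left_cancel₀ (Real.exp_ne_zero _) er
    simpa [Real.cos_arccos hc.1.le hc.2.le, Real.cos_arccos hc'.1.le hc'.2.le] using this.symm
  have himage := fun ξ => image_Ioo_of_injOn (by norm_num) (hmcc ξ) (hinj ξ)
  have hlt : ∀ ξ, m ξ 1 < m ξ (-1) := by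
    -- Injectivity makes the two end values different, and at `ξ = 0` their order is explicit.
    have h0 : m 0 1 < m 0 (-1) := by
      rw [hm, hm, (hs 0 1 h1 0).1 (critSpeed_zero _ _ _), (hs 0 (-1) h1' 0).1 (critSpeed_zero _ _ _),
        critLevel_zero, critLevel_zero]
      linarith
    intro ξ
    by_contra hge
    obtain ⟨η, -, hη⟩ := intermediate_value_uIcc (a := 0) (b := ξ)
      (f := fun ξ => m ξ 1 - m ξ (-1)) ((hmξ 1 h1).sub (hmξ (-1) h1')).continuousOn
      (Set.mem_uIcc.2 (Or.inl ⟨by linarith, by linarith⟩) : (0 : ℝ) ∈ _)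
    exact (himage η).1 (by simp only at hη; linarith)
  refine ⟨fun ξ => m ξ 1, fun ξ => m ξ (-1), hmξ 1 h1, hmξ (-1) h1', hlt, fun σ => ?_, fun σ => ?_, ?_⟩
  · simp only
    rw [hm, (hs _ 1 h1 σ).1 rfl]
  · simp only
    rw [hm, (hs _ (-1) h1' σ).1 rfl]
  · ext ⟨ξ, μ⟩
    change _ ↔ μ ∈ Set.Ioo (m ξ 1) (m ξ (-1))
    rw [← (himage ξ).2 (hlt ξ)]
    constructor
    · rintro ⟨-, z, hz⟩
      obtain ⟨harg, hzexp⟩ := exists_exp_eq_of_im_pos hz.1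
      rw [hzexp, isUpperCritical_exp_iff_crit hε harg] at hz
      refine ⟨Real.cos z.arg, cos_mem_Ioo harg, ?_⟩
      rw [hm, (hs ξ _ (Set.Ioo_subset_Icc_self (cos_mem_Ioo harg)) _).1 hz.1, hz.2]
    · rintro ⟨c, hc, rfl⟩
      refine ⟨(critLevel_nonneg hτ ha (Set.Ioo_subset_Icc_self hc)).trans_eq (hm ξ c).symm,
        Complex.exp (s (ξ, c) + Real.arccos c * Complex.I), ?_⟩
      rw [isUpperCritical_exp_iff_crit hε ⟨Real.arccos_pos.2 hc.2, Real.arccos_lt_pi.2 hc.1⟩,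
        Real.cos_arccos hc.1.le hc.2.le]
      exact ⟨(hs ξ c (Set.Ioo_subset_Icc_self hc) _).2 rfl, (hm ξ c).symm⟩

/-- The kernel carries the factor `w ^ x` where the action has `-ξ log z`, so the saddle points of the
kernel are the critical points of the action with `σ = log ‖z‖` of the opposite sign. -/
theorem isSaddle_of_crit {ε τ ξ μ σ θ : ℝ} (hθ : θ ∈ Set.Icc 0 Real.pi)
    (hden : 0 < (ε + ε⁻¹) * Real.cosh σ - 2 * Real.cos θ)
    (hξ : critSpeed τ (ε + ε⁻¹) σ (Real.cos θ) = ξ)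
    (hρ : 0 < 4 * (Real.cosh σ ^ 2 + Real.cos θ ^ 2 -
      (ε + ε⁻¹) * Real.cosh σ * Real.cos θ) + (ε + ε⁻¹) ^ 2 - 4)
    (hμ : ∀ y ∈ Set.Icc (-1 : ℝ) 1,
      (y - Real.cos θ) * (critLevel τ (ε + ε⁻¹) σ (Real.cos θ) - μ) ≤ 0) :
    IsSaddle ε τ ξ μ (-σ) θ (√(4 * (Real.cosh σ ^ 2 + Real.cos θ ^ 2 -
      (ε + ε⁻¹) * Real.cosh σ * Real.cos θ) + (ε + ε⁻¹) ^ 2 - 4)) where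
  angle_mem := hθ
  den_pos := by rwa [Real.cosh_neg]
  radius_pos := Real.sqrt_pos.2 hρ
  radius_sq := by rw [Real.cosh_neg, Real.sq_sqrt hρ.le]
  speed := by
    rw [← hξ, critSpeed, Real.cosh_neg, Real.sinh_neg]
    ring
  slope := by
    intro y hy
    have h := hμ y hy
    rw [Real.cosh_neg, Real.sq_sqrt hρ.le]
    have e : 2 * τ * Real.cosh σ - μ * ((ε + ε⁻¹) * Real.cosh σ - 2 * Real.cos θ) /
        (4 * (Real.cosh σ ^ 2 + Real.cos θ ^ 2 - (ε + ε⁻¹) * Real.cosh σ * Real.cos θ) +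
          (ε + ε⁻¹) ^ 2 - 4) = (critLevel τ (ε + ε⁻¹) σ (Real.cos θ) - μ) *
        (((ε + ε⁻¹) * Real.cosh σ - 2 * Real.cos θ) /
        (4 * (Real.cosh σ ^ 2 + Real.cos θ ^ 2 - (ε + ε⁻¹) * Real.cosh σ * Real.cos θ) +
          (ε + ε⁻¹) ^ 2 - 4)) := by
      unfold critLevel
      generalize (ε + ε⁻¹) * Real.cosh σ - 2 * Real.cos θ = D at hden
      generalize 4 * (Real.cosh σ ^ 2 + Real.cos θ ^ 2 -
        (ε + ε⁻¹) * Real.cosh σ * Real.cos θ) + (ε + ε⁻¹) ^ 2 - 4 = Q at hρ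
      have h1 := hden.ne'
      have h2 := hρ.ne'
      field_simp
    rw [e, ← mul_assoc]
    exact mul_nonpos_of_nonpos_of_nonneg h (div_pos hden hρ).le

/-! ### The three phases -/

theorem tendsto_corrKernel_of_isUpperCritical {ε τ ξ μ : ℝ} (hε : 0 < ε) (hτ : 0 < τ) (hμ : 0 ≤ μ)
    {z : ℂ} (hz : IsUpperCritical ε τ ξ μ z) :
    Tendsto (fun L : ℝ => corrKernel ε (τ * L) ⌊ξ * L⌋ ⌊μ * L⌋₊ ⌊ξ * L⌋ ⌊μ * L⌋₊) atTop
      (𝓝 ((1 / Real.pi * z.arg : ℝ) : ℂ)) := by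
  obtain ⟨harg, hzexp⟩ := exists_exp_eq_of_im_pos hz.1
  rw [hzexp, isUpperCritical_exp_iff_crit hε harg] at hz
  have ha := two_le_add_inv hε
  have hC := Real.one_le_cosh (Real.log ‖z‖)
  obtain ⟨hc1, hc2⟩ := cos_mem_Ioo harg
  refine (isSaddle_of_crit ⟨harg.1.le, harg.2.le⟩ (den_pos ha hC hc2) hz.1 ?_
    fun y _ => by rw [hz.2]; simp).tendsto_corrKernel hε hτ hμ
  generalize Real.cosh (Real.log ‖z‖) = C at hC
  generalize Real.cos z.arg = c at hc1 hc2
  generalize ε + ε⁻¹ = a at ha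
  have e : 4 * (C ^ 2 + c ^ 2 - a * C * c) + a ^ 2 - 4 =
      (a - 2 * C * c) ^ 2 + 4 * ((C ^ 2 - 1) * (1 - c ^ 2)) := by ring
  rw [e]
  rcases hC.eq_or_lt with rfl | hC
  · have : 0 < a - 2 * 1 * c := by linarith
    have : 0 < (a - 2 * 1 * c) ^ 2 := by positivity
    linarith
  · have : 0 < (C ^ 2 - 1) * (1 - c ^ 2) := mul_pos (by nlinarith) (by nlinarith)
    positivity

/-- Above the upper boundary curve the saddle point sits on the negative real axis. -/
theorem tendsto_corrKernel_of_critLevel_le {ε τ μ σ : ℝ} (hε : 0 < ε) (hτ : 0 < τ) (hμ : 0 ≤ μ)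
    (h : critLevel τ (ε + ε⁻¹) σ (-1) ≤ μ) {ξ : ℝ} (hξ : critSpeed τ (ε + ε⁻¹) σ (-1) = ξ) :
    Tendsto (fun L : ℝ => corrKernel ε (τ * L) ⌊ξ * L⌋ ⌊μ * L⌋₊ ⌊ξ * L⌋ ⌊μ * L⌋₊) atTop (𝓝 1) := by
  have ha := two_le_add_inv hε
  have hC := Real.one_le_cosh σ
  rw [← Real.cos_pi] at h hξ
  have := (isSaddle_of_crit ⟨Real.pi_pos.le, le_rfl⟩
    (by rw [Real.cos_pi]; exact den_pos ha hC (by norm_num)) hξ ?_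
    fun y hy => mul_nonpos_of_nonneg_of_nonpos (by rw [Real.cos_pi]; linarith [hy.1])
      (sub_nonpos.2 h)).tendsto_corrKernel hε hτ hμ
  · rwa [one_div_mul_cancel Real.pi_ne_zero, Complex.ofReal_one] at this
  · rw [Real.cos_pi]
    have : 0 < 2 * Real.cosh σ + (ε + ε⁻¹) := by linarith
    have : 0 < (2 * Real.cosh σ + (ε + ε⁻¹)) ^ 2 := by positivity
    linarith

/-- Below the lower boundary curve the saddle point sits on the positive real axis. -/
theorem tendsto_corrKernel_of_le_critLevel {ε τ μ σ : ℝ} (hε : 0 < ε) (hτ : 0 < τ) (hμ : 0 < μ)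
    (h : μ ≤ critLevel τ (ε + ε⁻¹) σ 1) {ξ : ℝ} (hξ : critSpeed τ (ε + ε⁻¹) σ 1 = ξ) :
    Tendsto (fun L : ℝ => corrKernel ε (τ * L) ⌊ξ * L⌋ ⌊μ * L⌋₊ ⌊ξ * L⌋ ⌊μ * L⌋₊) atTop (𝓝 0) := by
  have ha := two_le_add_inv hε
  have hC := Real.one_le_cosh σ
  have hpos : 0 < critLevel τ (ε + ε⁻¹) σ 1 := hμ.trans_le h
  have hden : 0 < (ε + ε⁻¹) * Real.cosh σ - 2 * 1 := by
    -- For `ε = 1` the denominator vanishes at `σ = 0`, but there `critLevel` is `0`, which is below `μ`.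
    refine lt_of_le_of_ne (by nlinarith) fun h0 => ?_
    rw [critLevel, ← h0, div_zero] at hpos
    exact hpos.false
  have hnum : 0 < 4 * (Real.cosh σ ^ 2 + 1 ^ 2 - (ε + ε⁻¹) * Real.cosh σ * 1) +
      (ε + ε⁻¹) ^ 2 - 4 := by
    rw [critLevel, div_pos_iff_of_pos_right hden] at hpos
    exact pos_of_mul_pos_right hpos (by positivity)
  rw [← Real.cos_zero] at h hξ hden hnum
  have := (isSaddle_of_crit ⟨le_rfl, Real.pi_pos.le⟩ hden hξ hnum
    fun y hy => mul_nonpos_of_nonpos_of_nonneg (by rw [Real.cos_zero]; linarith [hy.2])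
      (sub_nonneg.2 h)).tendsto_corrKernel hε hτ hμ.le
  rwa [mul_zero, Complex.ofReal_zero] at this

/-- Every point outside the domain is on or beyond one of the boundary curves, and `ξ` determines the real
saddle point on that side. -/
theorem tendsto_corrKernel_of_mem {ε τ : ℝ} (hε : 0 < ε) (hτ : 0 < τ) {ξ μ : ℝ} (hμ : 0 ≤ μ) :
    ((ξ, μ) ∈ domainD2 ε τ →
      Tendsto (fun L : ℝ => corrKernel ε (τ * L) ⌊ξ * L⌋ ⌊μ * L⌋₊ ⌊ξ * L⌋ ⌊μ * L⌋₊)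
        atTop (𝓝 1)) ∧
    ((ξ, μ) ∉ domainD1 ε τ → (ξ, μ) ∉ domainD2 ε τ →
      Tendsto (fun L : ℝ => corrKernel ε (τ * L) ⌊ξ * L⌋ ⌊μ * L⌋₊ ⌊ξ * L⌋ ⌊μ * L⌋₊)
        atTop (𝓝 0)) := by
  have ha := two_le_add_inv hε
  obtain ⟨lo, up, -, -, hlt, hlo, hup, hD⟩ := exists_domainD1_eq hε hτ
  have hmem : ∀ μ, (ξ, μ) ∈ domainD1 ε τ ↔ lo ξ < μ ∧ μ < up ξ := by
    intro μ; rw [hD]; rfl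
  constructor
  · rintro ⟨h1, μ', h2, h3⟩
    rw [hmem] at h3
    simp only [hmem, not_and, not_lt] at h1
    obtain ⟨σ, hσ⟩ := surjective_critSpeed (c := -1) hτ ha (by norm_num) ξ
    simp only at hσ
    refine tendsto_corrKernel_of_critLevel_le hε hτ hμ ?_ hσ
    rw [← hup, hσ]
    exact h1 (h3.1.trans h2)
  · intro h1 h2
    -- At `μ = 0` the level curve may degenerate to the poles, and the kernel vanishes identically.
    rcases hμ.eq_or_lt with rfl | hμ
    · simp only [zero_mul, Nat.floor_zero, corrKernel_diag_zero hε]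
      exact tendsto_const_nhds
    obtain ⟨σ, hσ⟩ := surjective_critSpeed (c := 1) hτ ha (by norm_num) ξ
    simp only at hσ
    refine tendsto_corrKernel_of_le_critLevel hε hτ hμ ?_ hσ
    rw [← hlo, hσ]
    by_contra hlt'
    have h3 : up ξ ≤ μ := by
      by_contra h4
      exact h1 ((hmem μ).2 ⟨lt_of_not_ge hlt', lt_of_not_ge h4⟩)
    obtain ⟨μ', h5, h6⟩ := exists_between (hlt ξ)
    exact h2 ⟨h1, μ', h6.trans_le h3, (hmem μ').2 ⟨h5, h6⟩⟩

/-! ### The frontier and its cusps -/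

/-- The region between two graphs is bounded by the graphs. -/
theorem frontier_between {lo up : ℝ → ℝ} (hlo : Continuous lo) (hup : Continuous up)
    (hlt : ∀ ξ, lo ξ < up ξ) :
    frontier {p : ℝ × ℝ | lo p.1 < p.2 ∧ p.2 < up p.1} = {p | p.2 = lo p.1 ∨ p.2 = up p.1} := by
  have hopen : IsOpen {p : ℝ × ℝ | lo p.1 < p.2 ∧ p.2 < up p.1} := by
    rw [Set.ofPred_and]
    exact (isOpen_lt (by fun_prop) (by fun_prop)).inter (isOpen_lt (by fun_prop) (by fun_prop))
  have hclosed : IsClosed {p : ℝ × ℝ | lo p.1 ≤ p.2 ∧ p.2 ≤ up p.1} := by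
    rw [Set.ofPred_and]
    exact (isClosed_le (by fun_prop) (by fun_prop)).inter (isClosed_le (by fun_prop) (by fun_prop))
  have hsub : ∀ ξ, ∀ μ ∈ Set.Icc (lo ξ) (up ξ),
      (ξ, μ) ∈ closure {p : ℝ × ℝ | lo p.1 < p.2 ∧ p.2 < up p.1} := by
    intro ξ μ hμ
    rw [← closure_Ioo (hlt ξ).ne] at hμ
    exact map_mem_closure (f := fun μ : ℝ => (ξ, μ)) (by fun_prop) hμ fun _ h => h
  rw [frontier, hopen.interior_eq]
  ext ⟨ξ, μ⟩
  constructor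
  · rintro ⟨h1, h2⟩
    obtain ⟨h3, h4⟩ : lo ξ ≤ μ ∧ μ ≤ up ξ :=
      closure_minimal (t := {p : ℝ × ℝ | lo p.1 ≤ p.2 ∧ p.2 ≤ up p.1})
        (fun _ hp => And.intro hp.1.le hp.2.le) hclosed h1
    rcases h3.eq_or_lt with h | h
    · exact Or.inl h.symm
    · exact Or.inr (h4.antisymm (not_lt.1 fun h5 => h2 ⟨h, h5⟩))
  · rintro (h | h)
    · simp only at h
      subst h
      exact ⟨hsub ξ _ ⟨le_rfl, (hlt ξ).le⟩, fun h => h.1.false⟩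
    · simp only at h
      subst h
      exact ⟨hsub ξ _ ⟨(hlt ξ).le, le_rfl⟩, fun h => h.2.false⟩

/-- A graph is locally an arc with respect to each smooth injective parametrization. -/
theorem isLocalArc_of_graph {S V : Set (ℝ × ℝ)} {g X Y : ℝ → ℝ} (hV : IsOpen V)
    (hS : ∀ q ∈ V, q ∈ S ↔ q.2 = g q.1) (hX : ContDiff ℝ ∞ X) (hY : ContDiff ℝ ∞ Y)
    (hmono : StrictMono X) (hsurj : Function.Surjective X) (hg : ∀ s, g (X s) = Y s)
    (hmem : ∀ s, (X s, Y s) ∈ V) (s₀ : ℝ) :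
    IsLocalArc S (X s₀, Y s₀) fun t => (X (s₀ + t), Y (s₀ + t)) := by
  refine ⟨by fun_prop, fun t _ t' _ h => ?_, by simp, ?_⟩
  · have := hmono.injective (congrArg Prod.fst h)
    linarith
  · refine ⟨V ∩ Prod.fst ⁻¹' Set.Ioo (X (s₀ - 1)) (X (s₀ + 1)), ?_, ?_⟩
    · exact (hV.inter (isOpen_Ioo.preimage continuous_fst)).mem_nhds
        ⟨hmem s₀, hmono (by linarith), hmono (by linarith)⟩
    · ext ⟨x, y⟩
      constructor
      · rintro ⟨h1, h2, h3, h4⟩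
        refine ⟨?_, h2, h3, h4⟩
        obtain ⟨s, rfl⟩ := hsurj x
        have h5 := hmono.lt_iff_lt.1 h3
        have h6 := hmono.lt_iff_lt.1 h4
        refine ⟨s - s₀, ⟨by linarith, by linarith⟩, ?_⟩
        have h7 := (hS _ h2).1 h1
        simp only [add_sub_cancel, Prod.mk.injEq, true_and]
        rw [← hg]
        exact h7.symm
      · rintro ⟨⟨t, -, h1⟩, h2⟩
        refine ⟨?_, h2⟩
        rw [hS _ h2.1, ← h1]
        exact (hg _).symm

/-- The derivatives at `0` of an arc whose components have derivatives with a double and a simple zero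
at `0`. -/
theorem linearIndependent_of_hasDerivAt_sinh {W V : ℝ → ℝ} {γ : ℝ → ℝ × ℝ} (hW : ContDiff ℝ ∞ W)
    (hV : ContDiff ℝ ∞ V)
    (hγ : ∀ s, HasDerivAt γ (Real.sinh s * (Real.sinh s * W s), Real.sinh s * V s) s)
    (hW0 : W 0 ≠ 0) (hV0 : V 0 ≠ 0) :
    deriv γ 0 = 0 ∧ LinearIndependent ℝ ![iteratedDeriv 2 γ 0, iteratedDeriv 3 γ 0] := by
  have hWd : ∀ s, HasDerivAt W (deriv W s) s := fun s =>
    (hW.differentiable (by simp) s).hasDerivAt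
  have hVd : ∀ s, HasDerivAt V (deriv V s) s := fun s =>
    (hV.differentiable (by simp) s).hasDerivAt
  have hdW : ContDiff ℝ ∞ (deriv W) := ((contDiff_infty_iff_deriv (𝕜 := ℝ)).1 hW).2
  have hdV : ContDiff ℝ ∞ (deriv V) := ((contDiff_infty_iff_deriv (𝕜 := ℝ)).1 hV).2
  have h1 : deriv γ = fun s => (Real.sinh s * (Real.sinh s * W s), Real.sinh s * V s) :=
    funext fun s => (hγ s).deriv
  have h2 : iteratedDeriv 2 γ = fun s => (Real.sinh s * (2 * Real.cosh s * W s +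
      Real.sinh s * deriv W s), Real.cosh s * V s + Real.sinh s * deriv V s) := by
    rw [iteratedDeriv_succ, iteratedDeriv_one, h1]
    funext s
    have e1 := (Real.hasDerivAt_sinh s).mul ((Real.hasDerivAt_sinh s).mul (hWd s))
    have e2 := (Real.hasDerivAt_sinh s).mul (hVd s)
    refine (e1.prodMk e2).deriv.trans ?_
    ext
    · simp only [Pi.mul_apply]; ring
    · rfl
  have h3 : iteratedDeriv 3 γ 0 = (2 * W 0, (iteratedDeriv 3 γ 0).2) := by
    rw [iteratedDeriv_succ, h2]
    have e1 : HasDerivAt (fun s => 2 * Real.cosh s * W s + Real.sinh s * deriv W s)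
        (deriv (fun s => 2 * Real.cosh s * W s + Real.sinh s * deriv W s) 0) 0 :=
      (ContDiff.differentiable (n := ∞) (by fun_prop) (by simp) 0).hasDerivAt
    have e2 : HasDerivAt (fun s => Real.cosh s * V s + Real.sinh s * deriv V s)
        (deriv (fun s => Real.cosh s * V s + Real.sinh s * deriv V s) 0) 0 :=
      (ContDiff.differentiable (n := ∞) (by fun_prop) (by simp) 0).hasDerivAt
    have e3 := ((Real.hasDerivAt_sinh 0).mul e1).prodMk e2
    rw [HasDerivAt.deriv (f := fun s => (Real.sinh s * (2 * Real.cosh s * W s +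
      Real.sinh s * deriv W s), Real.cosh s * V s + Real.sinh s * deriv V s)) e3]
    simp
  refine ⟨by rw [h1]; simp, ?_⟩
  rw [LinearIndependent.pair_iff, h3, h2]
  intro p q hpq
  simp only [Real.sinh_zero, Real.cosh_zero, Prod.smul_mk, Prod.mk_add_mk, Prod.mk_eq_zero,
    smul_eq_mul, zero_mul, mul_zero, one_mul, add_zero, zero_add] at hpq
  have hq : q = 0 := by
    rcases mul_eq_zero.1 hpq.1 with h | h
    · exact h
    · exact absurd h (by simpa using hW0)
  refine ⟨?_, hq⟩
  have := hpq.2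
  rw [hq, zero_mul, add_zero] at this
  exact (mul_eq_zero.1 this).resolve_right hV0

/-- The boundary curves, for `c = 1` the lower and for `c = -1` the upper one. -/
theorem hasDerivAt_crit {τ a c : ℝ} (ha : 2 < a) (hc : c = 1 ∨ c = -1) (s : ℝ) :
    HasDerivAt (fun s => (critSpeed τ a s c, critLevel τ a s c))
      (Real.sinh s * (Real.sinh s * (4 * τ * (2 * a * Real.cosh s ^ 2 - 6 * c * Real.cosh s + a) /
        (a * Real.cosh s - 2 * c) ^ 2)),
        Real.sinh s * (2 * τ * (((2 * Real.cosh s - c * a) ^ 2 +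
          4 * Real.cosh s * (2 * Real.cosh s - c * a)) * (a * Real.cosh s - 2 * c) -
          a * Real.cosh s * (2 * Real.cosh s - c * a) ^ 2) / (a * Real.cosh s - 2 * c) ^ 2)) s := by
  have hc1 : c ≤ 1 := by rcases hc with rfl | rfl <;> norm_num
  have hc2 : c ^ 2 = 1 := by rcases hc with rfl | rfl <;> norm_num
  have hden : a * Real.cosh s - 2 * c ≠ 0 :=
    (den_pos_of_two_lt ha (Real.one_le_cosh s) hc1).ne'
  have hC := Real.hasDerivAt_cosh s
  have hS := Real.hasDerivAt_sinh s
  have hD : HasDerivAt (fun s => a * Real.cosh s - 2 * c) (a * Real.sinh s) s :=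
    (hC.const_mul a).sub_const _
  have hC2 : HasDerivAt (fun s => Real.cosh s ^ 2) (2 * Real.cosh s * Real.sinh s) s := 
    (hC.fun_pow 2).congr_deriv (by simp)
  have hCS := Real.cosh_sq s
  refine HasDerivAt.prodMk ?_ ?_
  · refine (((hS.const_mul (4 * τ)).mul (hC2.sub_const (c ^ 2))).div hD hden).congr_deriv ?_
    simp only [Pi.mul_apply]
    rw [← mul_div_assoc, ← mul_div_assoc]
    congr 1
    linear_combination (4 * τ * (Real.cosh s * (a * Real.cosh s - 2 * c) - a * Real.sinh s ^ 2) +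
      4 * τ * Real.sinh s ^ 2 * a) * hCS -
      4 * τ * (Real.cosh s * (a * Real.cosh s - 2 * c) - a * Real.sinh s ^ 2) * hc2
  · refine (((hC.const_mul (2 * τ)).mul (((((hC2.add_const (c ^ 2)).sub
      ((hC.const_mul a).mul_const c)).const_mul 4).add_const (a ^ 2)).sub_const 4)).div
      hD hden).congr_deriv ?_
    simp only [Pi.mul_apply, Pi.sub_apply]
    rw [← mul_div_assoc]
    congr 1
    linear_combination (-4 * τ * c * Real.sinh s * (4 - a ^ 2)) * hc2

theorem contDiff_crit {τ a c : ℝ} (ha : 2 < a) (hc : c = 1 ∨ c = -1) :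
    ContDiff ℝ ∞ (fun s => critSpeed τ a s c) ∧ ContDiff ℝ ∞ (fun s => critLevel τ a s c) := by
  have hden : ∀ s, a * Real.cosh s - 2 * c ≠ 0 := fun s =>
    (den_pos_of_two_lt ha (Real.one_le_cosh s) (by rcases hc with rfl | rfl <;> norm_num)).ne'
  have hD : ContDiff ℝ ∞ fun s => a * Real.cosh s - 2 * c := by fun_prop
  exact ⟨ContDiff.div (by fun_prop) hD hden, ContDiff.div (by fun_prop) hD hden⟩

/-- A boundary curve of the domain has a cusp at the parameter `0` and is regular elsewhere. -/
theorem isCuspPoint_and_isRegularCurvePoint_of_graph {τ a c : ℝ} (hτ : 0 < τ) (ha : 2 < a)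
    (hc : c = 1 ∨ c = -1) {S V : Set (ℝ × ℝ)} {g : ℝ → ℝ} (hV : IsOpen V)
    (hS : ∀ q ∈ V, q ∈ S ↔ q.2 = g q.1) (hg : ∀ s, g (critSpeed τ a s c) = critLevel τ a s c)
    (hmem : ∀ s, (critSpeed τ a s c, critLevel τ a s c) ∈ V) :
    IsCuspPoint S (0, 2 * τ * (a - 2 * c)) ∧
      ∀ p : ℝ × ℝ, p.2 = g p.1 → p ≠ (0, 2 * τ * (a - 2 * c)) → IsRegularCurvePoint S p := by
  have hcI : c ∈ Set.Icc (-1 : ℝ) 1 := by rcases hc with rfl | rfl <;> norm_num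
  have hc2 : c ^ 2 = 1 := by rcases hc with rfl | rfl <;> norm_num
  have hden : ∀ s, 0 < a * Real.cosh s - 2 * c := fun s =>
    den_pos_of_two_lt ha (Real.one_le_cosh s) hcI.2
  obtain ⟨hX, hY⟩ := contDiff_crit (τ := τ) ha hc
  have harc := isLocalArc_of_graph hV hS hX hY (strictMono_critSpeed hτ ha.le hcI)
    (surjective_critSpeed hτ ha.le hcI) hg hmem
  constructor
  · have h0 := harc 0
    simp only [zero_add, critSpeed_zero, critLevel_zero] at h0
    refine ⟨_, h0, linearIndependent_of_hasDerivAt_sinh (W := fun s => 4 * τ *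
      (2 * a * Real.cosh s ^ 2 - 6 * c * Real.cosh s + a) / (a * Real.cosh s - 2 * c) ^ 2)
      (V := fun s => 2 * τ * (((2 * Real.cosh s - c * a) ^ 2 +
          4 * Real.cosh s * (2 * Real.cosh s - c * a)) * (a * Real.cosh s - 2 * c) -
          a * Real.cosh s * (2 * Real.cosh s - c * a) ^ 2) / (a * Real.cosh s - 2 * c) ^ 2)
      ?_ ?_ (hasDerivAt_crit ha hc) ?_ ?_⟩
    · exact ContDiff.div (by fun_prop) (by fun_prop) fun s => pow_ne_zero 2 (hden s).ne'
    · exact ContDiff.div (by fun_prop) (by fun_prop) fun s => pow_ne_zero 2 (hden s).ne'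
    · have h1 := hden 0
      rw [Real.cosh_zero, mul_one] at h1
      simp only [Real.cosh_zero]
      have : 4 * τ * (2 * a * 1 ^ 2 - 6 * c * 1 + a) / (a * 1 - 2 * c) ^ 2 =
          12 * τ / (a - 2 * c) := by
        field_simp
        ring
      rw [this]
      positivity
    · have h1 := hden 0
      rw [Real.cosh_zero, mul_one] at h1
      simp only [Real.cosh_zero]
      have : 2 * τ * (((2 * 1 - c * a) ^ 2 + 4 * 1 * (2 * 1 - c * a)) * (a * 1 - 2 * c) -
          a * 1 * (2 * 1 - c * a) ^ 2) / (a * 1 - 2 * c) ^ 2 = -12 * τ * c := by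
        rw [div_eq_iff (by rw [mul_one]; positivity)]
        rcases hc with rfl | rfl <;> ring
      rw [this]
      have hc0 : c ≠ 0 := by rintro rfl; norm_num at hc2
      have := hτ.ne'
      simp [hc0, this]
  · rintro ⟨x, y⟩ hp hne
    obtain ⟨s, rfl⟩ := surjective_critSpeed hτ ha.le hcI x
    simp only at hp
    rw [hg] at hp
    subst hp
    have hs : s ≠ 0 := by
      rintro rfl
      exact hne (by simp [critSpeed_zero, critLevel_zero])
    refine ⟨_, harc s, fun h0 => ?_⟩
    have hd := (hasDerivAt_crit (τ := τ) ha hc (s + 0)).comp_const_add s 0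
    rw [hd.deriv, add_zero] at h0
    have h1 := congrArg Prod.fst h0
    have hS0 : Real.sinh s ≠ 0 := by rwa [Ne, Real.sinh_eq_zero]
    have hC := Real.one_le_cosh s
    have hnum : 0 < 2 * a * Real.cosh s ^ 2 - 6 * c * Real.cosh s + a := by
      nlinarith [hcI.2, hcI.1]
    have hW : 0 < 4 * τ * (2 * a * Real.cosh s ^ 2 - 6 * c * Real.cosh s + a) /
        (a * Real.cosh s - 2 * c) ^ 2 := by
      have := hden s
      positivity
    exact mul_ne_zero hS0 (mul_ne_zero hS0 hW.ne') h1

theorem two_lt_add_inv {ε : ℝ} (hε : 0 < ε) (h1 : ε ≠ 1) : 2 < ε + ε⁻¹ := by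
  have h : Real.log ε ≠ 0 := Real.log_ne_zero_of_pos_of_ne_one hε h1
  have := Real.one_lt_cosh.2 h
  rw [Real.cosh_log hε] at this
  linarith

theorem frontier_domainD1 {ε τ : ℝ} (hε : 0 < ε) (hτ : 0 < τ) (hε1 : ε ≠ 1) :
    IsCuspPoint (frontier (domainD1 ε τ)) (0, 2 * τ * (ε + ε⁻¹ - 2)) ∧
      IsCuspPoint (frontier (domainD1 ε τ)) (0, 2 * τ * (ε + ε⁻¹ + 2)) ∧
      ∀ p ∈ frontier (domainD1 ε τ),
        p ≠ (0, 2 * τ * (ε + ε⁻¹ - 2)) → p ≠ (0, 2 * τ * (ε + ε⁻¹ + 2)) →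
          IsRegularCurvePoint (frontier (domainD1 ε τ)) p := by
  have ha := two_lt_add_inv hε hε1
  obtain ⟨lo, up, hloc, hupc, hlt, hlo, hup, hD⟩ := exists_domainD1_eq hε hτ
  have hfr : frontier (domainD1 ε τ) = {p | p.2 = lo p.1 ∨ p.2 = up p.1} := by
    rw [hD, frontier_between hloc hupc hlt]
  rw [hfr]
  obtain ⟨h1, h2⟩ := isCuspPoint_and_isRegularCurvePoint_of_graph hτ ha (Or.inl rfl)
    (S := {p | p.2 = lo p.1 ∨ p.2 = up p.1}) (V := {p | p.2 < up p.1}) (g := lo)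
    (isOpen_lt (by fun_prop) (by fun_prop))
    (fun q hq => or_iff_left (ne_of_lt hq)) hlo (fun s => by
      change critLevel τ (ε + ε⁻¹) s 1 < up (critSpeed τ (ε + ε⁻¹) s 1)
      rw [← hlo]
      exact hlt _)
  obtain ⟨h3, h4⟩ := isCuspPoint_and_isRegularCurvePoint_of_graph hτ ha (Or.inr rfl)
    (S := {p | p.2 = lo p.1 ∨ p.2 = up p.1}) (V := {p | lo p.1 < p.2}) (g := up)
    (isOpen_lt (by fun_prop) (by fun_prop))
    (fun q hq => or_iff_right (ne_of_gt hq)) hup (fun s => by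
      change lo (critSpeed τ (ε + ε⁻¹) s (-1)) < critLevel τ (ε + ε⁻¹) s (-1)
      rw [← hup]
      exact hlt _)
  rw [show ε + ε⁻¹ - 2 * -1 = ε + ε⁻¹ + 2 by ring] at h3 h4
  rw [mul_one] at h1 h2
  exact ⟨h1, h3, fun p hp hp1 hp2 => hp.elim (fun h => h2 p h hp1) fun h => h4 p h hp2⟩

theorem theorem1 (ε τ : ℝ) (hε : 0 < ε) (hτ : 0 < τ) :
    (ε ≠ 1 →
      IsCuspPoint (frontier (domainD1 ε τ)) (0, 2 * τ * (ε + ε⁻¹ - 2)) ∧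
      IsCuspPoint (frontier (domainD1 ε τ)) (0, 2 * τ * (ε + ε⁻¹ + 2)) ∧
      ∀ p ∈ frontier (domainD1 ε τ),
        p ≠ (0, 2 * τ * (ε + ε⁻¹ - 2)) → p ≠ (0, 2 * τ * (ε + ε⁻¹ + 2)) →
          IsRegularCurvePoint (frontier (domainD1 ε τ)) p) ∧
    (∀ ξ μ : ℝ, 0 ≤ μ →
      ((ξ, μ) ∈ domainD2 ε τ →
        Tendsto (fun L : ℝ => corrKernel ε (τ * L) ⌊ξ * L⌋ ⌊μ * L⌋₊ ⌊ξ * L⌋ ⌊μ * L⌋₊)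
          atTop (𝓝 1)) ∧
      ((ξ, μ) ∈ domainD1 ε τ →
        ∃ z : ℂ, IsUpperCritical ε τ ξ μ z ∧ (∀ z', IsUpperCritical ε τ ξ μ z' → z' = z) ∧
          Tendsto (fun L : ℝ => corrKernel ε (τ * L) ⌊ξ * L⌋ ⌊μ * L⌋₊ ⌊ξ * L⌋ ⌊μ * L⌋₊)
            atTop (𝓝 ((1 / Real.pi * z.arg : ℝ) : ℂ))) ∧
      ((ξ, μ) ∉ domainD1 ε τ → (ξ, μ) ∉ domainD2 ε τ →
        Tendsto (fun L : ℝ => corrKernel ε (τ * L) ⌊ξ * L⌋ ⌊μ * L⌋₊ ⌊ξ * L⌋ ⌊μ * L⌋₊)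
          atTop (𝓝 0))) := by
  refine ⟨frontier_domainD1 hε hτ, fun ξ μ hμ => ?_⟩
  obtain ⟨h2, h0⟩ := tendsto_corrKernel_of_mem hε hτ (ξ := ξ) hμ
  refine ⟨h2, ?_, h0⟩
  rintro ⟨-, z, hz⟩
  exact ⟨z, hz, fun z' hz' => hz.unique hε hτ hz', tendsto_corrKernel_of_isUpperCritical hε hτ hμ hz⟩
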